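/- Let $d\in\mathbb N$, $p,q\in(1,\infty)$, $\alpha,\beta>0$, and let $\Omega\subset\mathbb R^d$ be closed and convex. Let $W_p(\Omega)$ be the space of probability measures on $\Omega$ with finite $p$-th moment, endowed with the $p$-Wasserstein distance. For a Lipschitz curve $\mu:[0,1]\to W_p(\Omega)$, a *velocity field* of $\mu$ is a Borel field $v$ with $v_t\in L^p(\mu_t;\mathbb R^d)$ for a.e. $t$ such that, for all $\phi\in C^1_c(\mathbb R^d)$, the function $s\mapsto\int_\Omega\nabla\phi\cdot v_s\,d\mu_s$ is integrable on $[0,1]$ and $$\int_\Omega\phi\,d\mu_{t_2}-\int_\Omega\phi\,d\mu_{t_1}=\int_{t_1}^{t_2}\!\int_\Omega\nabla\phi\cdot v_s\,d\mu_s\,ds\qquad\text{for all }0\le t_1<t_2\le 1 .$$ The *tangent field* of $\mu$ is the velocity field $v$ such that, for every velocity field $w$ of $\mu$, $\|v_t\|_{L^p(\mu_t)}\le\|w_t\|_{L^p(\mu_t)}$ for a.e. $t$. Put $V(t)=V(\mu,t)=\int_\Omega|v_t|^p\,d\mu_t$ with $v$ the tangent field, $L_q(\nu)=\int_\Omega u^q\,dx$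 if $\nu=u\,\mathcal L^d$ and $L_q(\nu)=+\infty$ otherwise, and $$\mathfrak F(\mu)=\int_0^1 L_q(\mu_t)^\alpha\,V(\mu,t)^\beta\,dt\in[0,\infty]\qquad(\text{with }\infty\cdot 0=0).$$ Let $\mu$ minimize $\mathfrak F$ among all Lipschitz curves $[0,1]\to W_p(\Omega)$ with given endpoints $\mu_0,\mu_1$, with $\mathfrak F(\mu)<\infty$, and let $v$ be its tangent field. Assume that on every interval $[a,b]\subset(0,1)$ there is $V_0>0$ with $V(t)\ge V_0$ for a.e. $t\in[a,b]$ (for instance, $V\ge V_0>0$ a.e. on $[0,1]$). Then $\mu_t=u_t\,\mathcal L^d$ is absolutely continuous for a.e. $t$, and, with $F(t)=L_q(\mu_t)$, for every $\xi\in C_c^\infty\big((0,1)\times\operatorname{int}\Omega;\mathbb R^d\big)$ $$\alpha(1-q)\int_0^1F^{\alpha-1}V^{\beta}\int_\Omega(\nabla\cdot\xi)\,u_t^q\,dx\,dt+p\beta\int_0^1F^{\alpha}V^{\beta-1}\int_\Omega u_t|v_t|^{p-2}\big(\nabla\xi\cdot v_t+\partial_t\xi\big)\cdot v_t\,dx\,dt=0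 ,$$ where the inner integrands are integrable on $\Omega$ for a.e. $t$ and the outer integrands are integrable on $[0,1]$. -/

import Mathlib

open MeasureTheory Set
open scoped NNReal ENNReal
open scoped ContDiff

namespace WGeod

noncomputable section

/-- `ℝ^d` with its Euclidean norm. -/
abbrev Space (d : ℕ) : Type := EuclideanSpace ℝ (Fin d)

variable {d : ℕ}

/-- `γ` is a transport plan (coupling) between `μ` and `ν`. -/
def IsCoupling (μ ν : Measure (Space d)) (γ : Measure (Space d × Space d)) : Prop :=
  γ.map Prod.fst = μ ∧ γ.map Prod.snd = ν

/-- The Wasserstein distance of order `p`: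
`W_p(μ,ν) = (inf_γ ∫ |x - y|^p dγ(x,y))^(1/p)` over all couplings `γ`. -/
def wassersteinDist (p : ℝ) (μ ν : Measure (Space d)) : ℝ≥0∞ :=
  (⨅ (γ : Measure (Space d × Space d)) (_ : IsCoupling μ ν γ),
    ∫⁻ z, ‖z.1 - z.2‖ₑ ^ p ∂γ) ^ (1 / p)

/-- Membership in `W_p(Ω)`: probability measures on `Ω` with finite `p`-th moment. -/
structure MemWp (p : ℝ) (Ω : Set (Space d)) (μ : Measure (Space d)) : Prop where
  isProb : IsProbabilityMeasure μ
  concentrated : μ Ωᶜ = 0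
  moment : ∫⁻ x, ‖x‖ₑ ^ p ∂μ < ⊤

/-- `μ` is a Lipschitz curve `[0,1] → W_p(Ω)` (the values `μ t` with `t ∉ [0,1]` play no role). -/
structure IsLipschitzCurve (p : ℝ) (Ω : Set (Space d)) (μ : ℝ → Measure (Space d)) : Prop where
  mem : ∀ t ∈ Icc (0 : ℝ) 1, MemWp p Ω (μ t)
  lip : ∃ C : ℝ≥0, ∀ s ∈ Icc (0 : ℝ) 1, ∀ t ∈ Icc (0 : ℝ) 1,
    wassersteinDist p (μ s) (μ t) ≤ C * ENNReal.ofReal |s - t|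

/-- `v` is a velocity field of the curve `μ`: a Borel field with `v_t ∈ L^p(μ_t)` for a.e. `t`
that solves the continuity equation, tested against all `φ ∈ C^1_c`. Since `Ω` is closed and the
measures live on `Ω`, the test functions are the restrictions to `Ω` of functions in `C^1_c(ℝ^d)`:
they need not vanish on the boundary of `Ω`. -/
structure IsVelocityField (p : ℝ) (μ : ℝ → Measure (Space d)) (v : ℝ → Space d → Space d) :
    Prop where
  measurable : Measurable (Function.uncurry v)
  memLp : ∀ᵐ t ∂(volume.restrict (Icc (0 : ℝ) 1)), MemLp (v t) (ENNReal.ofReal p) (μ t)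
  integrable : ∀ φ : Space d → ℝ, ContDiff ℝ 1 φ → HasCompactSupport φ →
    IntegrableOn (fun s => ∫ x, fderiv ℝ φ x (v s x) ∂(μ s)) (Icc (0 : ℝ) 1)
  continuity_eq : ∀ φ : Space d → ℝ, ContDiff ℝ 1 φ → HasCompactSupport φ →
    ∀ t₁ ∈ Icc (0 : ℝ) 1, ∀ t₂ ∈ Icc (0 : ℝ) 1, t₁ < t₂ →
      ∫ x, φ x ∂(μ t₂) - ∫ x, φ x ∂(μ t₁) = ∫ s in t₁..t₂, ∫ x, fderiv ℝ φ x (v s x) ∂(μ s)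

/-- `v` is the tangent field of the curve `μ`: a velocity field which, for a.e. `t`, has minimal
`L^p(μ_t)` norm among all velocity fields. -/
structure IsTangentField (p : ℝ) (μ : ℝ → Measure (Space d)) (v : ℝ → Space d → Space d) :
    Prop where
  velocity : IsVelocityField p μ v
  minimal : ∀ w : ℝ → Space d → Space d, IsVelocityField p μ w →
    ∀ᵐ t ∂(volume.restrict (Icc (0 : ℝ) 1)),
      eLpNorm (v t) (ENNReal.ofReal p) (μ t) ≤ eLpNorm (w t) (ENNReal.ofReal p) (μ t)

open Classical in
/-- `L_q(ν) = ∫_Ω u^q dx` if `ν = u · Lebesgue`, and `+∞` otherwise. -/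
def Lq (q : ℝ) (Ω : Set (Space d)) (ν : Measure (Space d)) : ℝ≥0∞ :=
  if ν ≪ volume then ∫⁻ x in Ω, (ν.rnDeriv volume x) ^ q else ⊤

/-- `∫ |v_t|^p dμ_t`, which is `V(μ,t)` when `v` is the tangent field of `μ`. -/
def kinetic (p : ℝ) (μ : ℝ → Measure (Space d)) (v : ℝ → Space d → Space d) (t : ℝ) : ℝ≥0∞ :=
  ∫⁻ x, ‖v t x‖ₑ ^ p ∂(μ t)

/-- `∫_0^1 L_q(μ_t)^α (∫ |v_t|^p dμ_t)^β dt`. -/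
def energyOf (p q α β : ℝ) (Ω : Set (Space d)) (μ : ℝ → Measure (Space d))
    (v : ℝ → Space d → Space d) : ℝ≥0∞ :=
  ∫⁻ t in Icc (0 : ℝ) 1, (Lq q Ω (μ t)) ^ α * (kinetic p μ v t) ^ β

/-- The functional `𝔉(μ) = ∫_0^1 L_q(μ_t)^α V(μ,t)^β dt` with `V(μ,t) = ∫ |v_t|^p dμ_t` and `v` the
tangent field of `μ`. The infimum only selects the tangent field: all tangent fields of `μ` give
the same value, see `energy_eq`. -/
def energy (p q α β : ℝ) (Ω : Set (Space d)) (μ : ℝ → Measure (Space d)) : ℝ≥0∞ :=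
  ⨅ (v : ℝ → Space d → Space d) (_ : IsTangentField p μ v), energyOf p q α β Ω μ v

lemma kinetic_eq {p : ℝ} (hp : 0 < p) (μ : ℝ → Measure (Space d)) (v : ℝ → Space d → Space d)
    (t : ℝ) : kinetic p μ v t = eLpNorm (v t) (ENNReal.ofReal p) (μ t) ^ p := by
  have h0 : ENNReal.ofReal p ≠ 0 := by simpa using hp
  rw [eLpNorm_eq_lintegral_rpow_enorm_toReal h0 ENNReal.ofReal_ne_top,
    ENNReal.toReal_ofReal hp.le, ← ENNReal.rpow_mul, one_div, inv_mul_cancel₀ hp.ne',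
    ENNReal.rpow_one]
  rfl

lemma energy_eq {p : ℝ} (hp : 0 < p) (q α β : ℝ) (Ω : Set (Space d))
    (μ : ℝ → Measure (Space d)) (v : ℝ → Space d → Space d) (hv : IsTangentField p μ v) :
    energy p q α β Ω μ = energyOf p q α β Ω μ v := by
  refine le_antisymm (iInf₂_le v hv) (le_iInf₂ fun w hw => le_of_eq ?_)
  refine lintegral_congr_ae ?_
  filter_upwards [hv.minimal w hw.velocity, hw.minimal v hv.velocity] with t h₁ h₂
  rw [kinetic_eq hp, kinetic_eq hp, le_antisymm h₁ h₂]

/-- `Γ(μ₀,μ₁)`: Lipschitz curves in `W_p(Ω)` from `μ₀` to `μ₁`. -/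
structure IsAdmissible (p : ℝ) (Ω : Set (Space d)) (μ₀ μ₁ : Measure (Space d))
    (μ : ℝ → Measure (Space d)) : Prop where
  curve : IsLipschitzCurve p Ω μ
  init : μ 0 = μ₀
  final : μ 1 = μ₁

/-- `μ` minimizes `𝔉` among the curves in `Γ(μ₀,μ₁)`. -/
structure IsMinimizer (p q α β : ℝ) (Ω : Set (Space d)) (μ₀ μ₁ : Measure (Space d))
    (μ : ℝ → Measure (Space d)) : Prop where
  admissible : IsAdmissible p Ω μ₀ μ₁ μ
  le : ∀ ν : ℝ → Measure (Space d), IsAdmissible p Ω μ₀ μ₁ ν →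
    energy p q α β Ω μ ≤ energy p q α β Ω ν

/-- The Lebesgue density of `ν` (relevant where `ν ≪ volume`). -/
def density (ν : Measure (Space d)) (x : Space d) : ℝ := (ν.rnDeriv volume x).toReal

/-- The divergence in space, `∇ · ξ = ∑ i, ∂ξ_i/∂x_i` at `(t, x)`. -/
def divergence (ξ : ℝ × Space d → Space d) (t : ℝ) (x : Space d) : ℝ :=
  ∑ i : Fin d, (fderiv ℝ (fun y => ξ (t, y)) x (EuclideanSpace.single i 1)) i

/-- The vector `∇ξ · w + ∂ξ/∂t` at `(t, x)`. -/
def transportDeriv (ξ : ℝ × Space d → Space d) (t : ℝ) (x w : Space d) : Space d :=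
  fderiv ℝ (fun y => ξ (t, y)) x w + deriv (fun s => ξ (s, x)) t

/-- The inner integrand `(∇ · ξ) u_t^q`. -/
def pressureIntegrand (q : ℝ) (μ : ℝ → Measure (Space d)) (ξ : ℝ × Space d → Space d)
    (t : ℝ) (x : Space d) : ℝ :=
  divergence ξ t x * density (μ t) x ^ q

/-- The inner integrand `u_t |v_t|^(p-2) (∇ξ · v_t + ∂ξ/∂t) · v_t`. -/
def momentumIntegrand (p : ℝ) (μ : ℝ → Measure (Space d)) (v : ℝ → Space d → Space d)
    (ξ : ℝ × Space d → Space d) (t : ℝ) (x : Space d) : ℝ :=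
  density (μ t) x * ‖v t x‖ ^ (p - 2) * inner ℝ (transportDeriv ξ t x (v t x)) (v t x)

/-- `t ↦ F(t)^(α-1) V(t)^β ∫_Ω (∇ · ξ) u_t^q dx`, with `F(t) = L_q(μ_t)` and
`V(t) = ∫ |v_t|^p dμ_t`. -/
def pressureTerm (p q α β : ℝ) (Ω : Set (Space d)) (μ : ℝ → Measure (Space d))
    (v : ℝ → Space d → Space d) (ξ : ℝ × Space d → Space d) (t : ℝ) : ℝ :=
  (Lq q Ω (μ t)).toReal ^ (α - 1) * (kinetic p μ v t).toReal ^ β *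
    ∫ x in Ω, pressureIntegrand q μ ξ t x

/-- `t ↦ F(t)^α V(t)^(β-1) ∫_Ω u_t |v_t|^(p-2) (∇ξ · v_t + ∂ξ/∂t) · v_t dx`, with
`F(t) = L_q(μ_t)` and `V(t) = ∫ |v_t|^p dμ_t`. -/
def momentumTerm (p q α β : ℝ) (Ω : Set (Space d)) (μ : ℝ → Measure (Space d))
    (v : ℝ → Space d → Space d) (ξ : ℝ × Space d → Space d) (t : ℝ) : ℝ :=
  (Lq q Ω (μ t)).toReal ^ α * (kinetic p μ v t).toReal ^ (β - 1) *
    ∫ x in Ω, momentumIntegrand p μ v ξ t x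

end

end WGeod

/-!
The minimizer is compared with the curves obtained by pushing `μ t` forward under
`x ↦ x + ε • ξ (t, x)`. The push-forward inherits from the tangent field `v` the explicit velocity
field `v + ε • (∇ξ · v + ∂ξ/∂t)`, transported along the map, so by minimality of the tangent field
its energy is at most an explicit function of `ε`, with equality at `ε = 0`. Once this function is
known to be differentiable at `0`, its derivative vanishes there, which is the asserted identity:
the change of variables gives `F_ε = ∫ u ^ q * det (1 + ε • ∇ξ) ^ (1 - q)`, with derivative
`(1 - q) * ∫ (∇ · ξ) * u ^ q`, and the kinetic energy is differentiated under the integral sign.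

The lower bound on `V` over the time support of `ξ` makes both `ε`-dependent factors Lipschitz with
a constant proportional to their value at `ε = 0`. Hence the difference quotients of
`F_ε ^ α * V_ε ^ β` are dominated by a multiple of `F ^ α * V ^ β`, even when `α < 1` or `β < 1`.

The energy of a curve is defined through its tangent field, so the perturbed curve must be shown to
have one: it is an element of least norm among the velocity fields of given divergence, a closed
affine subspace of `L ^ p`, where minimizing sequences converge because the space is uniformly
convex.
-/

namespace WGeod

open Filter ProbabilityTheory
open scoped Topology

variable {d : ℕ}

section Coupling

lemma IsCoupling.isProbabilityMeasure {μ ν : Measure (Space d)} [IsProbabilityMeasure μ]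
    {γ : Measure (Space d × Space d)} (h : IsCoupling μ ν γ) : IsProbabilityMeasure γ := by
  have : IsProbabilityMeasure (γ.map Prod.fst) := by rwa [h.1]
  exact Measure.isProbabilityMeasure_of_map Prod.fst

lemma wassersteinDist_le_of_isCoupling {p : ℝ} (hp : 0 ≤ p) {μ ν : Measure (Space d)}
    {γ : Measure (Space d × Space d)} (h : IsCoupling μ ν γ) :
    wassersteinDist p μ ν ≤ (∫⁻ z, ‖z.1 - z.2‖ₑ ^ p ∂γ) ^ (1 / p) :=
  ENNReal.rpow_le_rpow (iInf₂_le γ h) (one_div_nonneg.2 hp)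

lemma exists_isCoupling_lintegral_rpow_lt {p : ℝ} (hp : 0 < p) {μ ν : Measure (Space d)}
    {c : ℝ≥0∞} (h : wassersteinDist p μ ν < c) :
    ∃ γ, IsCoupling μ ν γ ∧ ∫⁻ z, ‖z.1 - z.2‖ₑ ^ p ∂γ < c ^ p := by
  have h' := ENNReal.rpow_lt_rpow h hp
  rw [wassersteinDist, one_div, ENNReal.rpow_inv_rpow hp.ne'] at h'
  simpa only [iInf_lt_iff, exists_prop] using h'

lemma exists_isCoupling_integral_norm_le {p : ℝ} (hp : 1 ≤ p) {μ ν : Measure (Space d)}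
    [IsProbabilityMeasure μ] {w : ℝ} (hw : 0 ≤ w) (h : wassersteinDist p μ ν < ENNReal.ofReal w) :
    ∃ γ, IsCoupling μ ν γ ∧ Integrable (fun z => z.1 - z.2) γ ∧
      ∫ z, ‖z.1 - z.2‖ ∂γ ≤ w := by
  have hp₀ : 0 < p := zero_lt_one.trans_le hp
  obtain ⟨γ, hγ, hlt⟩ := exists_isCoupling_lintegral_rpow_lt hp₀ h
  have := hγ.isProbabilityMeasure
  have hmeas : AEStronglyMeasurable (fun z : Space d × Space d => z.1 - z.2) γ :=
    (measurable_fst.sub measurable_snd).aestronglyMeasurable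
  have hnorm : eLpNorm (fun z : Space d × Space d => z.1 - z.2) 1 γ ≤ ENNReal.ofReal w :=
    calc eLpNorm (fun z : Space d × Space d => z.1 - z.2) 1 γ
        ≤ eLpNorm (fun z : Space d × Space d => z.1 - z.2) (ENNReal.ofReal p) γ :=
          eLpNorm_le_eLpNorm_of_exponent_le (by simpa using hp) hmeas
      _ = (∫⁻ z, ‖z.1 - z.2‖ₑ ^ p ∂γ) ^ p⁻¹ := by
          rw [eLpNorm_eq_lintegral_rpow_enorm_toReal (by simpa using hp₀) ENNReal.ofReal_ne_top,
            ENNReal.toReal_ofReal hp₀.le, one_div]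
      _ ≤ (ENNReal.ofReal w ^ p) ^ p⁻¹ := by gcongr
      _ = ENNReal.ofReal w := ENNReal.rpow_rpow_inv hp₀.ne' _
  refine ⟨γ, hγ, memLp_one_iff_integrable.1 ⟨hmeas, hnorm.trans_lt ENNReal.ofReal_lt_top⟩, ?_⟩
  rw [integral_norm_eq_lintegral_enorm hmeas, ← eLpNorm_one_eq_lintegral_enorm]
  exact ENNReal.toReal_le_of_le_ofReal hw hnorm

lemma IsCoupling.abs_integral_sub_integral_le {μ ν : Measure (Space d)} [IsProbabilityMeasure μ]
    {γ : Measure (Space d × Space d)} (hγ : IsCoupling μ ν γ)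
    (hint : Integrable (fun z => z.1 - z.2) γ) {G H : Space d → ℝ} (hG : Integrable G μ)
    (hH : Integrable H ν) {a b : ℝ} (hGH : ∀ x y, |G x - H y| ≤ a + b * ‖x - y‖) :
    |∫ x, G x ∂μ - ∫ y, H y ∂ν| ≤ a + b * ∫ z, ‖z.1 - z.2‖ ∂γ := by
  have := hγ.isProbabilityMeasure
  rw [← hγ.1] at hG
  rw [← hγ.2] at hH
  have hG' : Integrable (fun z : Space d × Space d => G z.1) γ := hG.comp_measurable measurable_fst
  have hH' : Integrable (fun z : Space d × Space d => H z.2) γ := hH.comp_measurable measurable_snd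
  have hbound : Integrable (fun z : Space d × Space d => b * ‖z.1 - z.2‖) γ := hint.norm.const_mul b
  calc |∫ x, G x ∂μ - ∫ y, H y ∂ν|
      = |∫ z, (G z.1 - H z.2) ∂γ| := by
        rw [integral_sub hG' hH', ← integral_map measurable_fst.aemeasurable hG.1,
          ← integral_map measurable_snd.aemeasurable hH.1, hγ.1, hγ.2]
    _ ≤ ∫ z : Space d × Space d, (a + b * ‖z.1 - z.2‖) ∂γ :=
        abs_integral_le_integral_abs.trans <| integral_mono (hG'.sub hH').abs
          ((integrable_const a).add hbound) fun z => hGH _ _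
    _ = a + b * ∫ z : Space d × Space d, ‖z.1 - z.2‖ ∂γ := by
        rw [integral_add (integrable_const a) hbound, integral_const_mul]
        simp

lemma abs_integral_sub_integral_le_of_wassersteinDist_le {p : ℝ} (hp : 1 ≤ p)
    {μ ν : Measure (Space d)} [IsProbabilityMeasure μ] {G H : Space d → ℝ} (hG : Integrable G μ)
    (hH : Integrable H ν) {a b w : ℝ} (hb : 0 ≤ b) (hw : 0 ≤ w)
    (hGH : ∀ x y, |G x - H y| ≤ a + b * ‖x - y‖)
    (hW : wassersteinDist p μ ν ≤ ENNReal.ofReal w) :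
    |∫ x, G x ∂μ - ∫ y, H y ∂ν| ≤ a + b * w := by
  have hlt : ∀ w' > w, |∫ x, G x ∂μ - ∫ y, H y ∂ν| ≤ a + b * w' := fun w' hw' => by
    have hw'₀ : 0 < w' := hw.trans_lt hw'
    obtain ⟨γ, hγ, hint, hle⟩ := exists_isCoupling_integral_norm_le hp hw'₀.le
      (hW.trans_lt ((ENNReal.ofReal_lt_ofReal_iff hw'₀).2 hw'))
    exact (hγ.abs_integral_sub_integral_le hint hG hH hGH).trans (by gcongr)
  have hlim : Tendsto (fun w' => a + b * w') (𝓝[>] w) (𝓝 (a + b * w)) :=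
    Continuous.continuousWithinAt (by fun_prop)
  exact ge_of_tendsto hlim (eventually_nhdsWithin_of_forall hlt)

end Coupling

section LipschitzCurve

variable {p : ℝ} {Ω : Set (Space d)} {μ : ℝ → Measure (Space d)}

lemma exists_dist_le_add_mul_dist_of_uniformContinuous {X Y : Type*} [PseudoMetricSpace X]
    [PseudoMetricSpace Y] {g : X → Y} (hg : UniformContinuous g) {B : ℝ}
    (hB : ∀ x y, dist (g x) (g y) ≤ B) {ε : ℝ} (hε : 0 < ε) :
    ∃ K, 0 ≤ K ∧ ∀ x y, dist (g x) (g y) ≤ ε + K * dist x y := by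
  obtain ⟨δ, hδ, hgδ⟩ := Metric.uniformContinuous_iff.1 hg ε hε
  refine ⟨|B| / δ, by positivity, fun x y => ?_⟩
  rcases lt_or_ge (dist x y) δ with hxy | hxy
  · exact (hgδ hxy).le.trans (le_add_of_nonneg_right (by positivity))
  · calc dist (g x) (g y) ≤ |B| / δ * δ := by
          rw [div_mul_cancel₀ _ hδ.ne']
          exact (hB x y).trans (le_abs_self B)
      _ ≤ |B| / δ * dist x y := by gcongr
      _ ≤ ε + |B| / δ * dist x y := le_add_of_nonneg_left hε.le

lemma IsLipschitzCurve.exists_wassersteinDist_le (h : IsLipschitzCurve p Ω μ) :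
    ∃ C : ℝ, 0 ≤ C ∧ ∀ s ∈ Icc (0 : ℝ) 1, ∀ t ∈ Icc (0 : ℝ) 1,
      wassersteinDist p (μ s) (μ t) ≤ ENNReal.ofReal (C * |s - t|) := by
  obtain ⟨C, hC⟩ := h.lip
  refine ⟨C, C.2, fun s hs t ht => (hC s hs t ht).trans_eq ?_⟩
  rw [ENNReal.ofReal_mul (NNReal.coe_nonneg C), ENNReal.ofReal_coe_nnreal]

lemma IsLipschitzCurve.continuousOn_integral (hp : 1 ≤ p) (h : IsLipschitzCurve p Ω μ)
    {g : Space d → ℝ} (hg : UniformContinuous g) {B : ℝ} (hB : ∀ x, |g x| ≤ B) :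
    ContinuousOn (fun t => ∫ x, g x ∂(μ t)) (Icc 0 1) := by
  obtain ⟨C, hC₀, hC⟩ := h.exists_wassersteinDist_le
  have hint : ∀ t ∈ Icc (0 : ℝ) 1, Integrable g (μ t) := fun t ht => by
    have := (h.mem t ht).isProb
    exact Integrable.of_bound hg.continuous.aestronglyMeasurable B (ae_of_all _ hB)
  have hosc : ∀ x y, dist (g x) (g y) ≤ B + B := fun x y =>
    (dist_le_norm_add_norm _ _).trans (add_le_add (hB x) (hB y))
  refine fun t ht => Metric.continuousWithinAt_iff'.2 fun ε hε => ?_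
  obtain ⟨K, hK₀, hK⟩ :=
    exists_dist_le_add_mul_dist_of_uniformContinuous hg hosc (half_pos hε)
  have hsmall : ∀ᶠ s in 𝓝[Icc 0 1] t, K * (C * |s - t|) < ε / 2 :=
    (Continuous.continuousWithinAt (by fun_prop)).eventually_lt_const (by simpa using hε)
  filter_upwards [hsmall, self_mem_nhdsWithin] with s hs hsI
  have := (h.mem s hsI).isProb
  have hle := abs_integral_sub_integral_le_of_wassersteinDist_le hp (hint s hsI) (hint t ht) hK₀
    (mul_nonneg hC₀ (abs_nonneg _)) (fun x y => by simpa [dist_eq_norm] using hK x y)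
    (hC s hsI t ht)
  rw [Real.dist_eq]
  linarith

lemma measurable_of_forall_measurable_integral {T X : Type*} [MeasurableSpace T]
    [PseudoEMetricSpace X] [MeasurableSpace X] [BorelSpace X] {κ : T → Measure X}
    [∀ t, IsProbabilityMeasure (κ t)]
    (h : ∀ g : X → ℝ, UniformContinuous g → (∀ x, |g x| ≤ 1) →
      Measurable fun t => ∫ x, g x ∂(κ t)) :
    Measurable κ := by
  refine Measurable.measure_of_isPiSystem_of_isProbabilityMeasure (S := {s : Set X | IsClosed s})
    (by rw [← borel_eq_generateFrom_isClosed]; exact BorelSpace.measurable_eq)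
    isPiSystem_isClosed fun F hF => ?_
  obtain ⟨δ, -, hδ, hδ₀⟩ := exists_seq_strictAnti_tendsto (0 : ℝ)
  refine measurable_of_tendsto_metrizable (fun n => ?_) (tendsto_pi_nhds.2 fun t =>
    tendsto_lintegral_thickenedIndicator_of_isClosed (κ t) hF hδ hδ₀)
  let g : X → ℝ := fun x => thickenedIndicator (hδ n) F x
  have hg : UniformContinuous g :=
    NNReal.isUniformEmbedding_coe.uniformContinuous.comp
      (lipschitzWith_thickenedIndicator (hδ n) F).uniformContinuous
  have hg₁ : ∀ x, |g x| ≤ 1 := fun x => by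
    rw [abs_of_nonneg (NNReal.coe_nonneg _)]
    exact_mod_cast thickenedIndicator_le_one (hδ n) F x
  have hlintegral : (fun t => ∫⁻ x, (thickenedIndicator (hδ n) F x : ℝ≥0∞) ∂(κ t))
      = fun t => ENNReal.ofReal (∫ x, g x ∂(κ t)) := by
    funext t
    rw [ofReal_integral_eq_lintegral_ofReal
      (Integrable.of_bound hg.continuous.aestronglyMeasurable 1 (ae_of_all _ hg₁))
      (ae_of_all _ fun x => NNReal.coe_nonneg _)]
    simp only [g, ENNReal.ofReal_coe_nnreal]
  rw [hlintegral]
  exact (h g hg hg₁).ennreal_ofReal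

lemma IsLipschitzCurve.exists_kernel (hp : 1 ≤ p) (h : IsLipschitzCurve p Ω μ) :
    ∃ κ : Kernel ℝ (Space d), IsMarkovKernel κ ∧ ∀ t ∈ Icc (0 : ℝ) 1, κ t = μ t := by
  let clamp : ℝ → ℝ := fun t => projIcc 0 1 zero_le_one t
  have hclamp : ∀ t, clamp t ∈ Icc (0 : ℝ) 1 := fun t => (projIcc 0 1 zero_le_one t).2
  have hprob : ∀ t, IsProbabilityMeasure (μ (clamp t)) := fun t => (h.mem _ (hclamp t)).isProb
  have hmeas : Measurable fun t => μ (clamp t) :=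
    measurable_of_forall_measurable_integral fun g hg hg₁ =>
      ((h.continuousOn_integral hp hg hg₁).comp_continuous
        (continuous_subtype_val.comp continuous_projIcc) hclamp).measurable
  refine ⟨⟨fun t => μ (clamp t), hmeas⟩, ⟨hprob⟩, fun t ht => ?_⟩
  simp only [Kernel.coe_mk, clamp, projIcc_of_mem zero_le_one ht]

end LipschitzCurve

section TestFunctions

variable {p : ℝ} {Ω : Set (Space d)} {μ : ℝ → Measure (Space d)} {v : ℝ → Space d → Space d}

/-- Hypotheses on `ψ : ℝ × ℝ^d → ℝ` under which the continuity equation, imposed on `C^1_c`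
functions of space only, extends to `ψ`. Compactness of the support is only asked at each fixed
time, so that `(t, x) ↦ φ (T_t x)` is allowed for a smooth family of diffeomorphisms `T_t`. -/
structure IsTimeTest (ψ : ℝ × Space d → ℝ) : Prop where
  contDiff : ContDiff ℝ 1 ψ
  bounded : ∃ B : ℝ, ∀ z, ‖fderiv ℝ ψ z‖ ≤ B
  uniformContinuous : UniformContinuous (fderiv ℝ ψ)
  hasCompactSupport : ∀ t, HasCompactSupport fun x => ψ (t, x)

lemma hasDerivAt_of_forall_approx {m : ℝ → ℝ} {f t : ℝ}
    (h : ∀ ε > 0, ∃ (m' : ℝ → ℝ) (f' : ℝ), HasDerivAt m' f' t ∧ |f - f'| ≤ ε ∧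
      ∀ᶠ s in 𝓝 t, |m s - m' s - (m t - m' t)| ≤ ε * |s - t|) :
    HasDerivAt m f t := by
  rw [hasDerivAt_iff_isLittleO, Asymptotics.isLittleO_iff]
  intro ε hε
  obtain ⟨m', f', hm', hf, hs⟩ := h (ε / 3) (by positivity)
  rw [hasDerivAt_iff_isLittleO, Asymptotics.isLittleO_iff] at hm'
  filter_upwards [hs, hm' (by positivity : 0 < ε / 3)] with s hdiff hm's
  simp only [smul_eq_mul, Real.norm_eq_abs] at hm's ⊢
  have hslope : |(s - t) * (f - f')| ≤ ε / 3 * |s - t| := by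
    rw [abs_mul, mul_comm]
    gcongr
  calc |m s - m t - (s - t) * f| = |(m s - m' s - (m t - m' t))
        + (m' s - m' t - (s - t) * f') + -((s - t) * (f - f'))| := by congr 1; ring
    _ ≤ |m s - m' s - (m t - m' t)| + |m' s - m' t - (s - t) * f'| + |-((s - t) * (f - f'))| :=
        abs_add_three _ _ _
    _ ≤ ε / 3 * |s - t| + ε / 3 * |s - t| + ε / 3 * |s - t| := by
        rw [abs_neg]
        gcongr
    _ = ε * |s - t| := by ring

lemma IsVelocityField.ae_hasDerivAt (hv : IsVelocityField p μ v) {φ : Space d → ℝ}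
    (hφ : ContDiff ℝ 1 φ) (hc : HasCompactSupport φ) :
    ∀ᵐ t ∂(volume.restrict (Icc (0 : ℝ) 1)),
      HasDerivAt (fun s => ∫ x, φ x ∂(μ s)) (∫ x, fderiv ℝ φ x (v t x) ∂(μ t)) t := by
  have hint : IntervalIntegrable (fun s => ∫ x, fderiv ℝ φ x (v s x) ∂(μ s)) volume 0 1 := by
    rw [intervalIntegrable_iff_integrableOn_Icc_of_le zero_le_one]
    exact hv.integrable φ hφ hc
  rw [← restrict_Ioo_eq_restrict_Icc, ae_restrict_iff' measurableSet_Ioo]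
  filter_upwards [hint.ae_hasDerivAt_integral] with t ht htI
  have hprimitive := ht (by simpa using Ioo_subset_Icc_self htI) 0 (by simp)
  refine (hprimitive.const_add (∫ x, φ x ∂(μ 0))).congr_of_eventuallyEq ?_
  filter_upwards [Ioo_mem_nhds htI.1 htI.2] with s hs
  linarith [hv.continuity_eq φ hφ hc 0 (by simp) s (Ioo_subset_Icc_self hs) hs.1]

lemma integrable_clm_apply {X E : Type*} [MeasurableSpace X] [NormedAddCommGroup E]
    [NormedSpace ℝ E] {M : Measure X} {L : X → E →L[ℝ] ℝ} (hL : AEStronglyMeasurable L M) {B : ℝ}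
    (hB : ∀ x, ‖L x‖ ≤ B) {g : X → E} (hg : Integrable g M) :
    Integrable (fun x => L x (g x)) M :=
  (hg.norm.const_mul B).mono'
    (isBoundedBilinearMap_apply.continuous.comp_aestronglyMeasurable (hL.prodMk hg.1))
    (ae_of_all _ fun x => (L x).le_of_opNorm_le (hB x) (g x))

lemma integrable_fderiv_apply_of_hasCompactSupport {φ : Space d → ℝ} (hφ : ContDiff ℝ 1 φ)
    (hc : HasCompactSupport φ) {ν : Measure (Space d)} {w : Space d → Space d}
    (hw : Integrable w ν) : Integrable (fun x => fderiv ℝ φ x (w x)) ν := by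
  have hcont := hφ.continuous_fderiv one_ne_zero
  obtain ⟨B, hB⟩ := hcont.bounded_above_of_compact_support (hc.fderiv ℝ)
  exact integrable_clm_apply hcont.aestronglyMeasurable hB hw

lemma IsLipschitzCurve.exists_abs_integral_sub_integral_le (hp : 1 ≤ p)
    (hμ : IsLipschitzCurve p Ω μ) :
    ∃ C : ℝ, 0 ≤ C ∧ ∀ (f : Space d → ℝ) (η : ℝ), ContDiff ℝ 1 f → HasCompactSupport f →
      (∀ x, ‖fderiv ℝ f x‖ ≤ η) → ∀ s ∈ Icc (0 : ℝ) 1, ∀ t ∈ Icc (0 : ℝ) 1,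
        |∫ x, f x ∂(μ s) - ∫ x, f x ∂(μ t)| ≤ η * (C * |s - t|) := by
  obtain ⟨C, hC₀, hC⟩ := hμ.exists_wassersteinDist_le
  refine ⟨C, hC₀, fun f η hf hc hη s hs t ht => ?_⟩
  have hint : ∀ r ∈ Icc (0 : ℝ) 1, Integrable f (μ r) := fun r hr => by
    have := (hμ.mem r hr).isProb
    exact hf.continuous.integrable_of_hasCompactSupport hc
  have hlip : ∀ x y, |f x - f y| ≤ 0 + η * ‖x - y‖ := fun x y => by
    rw [zero_add]
    exact convex_univ.norm_image_sub_le_of_norm_fderiv_le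
      (fun z _ => hf.differentiable one_ne_zero z) (fun z _ => hη z) (mem_univ y) (mem_univ x)
  have := (hμ.mem s hs).isProb
  simpa only [zero_add] using abs_integral_sub_integral_le_of_wassersteinDist_le hp (hint s hs)
    (hint t ht) ((norm_nonneg _).trans (hη 0)) (mul_nonneg hC₀ (abs_nonneg (s - t))) hlip
    (hC s hs t ht)

lemma IsLipschitzCurve.hasDerivAt_integral_of_forall_approx (hp : 1 ≤ p)
    (hμ : IsLipschitzCurve p Ω μ) {t : ℝ} (ht : t ∈ Ioo (0 : ℝ) 1) {w : Space d → Space d}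
    (hw : Integrable w (μ t)) {φ : Space d → ℝ} (hφ : ContDiff ℝ 1 φ) (hc : HasCompactSupport φ)
    (happrox : ∀ ε > 0, ∃ φ' : Space d → ℝ, ContDiff ℝ 1 φ' ∧ HasCompactSupport φ' ∧
      (∀ x, ‖fderiv ℝ φ x - fderiv ℝ φ' x‖ ≤ ε) ∧
      HasDerivAt (fun s => ∫ x, φ' x ∂(μ s)) (∫ x, fderiv ℝ φ' x (w x) ∂(μ t)) t) :
    HasDerivAt (fun s => ∫ x, φ x ∂(μ s)) (∫ x, fderiv ℝ φ x (w x) ∂(μ t)) t := by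
  obtain ⟨C, hC₀, hC⟩ := hμ.exists_abs_integral_sub_integral_le hp
  have hint : ∀ {f : Space d → ℝ}, ContDiff ℝ 1 f → HasCompactSupport f → ∀ s ∈ Icc (0 : ℝ) 1,
      Integrable f (μ s) := fun hf hfc s hs => by
    have := (hμ.mem s hs).isProb
    exact hf.continuous.integrable_of_hasCompactSupport hfc
  have hN : 0 ≤ ∫ x, ‖w x‖ ∂(μ t) := integral_nonneg fun _ => norm_nonneg _
  set N : ℝ := ∫ x, ‖w x‖ ∂(μ t)
  refine hasDerivAt_of_forall_approx fun ε hε => ?_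
  set η : ℝ := ε / (1 + C + N)
  have hη : 0 < η := by positivity
  have hηε : η * (1 + C + N) = ε := div_mul_cancel₀ _ (by positivity)
  obtain ⟨φ', hφ', hc', hclose, hderiv⟩ := happrox η hη
  refine ⟨_, _, hderiv, ?_, ?_⟩
  · rw [← integral_sub (integrable_fderiv_apply_of_hasCompactSupport hφ hc hw)
      (integrable_fderiv_apply_of_hasCompactSupport hφ' hc' hw)]
    calc |∫ x, (fderiv ℝ φ x (w x) - fderiv ℝ φ' x (w x)) ∂(μ t)| ≤ ∫ x, η * ‖w x‖ ∂(μ t) :=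
          norm_integral_le_of_norm_le (hw.norm.const_mul η) (ae_of_all _ fun x =>
            (fderiv ℝ φ x - fderiv ℝ φ' x).le_of_opNorm_le (hclose x) (w x))
      _ = η * N := integral_const_mul _ _
      _ ≤ ε := by rw [← hηε]; gcongr; linarith
  · filter_upwards [Icc_mem_nhds ht.1 ht.2] with s hs
    have htI := Ioo_subset_Icc_self ht
    rw [← integral_sub (hint hφ hc s hs) (hint hφ' hc' s hs),
      ← integral_sub (hint hφ hc t htI) (hint hφ' hc' t htI)]
    calc _ ≤ η * (C * |s - t|) := hC (fun x => φ x - φ' x) η (hφ.sub hφ') (hc.sub hc')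
          (fun x => by
            rw [fderiv_fun_sub (hφ.differentiable one_ne_zero x)
              (hφ'.differentiable one_ne_zero x)]
            exact hclose x) s hs t htI
      _ = η * C * |s - t| := by ring
      _ ≤ ε * |s - t| := by rw [← hηε]; gcongr; linarith

namespace IsTimeTest

variable {ψ : ℝ × Space d → ℝ}

lemma differentiable (h : IsTimeTest ψ) : Differentiable ℝ ψ :=
  h.contDiff.differentiable one_ne_zero

lemma continuous_fderiv_slice (h : IsTimeTest ψ) (t : ℝ) :
    Continuous fun x => fderiv ℝ ψ (t, x) :=
  h.uniformContinuous.continuous.comp (Continuous.prodMk_right t)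

lemma contDiff_slice (h : IsTimeTest ψ) (t : ℝ) : ContDiff ℝ 1 fun x => ψ (t, x) :=
  h.contDiff.comp (contDiff_const.prodMk contDiff_id)

lemma fderiv_slice (h : IsTimeTest ψ) (t : ℝ) (x : Space d) :
    fderiv ℝ (fun x => ψ (t, x)) x =
      (fderiv ℝ ψ (t, x)).comp (ContinuousLinearMap.inr ℝ ℝ (Space d)) :=
  ((h.differentiable (t, x)).hasFDerivAt.comp x (hasFDerivAt_prodMk_right t x)).fderiv

lemma integrable_slice (h : IsTimeTest ψ) (t : ℝ) (ν : Measure (Space d)) [IsFiniteMeasure ν] :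
    Integrable (fun x => ψ (t, x)) ν :=
  (h.contDiff_slice t).continuous.integrable_of_hasCompactSupport (h.hasCompactSupport t)

lemma integrable_fderiv_apply (h : IsTimeTest ψ) (t a : ℝ) {ν : Measure (Space d)}
    [IsFiniteMeasure ν] {w : Space d → Space d} (hw : Integrable w ν) :
    Integrable (fun x => fderiv ℝ ψ (t, x) (a, w x)) ν := by
  obtain ⟨B, hB⟩ := h.bounded
  exact integrable_clm_apply (h.continuous_fderiv_slice t).aestronglyMeasurable
    (fun x => hB (t, x)) ((integrable_const a).prodMk hw)

lemma abs_sub_le (h : IsTimeTest ψ) {B : ℝ} (hB : ∀ z, ‖fderiv ℝ ψ z‖ ≤ B) (z z' : ℝ × Space d) :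
    |ψ z - ψ z'| ≤ B * ‖z - z'‖ :=
  convex_univ.norm_image_sub_le_of_norm_fderiv_le (fun x _ => h.differentiable x)
    (fun x _ => hB x) (mem_univ z') (mem_univ z)

lemma lipschitzOnWith_integral (h : IsTimeTest ψ) (hp : 1 ≤ p) (hμ : IsLipschitzCurve p Ω μ) :
    ∃ K, LipschitzOnWith K (fun t => ∫ x, ψ (t, x) ∂(μ t)) (Icc 0 1) := by
  obtain ⟨B, hB⟩ := h.bounded
  have hB₀ : 0 ≤ B := (norm_nonneg _).trans (hB (0, 0))
  obtain ⟨C, hC₀, hC⟩ := hμ.exists_wassersteinDist_le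
  refine ⟨(B + B * C).toNNReal, LipschitzOnWith.of_dist_le_mul fun s hs t ht => ?_⟩
  have := (hμ.mem s hs).isProb
  have := (hμ.mem t ht).isProb
  have hosc : ∀ x y, |ψ (s, x) - ψ (t, y)| ≤ B * |s - t| + B * ‖x - y‖ := fun x y => by
    refine (h.abs_sub_le hB (s, x) (t, y)).trans ?_
    rw [← mul_add]
    gcongr
    exact max_le (by simp) (by simp)
  rw [Real.dist_eq, Real.dist_eq, Real.coe_toNNReal _ (by positivity), add_mul, mul_assoc B C]
  exact abs_integral_sub_integral_le_of_wassersteinDist_le hp (h.integrable_slice s (μ s))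
    (h.integrable_slice t (μ t)) hB₀ (mul_nonneg hC₀ (abs_nonneg (s - t))) hosc (hC s hs t ht)

lemma eventually_norm_fderiv_sub_le (h : IsTimeTest ψ) (t : ℝ) {ε : ℝ} (hε : 0 < ε) :
    ∀ᶠ s in 𝓝 t, ∀ x, ‖fderiv ℝ ψ (s, x) - fderiv ℝ ψ (t, x)‖ ≤ ε := by
  obtain ⟨δ, hδ, hψδ⟩ := Metric.uniformContinuous_iff.1 h.uniformContinuous ε hε
  filter_upwards [Metric.ball_mem_nhds t hδ] with s hs x
  rw [← dist_eq_norm]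
  exact (hψδ (by simpa [Prod.dist_eq, hδ] using hs)).le

lemma eventually_abs_sub_sub_le (h : IsTimeTest ψ) (t : ℝ) {ε : ℝ} (hε : 0 < ε) :
    ∀ᶠ s in 𝓝 t, ∀ x,
      |ψ (s, x) - ψ (t, x) - (s - t) * fderiv ℝ ψ (t, x) (1, 0)| ≤ ε * |s - t| := by
  obtain ⟨δ, hδ, hψδ⟩ := Metric.eventually_nhds_iff_ball.1 (h.eventually_norm_fderiv_sub_le t hε)
  filter_upwards [Metric.ball_mem_nhds t hδ] with s hs x
  have hline : ∀ r, HasDerivAt (fun r => ψ (r, x) - r * fderiv ℝ ψ (t, x) (1, 0))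
      ((fderiv ℝ ψ (r, x) - fderiv ℝ ψ (t, x)) (1, 0)) r := fun r => by
    exact (((h.differentiable (r, x)).hasFDerivAt.comp_hasDerivAt r
      ((hasDerivAt_id r).prodMk (hasDerivAt_const r x))).sub
      ((hasDerivAt_id r).mul_const (fderiv ℝ ψ (t, x) (1, 0)))).congr_deriv (by simp)
  have hmean := (convex_ball t δ).norm_image_sub_le_of_norm_hasDerivWithin_le (C := ε)
    (fun r _ => (hline r).hasDerivWithinAt)
    (fun r hr => ((fderiv ℝ ψ (r, x) - fderiv ℝ ψ (t, x)).le_of_opNorm_le (hψδ r hr x) (1, 0)).trans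
      (by simp [Prod.norm_def])) (Metric.mem_ball_self hδ) hs
  rw [Real.norm_eq_abs, Real.norm_eq_abs] at hmean
  convert hmean using 2
  ring

lemma hasDerivAt_integral_time (h : IsTimeTest ψ) (hp : 1 ≤ p) (hμ : IsLipschitzCurve p Ω μ)
    {t : ℝ} (ht : t ∈ Ioo (0 : ℝ) 1) :
    HasDerivAt (fun s => ∫ x, (ψ (s, x) - ψ (t, x)) ∂(μ s))
      (∫ x, fderiv ℝ ψ (t, x) (1, 0) ∂(μ t)) t := by
  obtain ⟨B, hB⟩ := h.bounded
  let g : Space d → ℝ := fun x => fderiv ℝ ψ (t, x) (1, 0)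
  have hg : UniformContinuous g :=
    ((ContinuousLinearMap.apply ℝ ℝ ((1, 0) : ℝ × Space d)).uniformContinuous.comp
      h.uniformContinuous).comp (uniformContinuous_const.prodMk uniformContinuous_id)
  have hgB : ∀ x, |g x| ≤ B := fun x =>
    ((fderiv ℝ ψ (t, x)).le_of_opNorm_le (hB _) (1, 0)).trans (by simp [Prod.norm_def])
  have hcont : ContinuousAt (fun s => ∫ x, g x ∂(μ s)) t :=
    (hμ.continuousOn_integral hp hg hgB).continuousAt (Icc_mem_nhds ht.1 ht.2)
  rw [hasDerivAt_iff_isLittleO, Asymptotics.isLittleO_iff]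
  intro ε hε
  filter_upwards [h.eventually_abs_sub_sub_le t (half_pos hε), Icc_mem_nhds ht.1 ht.2,
    Metric.continuousAt_iff'.1 hcont (ε / 2) (half_pos hε)] with s hincr hsI hnear
  have := (hμ.mem s hsI).isProb
  have hgint : Integrable g (μ s) :=
    Integrable.of_bound hg.continuous.aestronglyMeasurable B (ae_of_all _ hgB)
  have hψint : Integrable (fun x => ψ (s, x) - ψ (t, x)) (μ s) :=
    (h.integrable_slice s _).sub (h.integrable_slice t _)
  have htaylor : |∫ x, (ψ (s, x) - ψ (t, x)) ∂(μ s) - (s - t) * ∫ x, g x ∂(μ s)|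
      ≤ ε / 2 * |s - t| := by
    rw [← integral_const_mul, ← integral_sub hψint (hgint.const_mul _)]
    simpa using norm_integral_le_of_norm_le_const
      (f := fun x => ψ (s, x) - ψ (t, x) - (s - t) * g x) (ae_of_all (μ s) hincr)
  have hdrift : |(s - t) * (∫ x, g x ∂(μ s) - ∫ x, g x ∂(μ t))| ≤ ε / 2 * |s - t| := by
    rw [abs_mul, mul_comm]
    exact mul_le_mul_of_nonneg_right hnear.le (abs_nonneg _)
  simp only [sub_self, integral_zero, sub_zero, smul_eq_mul, Real.norm_eq_abs]
  calc |∫ x, (ψ (s, x) - ψ (t, x)) ∂(μ s) - (s - t) * ∫ x, g x ∂(μ t)|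
      = |(∫ x, (ψ (s, x) - ψ (t, x)) ∂(μ s) - (s - t) * ∫ x, g x ∂(μ s))
          + (s - t) * (∫ x, g x ∂(μ s) - ∫ x, g x ∂(μ t))| := by congr 1; ring
    _ ≤ ε / 2 * |s - t| + ε / 2 * |s - t| := (abs_add_le _ _).trans (add_le_add htaylor hdrift)
    _ = ε * |s - t| := by ring

/- The null set of times where the continuity equation fails to be differentiable depends on the
test function. Testing with the countably many slices `ψ (r, ·)`, `r ∈ ℚ`, gives one null set, off
which `ψ (t, ·)` is reached by approximation in `C^1`. -/
lemma hasDerivAt_integral (h : IsTimeTest ψ) (hp : 1 ≤ p) (hμ : IsLipschitzCurve p Ω μ) {t : ℝ}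
    (ht : t ∈ Ioo (0 : ℝ) 1) {w : Space d → Space d} (hw : Integrable w (μ t))
    (hrat : ∀ r : ℚ, HasDerivAt (fun s => ∫ x, ψ ((r : ℝ), x) ∂(μ s))
      (∫ x, fderiv ℝ (fun x => ψ ((r : ℝ), x)) x (w x) ∂(μ t)) t) :
    HasDerivAt (fun s => ∫ x, ψ (s, x) ∂(μ s)) (∫ x, fderiv ℝ ψ (t, x) (1, w x) ∂(μ t)) t := by
  have htI := Ioo_subset_Icc_self ht
  have := (hμ.mem t htI).isProb
  have hspace : HasDerivAt (fun s => ∫ x, ψ (t, x) ∂(μ s))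
      (∫ x, fderiv ℝ (fun x => ψ (t, x)) x (w x) ∂(μ t)) t := by
    refine hμ.hasDerivAt_integral_of_forall_approx hp ht hw (h.contDiff_slice t)
      (h.hasCompactSupport t) fun ε hε => ?_
    obtain ⟨r, hr⟩ := Rat.denseRange_cast.exists_mem_open isOpen_interior
      ⟨t, mem_interior_iff_mem_nhds.2 (h.eventually_norm_fderiv_sub_le t hε)⟩
    refine ⟨_, h.contDiff_slice r, h.hasCompactSupport r, fun x => ?_, hrat r⟩
    calc ‖fderiv ℝ (fun x => ψ (t, x)) x - fderiv ℝ (fun x => ψ ((r : ℝ), x)) x‖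
        = ‖(fderiv ℝ ψ (t, x) - fderiv ℝ ψ ((r : ℝ), x)).comp
            (ContinuousLinearMap.inr ℝ ℝ (Space d))‖ := by
          rw [h.fderiv_slice, h.fderiv_slice, ContinuousLinearMap.sub_comp]
      _ ≤ ‖fderiv ℝ ψ (t, x) - fderiv ℝ ψ ((r : ℝ), x)‖ :=
          (ContinuousLinearMap.opNorm_comp_le _ _).trans <|
            mul_le_of_le_one_right (norm_nonneg _) (ContinuousLinearMap.norm_inr_le_one ℝ ℝ _)
      _ ≤ ε := by
          rw [norm_sub_rev]
          exact interior_subset hr x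
  have hsum := (h.hasDerivAt_integral_time hp hμ ht).add hspace
  have hderiv : ∫ x, fderiv ℝ ψ (t, x) (1, w x) ∂(μ t) = ∫ x, fderiv ℝ ψ (t, x) (1, 0) ∂(μ t)
      + ∫ x, fderiv ℝ (fun x => ψ (t, x)) x (w x) ∂(μ t) := by
    rw [← integral_add (h.integrable_fderiv_apply t 1 (w := fun _ => 0) (integrable_zero _ _ _))
      (integrable_fderiv_apply_of_hasCompactSupport (h.contDiff_slice t) (h.hasCompactSupport t)
        hw)]
    refine integral_congr_ae (ae_of_all _ fun x => ?_)
    simp [h.fderiv_slice, ← map_add]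
  rw [hderiv]
  refine hsum.congr_of_eventuallyEq ?_
  filter_upwards [Icc_mem_nhds ht.1 ht.2] with s hs
  have := (hμ.mem s hs).isProb
  simp [integral_sub (h.integrable_slice s (μ s)) (h.integrable_slice t (μ s))]

lemma ae_hasDerivAt (h : IsTimeTest ψ) (hp : 1 ≤ p) (hμ : IsLipschitzCurve p Ω μ)
    (hv : IsVelocityField p μ v) :
    ∀ᵐ t ∂(volume.restrict (Icc (0 : ℝ) 1)),
      HasDerivAt (fun s => ∫ x, ψ (s, x) ∂(μ s)) (∫ x, fderiv ℝ ψ (t, x) (1, v t x) ∂(μ t)) t := by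
  have hrat := ae_all_iff.2 fun r : ℚ =>
    hv.ae_hasDerivAt (h.contDiff_slice r) (h.hasCompactSupport r)
  have hmem := hv.memLp
  rw [← restrict_Ioo_eq_restrict_Icc] at hrat hmem ⊢
  filter_upwards [hrat, ae_restrict_mem measurableSet_Ioo, hmem] with t ht htI hLp
  have := (hμ.mem t (Ioo_subset_Icc_self htI)).isProb
  exact h.hasDerivAt_integral hp hμ htI (hLp.integrable (by simpa using hp)) ht

lemma integrableOn_and_integral_sub_eq (h : IsTimeTest ψ) (hp : 1 ≤ p)
    (hμ : IsLipschitzCurve p Ω μ) (hv : IsVelocityField p μ v) :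
    IntegrableOn (fun t => ∫ x, fderiv ℝ ψ (t, x) (1, v t x) ∂(μ t)) (Icc (0 : ℝ) 1) ∧
    ∀ t₁ ∈ Icc (0 : ℝ) 1, ∀ t₂ ∈ Icc (0 : ℝ) 1,
      ∫ x, ψ (t₂, x) ∂(μ t₂) - ∫ x, ψ (t₁, x) ∂(μ t₁)
        = ∫ s in t₁..t₂, ∫ x, fderiv ℝ ψ (s, x) (1, v s x) ∂(μ s) := by
  obtain ⟨K, hK⟩ := h.lipschitzOnWith_integral hp hμ
  set m : ℝ → ℝ := fun t => ∫ x, ψ (t, x) ∂(μ t)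
  have hac : ∀ t₁ ∈ Icc (0 : ℝ) 1, ∀ t₂ ∈ Icc (0 : ℝ) 1, AbsolutelyContinuousOnInterval m t₁ t₂ :=
    fun t₁ h₁ t₂ h₂ => (hK.mono (uIcc_subset_Icc h₁ h₂)).absolutelyContinuousOnInterval
  have hderiv : deriv m =ᵐ[volume.restrict (Icc (0 : ℝ) 1)]
      fun t => ∫ x, fderiv ℝ ψ (t, x) (1, v t x) ∂(μ t) :=
    (h.ae_hasDerivAt hp hμ hv).mono fun t ht => ht.deriv
  constructor
  · have hint := (hac 0 (by simp) 1 (by simp)).intervalIntegrable_deriv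
    rw [intervalIntegrable_iff_integrableOn_Icc_of_le zero_le_one] at hint
    exact hint.congr hderiv
  · intro t₁ h₁ t₂ h₂
    rw [← (hac t₁ h₁ t₂ h₂).integral_deriv_eq_sub]
    refine intervalIntegral.integral_congr_ae ?_
    filter_upwards [(ae_restrict_iff' measurableSet_Icc).1 hderiv] with t ht htI
    exact ht (uIcc_subset_Icc h₁ h₂ (uIoc_subset_uIcc htI))

end IsTimeTest

end TestFunctions

section UniformConvexity

variable {p : ℝ} {X : Type*} [NormedAddCommGroup X] [NormedSpace ℝ X]

/-- The defect `(‖a‖ ^ p + ‖b‖ ^ p) / 2 - ‖(a + b) / 2‖ ^ p` in the midpoint convexity of the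
`p`-th power of the norm. -/
noncomputable def midpointDefect (p : ℝ) (a b : X) : ℝ :=
  (‖a‖ ^ p + ‖b‖ ^ p) / 2 - ‖(1 / 2 : ℝ) • (a + b)‖ ^ p

lemma rpow_norm_half_smul_add_le (hp : 0 ≤ p) (a b : X) :
    ‖(1 / 2 : ℝ) • (a + b)‖ ^ p ≤ (1 / 2 * ‖a‖ + 1 / 2 * ‖b‖) ^ p := by
  refine Real.rpow_le_rpow (norm_nonneg _) ?_ hp
  rw [norm_smul, Real.norm_of_nonneg (by norm_num), ← mul_add]
  gcongr
  exact norm_add_le a b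

lemma midpointDefect_nonneg (hp : 1 ≤ p) (a b : X) : 0 ≤ midpointDefect p a b := by
  have hconvex := (convexOn_rpow hp).2 (norm_nonneg a) (norm_nonneg b)
    (by norm_num : (0 : ℝ) ≤ 1 / 2) (by norm_num : (0 : ℝ) ≤ 1 / 2) (by norm_num)
  simp only [smul_eq_mul] at hconvex
  unfold midpointDefect
  linarith [rpow_norm_half_smul_add_le (by linarith : 0 ≤ p) a b]

lemma midpointDefect_pos [StrictConvexSpace ℝ X] (hp : 1 < p) {a b : X} (hab : a ≠ b) :
    0 < midpointDefect p a b := by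
  unfold midpointDefect
  by_cases hn : ‖a‖ = ‖b‖
  · have hlt := Real.rpow_lt_rpow (norm_nonneg _) ((norm_midpoint_lt_iff hn).2 hab)
      (by linarith : 0 < p)
    rw [← hn]
    linarith
  · have hconvex := (strictConvexOn_rpow hp).2 (norm_nonneg a) (norm_nonneg b) hn
      (by norm_num : (0 : ℝ) < 1 / 2) (by norm_num : (0 : ℝ) < 1 / 2) (by norm_num)
    simp only [smul_eq_mul] at hconvex
    linarith [rpow_norm_half_smul_add_le (by linarith : 0 ≤ p) a b]

lemma norm_smul_rpow (r p : ℝ) (a : X) : ‖r • a‖ ^ p = |r| ^ p * ‖a‖ ^ p := by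
  rw [norm_smul, Real.norm_eq_abs, Real.mul_rpow (abs_nonneg r) (norm_nonneg a)]

lemma midpointDefect_smul (r p : ℝ) (a b : X) :
    midpointDefect p (r • a) (r • b) = |r| ^ p * midpointDefect p a b := by
  simp only [midpointDefect, ← smul_add, smul_comm _ r, norm_smul_rpow]
  ring

lemma continuous_midpointDefect (hp : 0 ≤ p) :
    Continuous fun z : X × X => midpointDefect p z.1 z.2 := by
  unfold midpointDefect
  fun_prop (disch := exact fun _ => Or.inr hp)

/-- A quantitative form of uniform convexity for the `p`-th power of the norm. The inequality is
linear in the `p`-th powers, so that it can be integrated. -/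
def UniformlyConvexPow (p : ℝ) (X : Type*) [NormedAddCommGroup X] [NormedSpace ℝ X] : Prop :=
  ∀ η > 0, ∃ c : ℝ, 0 ≤ c ∧ ∀ a b : X,
    ‖a - b‖ ^ p ≤ η * (‖a‖ ^ p + ‖b‖ ^ p) + c * midpointDefect p a b

lemma exists_pos_le_midpointDefect_of_norm_eq_one [StrictConvexSpace ℝ X] [ProperSpace X]
    (hp : 1 < p) {η : ℝ} (hη : 0 < η) :
    ∃ m > (0 : ℝ), ∀ a b : X, ‖(a, b)‖ = 1 → η * (‖a‖ ^ p + ‖b‖ ^ p) ≤ ‖a - b‖ ^ p →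
      m ≤ midpointDefect p a b := by
  have hp₀ : 0 < p := by linarith
  let T : Set (X × X) :=
    Metric.sphere 0 1 ∩ {z | η * (‖z.1‖ ^ p + ‖z.2‖ ^ p) ≤ ‖z.1 - z.2‖ ^ p}
  have hpow : ∀ f : X × X → X, Continuous f → Continuous fun z => ‖f z‖ ^ p := fun f hf =>
    hf.norm.rpow_const fun _ => Or.inr hp₀.le
  have hT : IsCompact T := (isCompact_sphere 0 1).inter_right (isClosed_le
    (((hpow _ continuous_fst).add (hpow _ continuous_snd)).const_mul η)
    (hpow _ (continuous_fst.sub continuous_snd)))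
  have hmem : ∀ a b : X, ‖(a, b)‖ = 1 → η * (‖a‖ ^ p + ‖b‖ ^ p) ≤ ‖a - b‖ ^ p → (a, b) ∈ T :=
    fun a b hab hle => ⟨mem_sphere_zero_iff_norm.2 hab, hle⟩
  have hpos : ∀ z ∈ T, 0 < midpointDefect p z.1 z.2 := by
    rintro ⟨a, b⟩ ⟨hsphere, hle⟩
    refine midpointDefect_pos hp fun hab => ?_
    obtain rfl : a = b := hab
    have ha : ‖a‖ = 1 := by simpa [Prod.norm_def] using hsphere
    simp only [mem_ofPred_eq, sub_self, norm_zero, Real.zero_rpow hp₀.ne', ha,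
      Real.one_rpow] at hle
    linarith
  rcases T.eq_empty_or_nonempty with hempty | hne
  · exact ⟨1, one_pos, fun a b hab hle => by simpa [hempty] using hmem a b hab hle⟩
  · obtain ⟨z, hz, hmin⟩ := hT.exists_isMinOn hne (continuous_midpointDefect hp₀.le).continuousOn
    exact ⟨_, hpos z hz, fun a b hab hle => hmin (hmem a b hab hle)⟩

lemma exists_pos_mul_le_midpointDefect [StrictConvexSpace ℝ X] [ProperSpace X]
    (hp : 1 < p) {η : ℝ} (hη : 0 < η) :
    ∃ m > (0 : ℝ), ∀ a b : X, η * (‖a‖ ^ p + ‖b‖ ^ p) ≤ ‖a - b‖ ^ p →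
      m * ‖(a, b)‖ ^ p ≤ midpointDefect p a b := by
  obtain ⟨m, hm₀, hm⟩ := exists_pos_le_midpointDefect_of_norm_eq_one (X := X) hp hη
  refine ⟨m, hm₀, fun a b hle => ?_⟩
  rcases eq_or_ne ((a, b) : X × X) 0 with hzero | hne
  · rw [hzero, norm_zero, Real.zero_rpow (by linarith), mul_zero]
    exact midpointDefect_nonneg hp.le a b
  set r := ‖((a, b) : X × X)‖
  have hr : 0 < r := norm_pos_iff.2 hne
  have hr' : 0 < |r⁻¹| ^ p := by positivity
  have hunit : ‖(r⁻¹ • a, r⁻¹ • b)‖ = 1 := by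
    rw [← Prod.smul_mk, norm_smul, norm_inv, norm_norm, inv_mul_cancel₀ hr.ne']
  have hscaled := hm _ _ hunit (by
    rw [← smul_sub, norm_smul_rpow, norm_smul_rpow, norm_smul_rpow]
    linarith [mul_le_mul_of_nonneg_left hle hr'.le])
  rwa [midpointDefect_smul, abs_of_pos (inv_pos.2 hr), Real.inv_rpow hr.le,
    inv_mul_eq_div, le_div_iff₀ (by positivity)] at hscaled

lemma uniformlyConvexPow_of_strictConvexSpace (hp : 1 < p) (X : Type*) [NormedAddCommGroup X]
    [NormedSpace ℝ X] [StrictConvexSpace ℝ X] [ProperSpace X] : UniformlyConvexPow p X := by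
  intro η hη
  obtain ⟨m, hm₀, hm⟩ := exists_pos_mul_le_midpointDefect (X := X) hp hη
  refine ⟨2 ^ p / m, by positivity, fun a b => ?_⟩
  have hsum : 0 ≤ η * (‖a‖ ^ p + ‖b‖ ^ p) := by positivity
  by_cases hle : η * (‖a‖ ^ p + ‖b‖ ^ p) ≤ ‖a - b‖ ^ p
  · have hnorm : ‖a - b‖ ≤ 2 * ‖(a, b)‖ := by
      linarith [norm_sub_le a b, norm_fst_le (a, b), norm_snd_le (a, b)]
    have hpow : ‖a - b‖ ^ p ≤ 2 ^ p * ‖(a, b)‖ ^ p := by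
      rw [← Real.mul_rpow (by norm_num) (norm_nonneg _)]
      exact Real.rpow_le_rpow (norm_nonneg _) hnorm (by linarith)
    calc ‖a - b‖ ^ p ≤ 2 ^ p / m * (m * ‖(a, b)‖ ^ p) := hpow.trans_eq (by field_simp)
      _ ≤ 2 ^ p / m * midpointDefect p a b := by gcongr; exact hm a b hle
      _ ≤ _ := le_add_of_nonneg_left hsum
  · have := mul_nonneg (by positivity : 0 ≤ 2 ^ p / m) (midpointDefect_nonneg hp.le a b)
    linarith [not_le.1 hle]

lemma UniformlyConvexPow.cauchySeq (hp : 0 < p) (h : UniformlyConvexPow p X) {f : ℕ → X} {m : ℝ}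
    (hm : 0 ≤ m) (hlim : Tendsto (fun n => ‖f n‖) atTop (𝓝 m))
    (hmid : ∀ n k, m ≤ ‖(1 / 2 : ℝ) • (f n + f k)‖) : CauchySeq f := by
  have hpow : Tendsto (fun n => ‖f n‖ ^ p) atTop (𝓝 (m ^ p)) := hlim.rpow_const (Or.inr hp.le)
  have hfst : Tendsto (fun n : ℕ × ℕ => ‖f n.1‖ ^ p) atTop (𝓝 (m ^ p)) := by
    rw [← prod_atTop_atTop_eq]
    exact hpow.comp tendsto_fst
  have hsnd : Tendsto (fun n : ℕ × ℕ => ‖f n.2‖ ^ p) atTop (𝓝 (m ^ p)) := by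
    rw [← prod_atTop_atTop_eq]
    exact hpow.comp tendsto_snd
  refine cauchySeq_iff_tendsto_dist_atTop_0.2 (Metric.tendsto_nhds.2 fun ε hε => ?_)
  have : 0 ≤ m ^ p := Real.rpow_nonneg hm p
  obtain ⟨c, hc₀, hc⟩ := h (ε ^ p / (2 * m ^ p + 1)) (by positivity)
  have hbound := ((hfst.add hsnd).const_mul (ε ^ p / (2 * m ^ p + 1))).add
    ((((hfst.add hsnd).div_const 2).sub_const (m ^ p)).const_mul c)
  have hlt : ε ^ p / (2 * m ^ p + 1) * (m ^ p + m ^ p) + c * ((m ^ p + m ^ p) / 2 - m ^ p)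
      < ε ^ p := by
    rw [add_self_div_two, sub_self, mul_zero, add_zero, div_mul_eq_mul_div,
      div_lt_iff₀ (by positivity)]
    exact mul_lt_mul_of_pos_left (by linarith) (by positivity)
  filter_upwards [hbound.eventually_lt_const hlt] with n hn
  rw [Real.dist_0_eq_abs, abs_of_nonneg dist_nonneg, dist_eq_norm,
    ← Real.rpow_lt_rpow_iff (norm_nonneg _) hε.le hp]
  refine (hc _ _).trans_lt (lt_of_le_of_lt ?_ hn)
  unfold midpointDefect
  gcongr
  exact hmid _ _

lemma UniformlyConvexPow.exists_norm_le [CompleteSpace X] (hp : 0 < p)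
    (h : UniformlyConvexPow p X) {K : Set X} (hK : IsClosed K) (hne : K.Nonempty)
    (hmid : ∀ a ∈ K, ∀ b ∈ K, (1 / 2 : ℝ) • (a + b) ∈ K) : ∃ f ∈ K, ∀ g ∈ K, ‖f‖ ≤ ‖g‖ := by
  have hbdd : BddBelow (norm '' K) := ⟨0, by rintro _ ⟨x, -, rfl⟩; exact norm_nonneg x⟩
  have hle : ∀ g ∈ K, sInf (norm '' K) ≤ ‖g‖ := fun g hg => csInf_le hbdd ⟨g, hg, rfl⟩
  have hnonneg : 0 ≤ sInf (norm '' K) :=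
    Real.sInf_nonneg (by rintro _ ⟨x, -, rfl⟩; exact norm_nonneg x)
  obtain ⟨s, -, hs, hsK⟩ := exists_seq_tendsto_sInf (hne.image norm) hbdd
  choose f hfK hfs using hsK
  have hlim : Tendsto (fun n => ‖f n‖) atTop (𝓝 (sInf (norm '' K))) := by simpa only [hfs] using hs
  obtain ⟨f₀, hf₀⟩ := cauchySeq_tendsto_of_complete (h.cauchySeq hp hnonneg hlim fun n k =>
    hle _ (hmid _ (hfK n) _ (hfK k)))
  refine ⟨f₀, hK.mem_of_tendsto hf₀ (Eventually.of_forall hfK), fun g hg => ?_⟩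
  rw [tendsto_nhds_unique hf₀.norm hlim]
  exact hle g hg

end UniformConvexity

section Lp

variable {p : ℝ} {T E : Type*} [MeasurableSpace T] {M : Measure T} [NormedAddCommGroup E]

lemma norm_rpow_eq_integral (hp : 0 < p) (f : Lp E (ENNReal.ofReal p) M) :
    ‖f‖ ^ p = ∫ z, ‖f z‖ ^ p ∂M := by
  have hnn : 0 ≤ ∫ z, ‖f z‖ ^ p ∂M := integral_nonneg fun _ => by positivity
  rw [Lp.norm_def, (Lp.memLp f).eLpNorm_eq_integral_rpow_norm (by simpa using hp)
    ENNReal.ofReal_ne_top, ENNReal.toReal_ofReal hp.le, ENNReal.toReal_ofReal (by positivity),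
    ← Real.rpow_mul hnn, inv_mul_cancel₀ hp.ne', Real.rpow_one]

lemma integrable_norm_rpow_Lp (hp : 0 < p) (f : Lp E (ENNReal.ofReal p) M) :
    Integrable (fun z => ‖f z‖ ^ p) M := by
  have := (Lp.memLp f).integrable_norm_rpow (by simpa using hp) ENNReal.ofReal_ne_top
  rwa [ENNReal.toReal_ofReal hp.le] at this

variable [NormedSpace ℝ E]

lemma UniformlyConvexPow.lp (hp : 0 < p) (M : Measure T) (h : UniformlyConvexPow p E)
    [Fact (1 ≤ ENNReal.ofReal p)] : UniformlyConvexPow p (Lp E (ENNReal.ofReal p) M) := by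
  intro η hη
  obtain ⟨c, hc₀, hc⟩ := h η hη
  refine ⟨c, hc₀, fun f g => ?_⟩
  have hsum : Integrable (fun z => ‖f z‖ ^ p + ‖g z‖ ^ p) M :=
    (integrable_norm_rpow_Lp hp f).add (integrable_norm_rpow_Lp hp g)
  have hhalf := integrable_norm_rpow_Lp hp ((1 / 2 : ℝ) • (f + g))
  have hdefect : Integrable (fun z => (‖f z‖ ^ p + ‖g z‖ ^ p) / 2
    - ‖((1 / 2 : ℝ) • (f + g)) z‖ ^ p) M := (hsum.div_const 2).sub hhalf
  rw [midpointDefect, norm_rpow_eq_integral hp f, norm_rpow_eq_integral hp g,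
    norm_rpow_eq_integral hp (f - g), norm_rpow_eq_integral hp ((1 / 2 : ℝ) • (f + g)),
    ← integral_add (integrable_norm_rpow_Lp hp f) (integrable_norm_rpow_Lp hp g),
    ← integral_const_mul, ← integral_div, ← integral_sub (hsum.div_const 2) hhalf,
    ← integral_const_mul, ← integral_add (hsum.const_mul η) (hdefect.const_mul c)]
  refine integral_mono_ae (integrable_norm_rpow_Lp hp (f - g))
    ((hsum.const_mul η).add (hdefect.const_mul c)) ?_
  filter_upwards [Lp.coeFn_sub f g, Lp.coeFn_add f g, Lp.coeFn_smul (1 / 2 : ℝ) (f + g)]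
    with z hsub hadd hsmul
  simp only [hsub, hsmul, hadd, Pi.sub_apply, Pi.smul_apply, Pi.add_apply]
  exact hc _ _

lemma exists_clm_eq_setIntegral_clm_apply [IsFiniteMeasure M] {P : ℝ≥0∞} [Fact (1 ≤ P)]
    {L : T → E →L[ℝ] ℝ} (hL : AEStronglyMeasurable L M) {B : ℝ} (hB : ∀ z, ‖L z‖ ≤ B) {s : Set T}
    (hs : MeasurableSet s) :
    ∃ F : Lp E P M →L[ℝ] ℝ, ∀ f, F f = ∫ z in s, L z (f z) ∂M := by
  have : Fact (1 ≤ P.conjExponent) := ⟨ENNReal.HolderConjugate.one_le P.conjExponent P⟩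
  have hmem : MemLp (s.indicator L) P.conjExponent M :=
    (MemLp.of_bound hL B (ae_of_all _ hB)).indicator hs
  refine ⟨(ContinuousLinearMap.id ℝ (E →L[ℝ] ℝ)).lpPairing M P.conjExponent P hmem.toLp,
    fun f => ?_⟩
  rw [ContinuousLinearMap.lpPairing_eq_integral, ← integral_indicator hs]
  refine integral_congr_ae ?_
  filter_upwards [hmem.coeFn_toLp] with z hz
  by_cases hzs : z ∈ s
  · simp [hz, hzs]
  · simp [hz, hzs]

end Lp

section FiniteMeasure

lemma exists_isFiniteMeasure_lintegral_lt_top {T : Type*} [MeasurableSpace T] (ν : Measure T)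
    [IsFiniteMeasure ν] {f : T → ℝ≥0∞} (hf : Measurable f) (hfin : ∀ᵐ t ∂ν, f t < ⊤) :
    ∃ τ : Measure T, IsFiniteMeasure τ ∧ τ ≪ ν ∧ ν ≪ τ ∧ ∫⁻ t, f t ∂τ < ⊤ := by
  let g : T → ℝ≥0∞ := fun t => (1 + f t)⁻¹
  have hg : Measurable g := (measurable_const.add hf).inv
  have hg₀ : ∀ᵐ t ∂ν, g t ≠ 0 := hfin.mono fun t ht =>
    ENNReal.inv_ne_zero.2 (ENNReal.add_ne_top.2 ⟨ENNReal.one_ne_top, ht.ne⟩)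
  have hone : ∫⁻ _, 1 ∂ν < ⊤ := by simp
  have hfg : ∀ t, (g * f) t ≤ 1 := fun t => by
    rw [Pi.mul_apply, mul_comm, ← div_eq_mul_inv]
    exact ENNReal.div_le_of_le_mul (by rw [one_mul]; exact le_add_self)
  refine ⟨ν.withDensity g, isFiniteMeasure_withDensity ?_, withDensity_absolutelyContinuous ν g,
    withDensity_absolutelyContinuous' hg.aemeasurable hg₀, ?_⟩
  · exact ((lintegral_mono fun t => ENNReal.inv_le_one.2 le_self_add).trans_lt hone).ne
  · rw [lintegral_withDensity_eq_lintegral_mul _ hg hf]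
    exact (lintegral_mono hfg).trans_lt hone

end FiniteMeasure

section TangentExistence

variable {p : ℝ} {μ : ℝ → Measure (Space d)}

/-- `∇ · (u_t μ_t) = ∇ · (w_t μ_t)` in the sense of distributions: for every test function, the
two sides agree at `τ`-a.e. time. Velocity fields of a curve are exactly the `p`-integrable fields
with one prescribed divergence. -/
def SameDivergence (τ : Measure ℝ) (μ : ℝ → Measure (Space d)) (u w : ℝ → Space d → Space d) :
    Prop :=
  ∀ φ : Space d → ℝ, ContDiff ℝ 1 φ → HasCompactSupport φ →
    ∀ᵐ t ∂τ, ∫ x, fderiv ℝ φ x (u t x) ∂(μ t) = ∫ x, fderiv ℝ φ x (w t x) ∂(μ t)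

lemma IsVelocityField.sameDivergence {u w : ℝ → Space d → Space d} (hu : IsVelocityField p μ u)
    (hw : IsVelocityField p μ w) : SameDivergence (volume.restrict (Icc 0 1)) μ u w :=
  fun φ hφ hc => by
    filter_upwards [hu.ae_hasDerivAt hφ hc, hw.ae_hasDerivAt hφ hc] with t htu htw
    exact htu.unique htw

lemma SameDivergence.isVelocityField {u w : ℝ → Space d → Space d}
    (h : SameDivergence (volume.restrict (Icc 0 1)) μ u w) (hw : IsVelocityField p μ w)
    (hm : Measurable (Function.uncurry u))
    (hLp : ∀ᵐ t ∂(volume.restrict (Icc (0 : ℝ) 1)), MemLp (u t) (ENNReal.ofReal p) (μ t)) :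
    IsVelocityField p μ u where
  measurable := hm
  memLp := hLp
  integrable φ hφ hc := (hw.integrable φ hφ hc).congr ((h φ hφ hc).mono fun _ ht => ht.symm)
  continuity_eq φ hφ hc t₁ h₁ t₂ h₂ hlt := by
    rw [hw.continuity_eq φ hφ hc t₁ h₁ t₂ h₂ hlt]
    refine intervalIntegral.integral_congr_ae ?_
    filter_upwards [(ae_restrict_iff' measurableSet_Icc).1 (h φ hφ hc)] with t ht htI
    exact (ht (uIcc_subset_Icc h₁ h₂ (uIoc_subset_uIcc htI))).symm

lemma memLp_iff_kinetic_lt_top (hp : 0 < p) {v : ℝ → Space d → Space d}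
    (hm : Measurable (Function.uncurry v)) (t : ℝ) :
    MemLp (v t) (ENNReal.ofReal p) (μ t) ↔ kinetic p μ v t < ⊤ := by
  rw [kinetic_eq hp, ENNReal.rpow_lt_top_iff_of_pos hp]
  exact ⟨fun h => h.2, fun h => ⟨(hm.comp measurable_prodMk_left).aestronglyMeasurable, h⟩⟩

lemma measurable_kinetic (κ : Kernel ℝ (Space d)) [IsSFiniteKernel κ] (p : ℝ)
    {v : ℝ → Space d → Space d} (hm : Measurable (Function.uncurry v)) :
    Measurable (kinetic p κ v) :=
  Measurable.lintegral_kernel_prod_right (hm.enorm.pow_const p)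

section SpaceTime

variable {τ : Measure ℝ} {κ : Kernel ℝ (Space d)}

lemma integrable_fderiv_apply_uncurry {u : ℝ → Space d → Space d}
    (hu : Integrable (Function.uncurry u) (τ ⊗ₘ κ)) {φ : Space d → ℝ} (hφ : ContDiff ℝ 1 φ)
    (hc : HasCompactSupport φ) :
    Integrable (fun z : ℝ × Space d => fderiv ℝ φ z.2 (u z.1 z.2)) (τ ⊗ₘ κ) := by
  have hcont := hφ.continuous_fderiv one_ne_zero
  obtain ⟨B, hB⟩ := hcont.bounded_above_of_compact_support (hc.fderiv ℝ)
  exact integrable_clm_apply (hcont.comp continuous_snd).aestronglyMeasurable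
    (fun z => hB z.2) hu

lemma ae_kinetic_le_of_forall_lintegral_kinetic_le [IsSFiniteKernel κ]
    {v w : ℝ → Space d → Space d}
    (hv : Measurable (Function.uncurry v)) (hvw : SameDivergence τ κ v w)
    (hfin : ∫⁻ t, kinetic p κ v t ∂τ < ⊤)
    (hmin : ∀ u : ℝ → Space d → Space d, Measurable (Function.uncurry u) →
      SameDivergence τ κ u w → ∫⁻ t, kinetic p κ v t ∂τ ≤ ∫⁻ t, kinetic p κ u t ∂τ)
    {u : ℝ → Space d → Space d} (hu : Measurable (Function.uncurry u))
    (huw : SameDivergence τ κ u w) : ∀ᵐ t ∂τ, kinetic p κ v t ≤ kinetic p κ u t := by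
  let S : Set ℝ := {t | kinetic p κ u t < kinetic p κ v t}
  have hS : MeasurableSet S :=
    measurableSet_lt (measurable_kinetic κ p hu) (measurable_kinetic κ p hv)
  classical
  let h : ℝ → Space d → Space d := fun t x => if t ∈ S then u t x else v t x
  have hh : Measurable (Function.uncurry h) := Measurable.ite (measurable_fst hS) hu hv
  have hdiv : SameDivergence τ κ h w := fun φ hφ hc => by
    filter_upwards [huw φ hφ hc, hvw φ hφ hc] with t htu htv
    by_cases ht : t ∈ S <;> simp [h, ht, htu, htv]
  have hkin : ∀ t, kinetic p κ h t = min (kinetic p κ v t) (kinetic p κ u t) := fun t => by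
    by_cases ht : t ∈ S
    · have hht : h t = u t := funext fun _ => if_pos ht
      rw [min_eq_right (le_of_lt ht), kinetic, kinetic, hht]
    · have hht : h t = v t := funext fun _ => if_neg ht
      rw [min_eq_left (not_lt.1 ht), kinetic, kinetic, hht]
  have hle := hmin h hh hdiv
  simp only [hkin] at hle
  have hae := ae_eq_of_ae_le_of_lintegral_le (ae_of_all τ fun t => min_le_left _ _)
    ((lintegral_mono fun t => min_le_left _ _).trans_lt hfin).ne
    (measurable_kinetic κ p hv).aemeasurable hle
  exact hae.mono fun t ht => min_eq_left_iff.1 ht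

variable [IsFiniteMeasure τ] [IsMarkovKernel κ]

lemma eLpNorm_uncurry_compProd (hp : 0 < p) {u : ℝ → Space d → Space d}
    (hu : Measurable (Function.uncurry u)) :
    eLpNorm (Function.uncurry u) (ENNReal.ofReal p) (τ ⊗ₘ κ)
      = (∫⁻ t, kinetic p κ u t ∂τ) ^ (1 / p) := by
  rw [eLpNorm_eq_lintegral_rpow_enorm_toReal (by simpa using hp) ENNReal.ofReal_ne_top,
    ENNReal.toReal_ofReal hp.le, Measure.lintegral_compProd (hu.enorm.pow_const p)]
  rfl

lemma memLp_uncurry_compProd_iff (hp : 0 < p) {u : ℝ → Space d → Space d}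
    (hu : Measurable (Function.uncurry u)) :
    MemLp (Function.uncurry u) (ENNReal.ofReal p) (τ ⊗ₘ κ) ↔ ∫⁻ t, kinetic p κ u t ∂τ < ⊤ := by
  rw [MemLp, eLpNorm_uncurry_compProd hp hu, ENNReal.rpow_lt_top_iff_of_pos (by positivity)]
  exact and_iff_right hu.aestronglyMeasurable

lemma sameDivergence_iff_forall_setIntegral {u w : ℝ → Space d → Space d}
    (hu : Integrable (Function.uncurry u) (τ ⊗ₘ κ))
    (hw : Integrable (Function.uncurry w) (τ ⊗ₘ κ)) :
    SameDivergence τ κ u w ↔ ∀ φ : Space d → ℝ, ContDiff ℝ 1 φ → HasCompactSupport φ →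
      ∀ A : Set ℝ, MeasurableSet A →
        ∫ z in A ×ˢ univ, fderiv ℝ φ z.2 (u z.1 z.2) ∂(τ ⊗ₘ κ)
          = ∫ z in A ×ˢ univ, fderiv ℝ φ z.2 (w z.1 z.2) ∂(τ ⊗ₘ κ) := by
  have hslice : ∀ {f : ℝ → Space d → Space d}, Integrable (Function.uncurry f) (τ ⊗ₘ κ) →
      ∀ φ : Space d → ℝ, ContDiff ℝ 1 φ → HasCompactSupport φ → ∀ A : Set ℝ, MeasurableSet A →
        ∫ z in A ×ˢ univ, fderiv ℝ φ z.2 (f z.1 z.2) ∂(τ ⊗ₘ κ)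
          = ∫ t in A, ∫ x, fderiv ℝ φ x (f t x) ∂(κ t) ∂τ := fun hf φ hφ hc A hA => by
    rw [Measure.setIntegral_compProd hA MeasurableSet.univ
      (integrable_fderiv_apply_uncurry hf hφ hc).integrableOn]
    simp only [Measure.restrict_univ]
  refine ⟨fun h φ hφ hc A hA => ?_, fun h φ hφ hc => ?_⟩
  · rw [hslice hu φ hφ hc A hA, hslice hw φ hφ hc A hA]
    exact setIntegral_congr_ae hA ((h φ hφ hc).mono fun _ ht _ => ht)
  · refine Integrable.ae_eq_of_forall_setIntegral_eq _ _
      (integrable_fderiv_apply_uncurry hu hφ hc).integral_compProd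
      (integrable_fderiv_apply_uncurry hw hφ hc).integral_compProd fun A hA _ => ?_
    rw [← hslice hu φ hφ hc A hA, ← hslice hw φ hφ hc A hA]
    exact h φ hφ hc A hA

lemma exists_isClosed_setOf_sameDivergence [Fact (1 ≤ ENNReal.ofReal p)]
    {w : ℝ → Space d → Space d} (hw : Integrable (Function.uncurry w) (τ ⊗ₘ κ)) :
    ∃ K : Set (Lp (Space d) (ENNReal.ofReal p) (τ ⊗ₘ κ)), IsClosed K ∧
      (∀ a ∈ K, ∀ b ∈ K, (1 / 2 : ℝ) • (a + b) ∈ K) ∧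
      ∀ {u : ℝ → Space d → Space d} (hu : MemLp (Function.uncurry u) (ENNReal.ofReal p) (τ ⊗ₘ κ)),
        hu.toLp ∈ K ↔ SameDivergence τ κ u w := by
  have hpairing : ∀ (φ : Space d → ℝ), ContDiff ℝ 1 φ → HasCompactSupport φ → ∀ A : Set ℝ,
      MeasurableSet A → ∃ F : Lp (Space d) (ENNReal.ofReal p) (τ ⊗ₘ κ) →L[ℝ] ℝ,
        ∀ f, F f = ∫ z in A ×ˢ univ, fderiv ℝ φ z.2 (f z) ∂(τ ⊗ₘ κ) := fun φ hφ hc A hA => by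
    have hcont := hφ.continuous_fderiv one_ne_zero
    obtain ⟨B, hB⟩ := hcont.bounded_above_of_compact_support (hc.fderiv ℝ)
    exact exists_clm_eq_setIntegral_clm_apply (hcont.comp continuous_snd).aestronglyMeasurable
      (fun z => hB z.2) (hA.prod MeasurableSet.univ)
  choose F hF using hpairing
  refine ⟨{f | ∀ φ hφ hc A hA, F φ hφ hc A hA f
    = ∫ z in A ×ˢ univ, fderiv ℝ φ z.2 (w z.1 z.2) ∂(τ ⊗ₘ κ)}, ?_, ?_, fun {u} hu => ?_⟩
  · simp only [ofPred_forall]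
    exact isClosed_iInter fun φ => isClosed_iInter fun hφ => isClosed_iInter fun hc =>
      isClosed_iInter fun A => isClosed_iInter fun hA =>
        isClosed_eq (F φ hφ hc A hA).continuous continuous_const
  · intro a ha b hb φ hφ hc A hA
    rw [map_smul, map_add, ha, hb, smul_eq_mul]
    ring
  · rw [sameDivergence_iff_forall_setIntegral (hu.integrable Fact.out) hw]
    refine forall₅_congr fun φ hφ hc A hA => ?_
    rw [hF]
    refine Eq.congr_left (setIntegral_congr_ae (hA.prod MeasurableSet.univ) ?_)
    filter_upwards [hu.coeFn_toLp] with z hz _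
    rw [hz, Function.uncurry_def]

lemma exists_minimal_lintegral_kinetic (hp : 1 < p) {w : ℝ → Space d → Space d}
    (hw : Measurable (Function.uncurry w)) (hfin : ∫⁻ t, kinetic p κ w t ∂τ < ⊤) :
    ∃ v : ℝ → Space d → Space d, Measurable (Function.uncurry v) ∧ SameDivergence τ κ v w ∧
      ∫⁻ t, kinetic p κ v t ∂τ < ⊤ ∧ ∀ u : ℝ → Space d → Space d, Measurable (Function.uncurry u) →
        SameDivergence τ κ u w → ∫⁻ t, kinetic p κ v t ∂τ ≤ ∫⁻ t, kinetic p κ u t ∂τ := by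
  have hp₀ : 0 < p := by linarith
  have : Fact (1 ≤ ENNReal.ofReal p) := ⟨by simpa using hp.le⟩
  have hwLp := (memLp_uncurry_compProd_iff hp₀ hw).2 hfin
  obtain ⟨K, hKclosed, hKmid, hK⟩ :=
    exists_isClosed_setOf_sameDivergence (p := p) (hwLp.integrable Fact.out)
  obtain ⟨f, hfK, hfmin⟩ := ((uniformlyConvexPow_of_strictConvexSpace hp (Space d)).lp hp₀
    (τ ⊗ₘ κ)).exists_norm_le hp₀ hKclosed ⟨hwLp.toLp, (hK hwLp).2 fun _ _ _ => ae_of_all _ fun _ =>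
      rfl⟩ hKmid
  have hv : Measurable (Function.uncurry fun t x => f (t, x)) :=
    (Lp.stronglyMeasurable f).measurable
  have hvLp : MemLp (Function.uncurry fun t x => f (t, x)) (ENNReal.ofReal p) (τ ⊗ₘ κ) := Lp.memLp f
  have hvf : hvLp.toLp = f := Lp.toLp_coeFn f _
  have hvfin := (memLp_uncurry_compProd_iff hp₀ hv).1 hvLp
  refine ⟨fun t x => f (t, x), hv, (hK hvLp).1 (hvf.symm ▸ hfK), hvfin, fun u hu hdiv => ?_⟩
  rcases eq_or_ne (∫⁻ t, kinetic p κ u t ∂τ) ⊤ with htop | hne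
  · exact htop ▸ le_top
  have huLp := (memLp_uncurry_compProd_iff hp₀ hu).2 hne.lt_top
  have hle := hfmin _ ((hK huLp).2 hdiv)
  rwa [← hvf, Lp.norm_toLp, Lp.norm_toLp, ENNReal.toReal_le_toReal hvLp.2.ne huLp.2.ne,
    eLpNorm_uncurry_compProd hp₀ hv, eLpNorm_uncurry_compProd hp₀ hu,
    ENNReal.rpow_le_rpow_iff (by positivity)] at hle

end SpaceTime

lemma IsVelocityField.exists_isTangentField (hp : 1 < p) {w : ℝ → Space d → Space d}
    (hw : IsVelocityField p μ w) {κ : Kernel ℝ (Space d)} [IsMarkovKernel κ]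
    (hκ : ∀ t ∈ Icc (0 : ℝ) 1, κ t = μ t) : ∃ v, IsTangentField p μ v := by
  have hp₀ : 0 < p := by linarith
  set I : Measure ℝ := volume.restrict (Icc (0 : ℝ) 1)
  have hκI : ∀ᵐ t ∂I, κ t = μ t := (ae_restrict_mem measurableSet_Icc).mono hκ
  have hkin : ∀ u : ℝ → Space d → Space d, ∀ᵐ t ∂I, kinetic p κ u t = kinetic p μ u t := fun u =>
    hκI.mono fun t ht => by simp only [kinetic, ht]
  have hwfin : ∀ᵐ t ∂I, kinetic p κ w t < ⊤ := by
    filter_upwards [hw.memLp, hkin w] with t hmem ht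
    rwa [ht, ← memLp_iff_kinetic_lt_top hp₀ hw.measurable]
  obtain ⟨τ, hτ, hτI, hIτ, hτw⟩ := exists_isFiniteMeasure_lintegral_lt_top I
    (measurable_kinetic κ p hw.measurable) hwfin
  obtain ⟨v, hv, hvw, hvfin, hmin⟩ := exists_minimal_lintegral_kinetic hp hw.measurable hτw
  have hvLp : ∀ᵐ t ∂I, MemLp (v t) (ENNReal.ofReal p) (μ t) := by
    filter_upwards [hIτ.ae_le (ae_lt_top (measurable_kinetic κ p hv) hvfin.ne), hkin v]
      with t hlt ht
    rwa [memLp_iff_kinetic_lt_top hp₀ hv, ← ht]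
  have hvel : IsVelocityField p μ v := by
    refine SameDivergence.isVelocityField (fun φ hφ hc => ?_) hw hv hvLp
    filter_upwards [hIτ.ae_le (hvw φ hφ hc), hκI] with t ht htκ
    rwa [← htκ]
  refine ⟨v, hvel, fun u hu => ?_⟩
  have huw : SameDivergence τ κ u w := fun φ hφ hc => by
    filter_upwards [hτI.ae_le (hu.sameDivergence hw φ hφ hc), hτI.ae_le hκI] with t ht htκ
    rwa [htκ]
  filter_upwards [hIτ.ae_le (ae_kinetic_le_of_forall_lintegral_kinetic_le hv hvw hvfin hmin
    hu.measurable huw), hkin v, hkin u] with t hle htv htu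
  rwa [htv, htu, kinetic_eq hp₀, kinetic_eq hp₀, ENNReal.rpow_le_rpow_iff hp₀] at hle

end TangentExistence

section TimeTest

lemma isTimeTest_of_hasCompactSupport {χ : ℝ × Space d → ℝ} (hχ : ContDiff ℝ 1 χ)
    (hc : HasCompactSupport χ) : IsTimeTest χ := by
  have hcont := hχ.continuous_fderiv one_ne_zero
  refine ⟨hχ, hcont.bounded_above_of_compact_support (hc.fderiv ℝ),
    (hc.fderiv ℝ).uniformContinuous_of_continuous hcont, fun t => ?_⟩
  refine HasCompactSupport.intro (hc.isCompact.image continuous_snd) fun x hx => ?_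
  exact image_eq_zero_of_notMem_tsupport fun htx => hx ⟨_, htx, rfl⟩

lemma isTimeTest_comp_snd {φ : Space d → ℝ} (hφ : ContDiff ℝ 1 φ) (hc : HasCompactSupport φ) :
    IsTimeTest fun z : ℝ × Space d => φ z.2 := by
  have hcont := hφ.continuous_fderiv one_ne_zero
  let pre := (ContinuousLinearMap.compL ℝ (ℝ × Space d) (Space d) ℝ).flip
    (ContinuousLinearMap.snd ℝ ℝ (Space d))
  have hfderiv : fderiv ℝ (fun z : ℝ × Space d => φ z.2) = fun z => pre (fderiv ℝ φ z.2) :=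
    funext fun z => ((hφ.differentiable one_ne_zero z.2).hasFDerivAt.comp z hasFDerivAt_snd).fderiv
  obtain ⟨B, hB⟩ := hcont.bounded_above_of_compact_support (hc.fderiv ℝ)
  refine ⟨hφ.comp contDiff_snd, ⟨‖pre‖ * B, fun z => ?_⟩, ?_, fun _ => hc⟩
  · rw [hfderiv]
    exact (pre.le_opNorm _).trans (by gcongr; exact hB _)
  · rw [hfderiv]
    exact pre.uniformContinuous.comp
      (((hc.fderiv ℝ).uniformContinuous_of_continuous hcont).comp uniformContinuous_snd)

lemma IsTimeTest.add {ψ χ : ℝ × Space d → ℝ} (hψ : IsTimeTest ψ) (hχ : IsTimeTest χ) :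
    IsTimeTest (ψ + χ) := by
  have hfderiv : fderiv ℝ (ψ + χ) = fderiv ℝ ψ + fderiv ℝ χ :=
    funext fun z => fderiv_add (hψ.differentiable z) (hχ.differentiable z)
  obtain ⟨B, hB⟩ := hψ.bounded
  obtain ⟨B', hB'⟩ := hχ.bounded
  refine ⟨hψ.contDiff.add hχ.contDiff, ⟨B + B', fun z => ?_⟩, ?_,
    fun t => (hψ.hasCompactSupport t).add (hχ.hasCompactSupport t)⟩
  · rw [hfderiv]
    exact (norm_add_le _ _).trans (add_le_add (hB z) (hB' z))
  · rw [hfderiv]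
    exact hψ.uniformContinuous.add hχ.uniformContinuous

end TimeTest

section Pushforward

variable {p : ℝ}

lemma IsCoupling.map {μ ν : Measure (Space d)} {γ : Measure (Space d × Space d)}
    (hγ : IsCoupling μ ν γ) {f g : Space d → Space d} (hf : Measurable f) (hg : Measurable g) :
    IsCoupling (μ.map f) (ν.map g) (γ.map (Prod.map f g)) := by
  have hfg := hf.prodMap hg
  constructor
  · rw [Measure.map_map measurable_fst hfg, ← hγ.1, Measure.map_map hf measurable_fst]; rfl
  · rw [Measure.map_map measurable_snd hfg, ← hγ.2, Measure.map_map hg measurable_snd]; rfl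

lemma eLpNorm_le_add_mul_eLpNorm {X E F : Type*} [MeasurableSpace X] [NormedAddCommGroup E]
    [NormedAddCommGroup F] {γ : Measure X} [IsProbabilityMeasure γ] {r : ℝ≥0∞} (hr : 1 ≤ r)
    {f : X → E} {g : X → F} (hg : AEStronglyMeasurable g γ) {a b : ℝ} (ha : 0 ≤ a) (hb : 0 ≤ b)
    (hfg : ∀ x, ‖f x‖ ≤ a + b * ‖g x‖) :
    eLpNorm f r γ ≤ ENNReal.ofReal a + ENNReal.ofReal b * eLpNorm g r γ := by
  have hconst : eLpNorm (fun _ : X => a) r γ = ENNReal.ofReal a := by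
    rw [eLpNorm_const _ (zero_lt_one.trans_le hr).ne' (NeZero.ne _)]
    simp [Real.enorm_of_nonneg ha]
  calc eLpNorm f r γ ≤ eLpNorm ((fun _ => a) + b • fun x => ‖g x‖) r γ := eLpNorm_mono_real hfg
    _ ≤ eLpNorm (fun _ => a) r γ + eLpNorm (b • fun x => ‖g x‖) r γ :=
      eLpNorm_add_le aestronglyMeasurable_const (hg.norm.const_smul b) hr
    _ = ENNReal.ofReal a + ENNReal.ofReal b * eLpNorm g r γ := by
      rw [hconst, eLpNorm_const_smul, eLpNorm_norm, Real.enorm_of_nonneg hb]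

lemma wassersteinDist_map_le (hp : 1 ≤ p) {μ ν : Measure (Space d)} [IsProbabilityMeasure μ]
    {f g : Space d → Space d} (hf : Measurable f) (hg : Measurable g) {a b : ℝ} (ha : 0 ≤ a)
    (hb : 0 ≤ b) (hfg : ∀ x y, ‖f x - g y‖ ≤ a + b * ‖x - y‖) (hW : wassersteinDist p μ ν ≠ ⊤) :
    wassersteinDist p (μ.map f) (ν.map g) ≤
      ENNReal.ofReal a + ENNReal.ofReal b * wassersteinDist p μ ν := by
  have hp₀ : 0 < p := by linarith
  let Δ : Space d × Space d → Space d := fun z => z.1 - z.2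
  have hΔ : Measurable Δ := measurable_fst.sub measurable_snd
  have hcost : ∀ γ : Measure (Space d × Space d),
      eLpNorm Δ (ENNReal.ofReal p) γ = (∫⁻ z, ‖z.1 - z.2‖ₑ ^ p ∂γ) ^ (1 / p) := fun γ => by
    rw [eLpNorm_eq_lintegral_rpow_enorm_toReal (by simpa using hp₀) ENNReal.ofReal_ne_top,
      ENNReal.toReal_ofReal hp₀.le]
  have hle : ∀ c > wassersteinDist p μ ν,
      wassersteinDist p (μ.map f) (ν.map g) ≤ ENNReal.ofReal a + ENNReal.ofReal b * c := by
    intro c hc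
    obtain ⟨γ, hγ, hlt⟩ := exists_isCoupling_lintegral_rpow_lt hp₀ hc
    have := hγ.isProbabilityMeasure
    have hΔc : eLpNorm Δ (ENNReal.ofReal p) γ ≤ c := by
      rw [hcost, one_div, ENNReal.rpow_inv_le_iff hp₀]
      exact hlt.le
    calc wassersteinDist p (μ.map f) (ν.map g)
        ≤ eLpNorm Δ (ENNReal.ofReal p) (γ.map (Prod.map f g)) :=
          (wassersteinDist_le_of_isCoupling hp₀.le (hγ.map hf hg)).trans_eq (hcost _).symm
      _ = eLpNorm (Δ ∘ Prod.map f g) (ENNReal.ofReal p) γ :=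
          eLpNorm_map_measure hΔ.aestronglyMeasurable (hf.prodMap hg).aemeasurable
      _ ≤ ENNReal.ofReal a + ENNReal.ofReal b * eLpNorm Δ (ENNReal.ofReal p) γ :=
          eLpNorm_le_add_mul_eLpNorm (by simpa using hp) hΔ.aestronglyMeasurable ha hb
            fun z => hfg z.1 z.2
      _ ≤ ENNReal.ofReal a + ENNReal.ofReal b * c := by gcongr
  have hcont : Continuous fun c => ENNReal.ofReal a + ENNReal.ofReal b * c :=
    continuous_const.add (ENNReal.continuous_const_mul ENNReal.ofReal_ne_top)
  have := nhdsGT_neBot_of_exists_gt ⟨_, hW.lt_top⟩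
  exact ge_of_tendsto (x := 𝓝[>] wassersteinDist p μ ν)
    ((hcont.tendsto _).mono_left nhdsWithin_le_nhds) (eventually_nhdsWithin_of_forall hle)

end Pushforward

section Perturbation

/-- The perturbed identity `x ↦ x + ε ξ(t,x)`. -/
def perturb (ξ : ℝ × Space d → Space d) (ε t : ℝ) (x : Space d) : Space d := x + ε • ξ (t, x)

/-- The image of a curve of measures under the perturbed identity: the competitor against which
a minimizer is tested. -/
noncomputable def perturbCurve (ξ : ℝ × Space d → Space d) (ε : ℝ) (μ : ℝ → Measure (Space d))
    (t : ℝ) : Measure (Space d) :=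
  (μ t).map (perturb ξ ε t)

/-- The velocity of the perturbed curve in Lagrangian coordinates: its value at `x` is the velocity
of the perturbed curve at the point `perturb ξ ε t x`. -/
noncomputable def perturbField (ξ : ℝ × Space d → Space d) (ε : ℝ) (v : ℝ → Space d → Space d)
    (t : ℝ) (x : Space d) : Space d :=
  v t x + ε • transportDeriv ξ t x (v t x)

variable {p : ℝ} {Ω : Set (Space d)} {μ : ℝ → Measure (Space d)} {v : ℝ → Space d → Space d}
  {ξ : ℝ × Space d → Space d} {B ε : ℝ}

lemma hasFDerivAt_slice (hξ : Differentiable ℝ ξ) (t : ℝ) (x : Space d) :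
    HasFDerivAt (fun y => ξ (t, y))
      ((fderiv ℝ ξ (t, x)).comp (ContinuousLinearMap.inr ℝ ℝ (Space d))) x :=
  (hξ (t, x)).hasFDerivAt.comp x (hasFDerivAt_prodMk_right t x)

lemma transportDeriv_eq (hξ : Differentiable ℝ ξ) (t : ℝ) (x w : Space d) :
    transportDeriv ξ t x w = fderiv ℝ ξ (t, x) (1, w) := by
  have htime : HasDerivAt (fun s => ξ (s, x)) (fderiv ℝ ξ (t, x) (1, 0)) t :=
    (hξ (t, x)).hasFDerivAt.comp_hasDerivAt t ((hasDerivAt_id t).prodMk (hasDerivAt_const t x))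
  have hsplit : ((1 : ℝ), w) = (0, w) + (1, 0) := by simp
  rw [transportDeriv, (hasFDerivAt_slice hξ t x).fderiv, htime.deriv, hsplit, map_add]
  simp

lemma norm_transportDeriv_le (hξ : Differentiable ℝ ξ) (hB : ∀ z, ‖fderiv ℝ ξ z‖ ≤ B)
    (t : ℝ) (x w : Space d) : ‖transportDeriv ξ t x w‖ ≤ B * (1 + ‖w‖) := by
  rw [transportDeriv_eq hξ]
  have hB₀ : 0 ≤ B := (norm_nonneg _).trans (hB (0, 0))
  refine (ContinuousLinearMap.le_opNorm _ _).trans ?_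
  gcongr
  · exact hB _
  · exact max_le (by simp) (by simp)

lemma measurable_transportDeriv (hξ : ContDiff ℝ 1 ξ) (hv : Measurable (Function.uncurry v)) :
    Measurable (Function.uncurry fun t x => transportDeriv ξ t x (v t x)) := by
  have happ : Measurable fun z : ℝ × Space d => fderiv ℝ ξ z (1, v z.1 z.2) :=
    isBoundedBilinearMap_apply.continuous.measurable.comp
      ((hξ.continuous_fderiv one_ne_zero).measurable.prodMk (measurable_const.prodMk hv))
  simpa only [Function.uncurry_def, transportDeriv_eq (hξ.differentiable one_ne_zero)] using happ

lemma measurable_perturbField (hξ : ContDiff ℝ 1 ξ) (ε : ℝ)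
    (hv : Measurable (Function.uncurry v)) : Measurable (Function.uncurry (perturbField ξ ε v)) :=
  hv.add ((measurable_transportDeriv hξ hv).const_smul ε)

lemma memLp_perturbField (hξ : ContDiff ℝ 1 ξ) (hB : ∀ z, ‖fderiv ℝ ξ z‖ ≤ B) (ε : ℝ)
    (hv : Measurable (Function.uncurry v)) {t : ℝ} {r : ℝ≥0∞} {ν : Measure (Space d)}
    [IsFiniteMeasure ν] (ht : MemLp (v t) r ν) : MemLp (perturbField ξ ε v t) r ν := by
  have hmeas : AEStronglyMeasurable (perturbField ξ ε v t) ν :=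
    ((measurable_perturbField hξ ε hv).comp measurable_prodMk_left).aestronglyMeasurable
  have hbd : MemLp (fun x => ‖v t x‖ + |ε| * (B * (1 + ‖v t x‖))) r ν :=
    ht.norm.add ((((memLp_const (1 : ℝ)).add ht.norm).const_mul B).const_mul |ε|)
  refine hbd.mono' hmeas (ae_of_all _ fun x => (norm_add_le _ _).trans ?_)
  rw [norm_smul, Real.norm_eq_abs]
  gcongr
  exact norm_transportDeriv_le (hξ.differentiable one_ne_zero) hB _ _ _

lemma continuous_perturb (hξ : Continuous ξ) (ε t : ℝ) : Continuous (perturb ξ ε t) :=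
  continuous_id.add ((hξ.comp (Continuous.prodMk_right t)).const_smul ε)

lemma perturb_eq_self_of_notMem_tsupport (ε : ℝ) {t : ℝ} {x : Space d} (h : (t, x) ∉ tsupport ξ) :
    perturb ξ ε t x = x := by
  rw [perturb, image_eq_zero_of_notMem_tsupport h, smul_zero, add_zero]

lemma norm_sub_le_of_norm_fderiv_le (hξ : Differentiable ℝ ξ) (hB : ∀ z, ‖fderiv ℝ ξ z‖ ≤ B)
    (z z' : ℝ × Space d) : ‖ξ z - ξ z'‖ ≤ B * ‖z - z'‖ :=
  convex_univ.norm_image_sub_le_of_norm_fderiv_le (𝕜 := ℝ)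
    (fun x _ => hξ x) (fun x _ => hB x) (mem_univ z') (mem_univ z)

lemma norm_perturb_sub_le (hξ : Differentiable ℝ ξ) (hB : ∀ z, ‖fderiv ℝ ξ z‖ ≤ B)
    (hε : |ε| ≤ 1) (s t : ℝ) (x y : Space d) :
    ‖perturb ξ ε s x - perturb ξ ε t y‖ ≤ B * |s - t| + (1 + B) * ‖x - y‖ := by
  have hB₀ : 0 ≤ B := (norm_nonneg _).trans (hB (0, 0))
  have hprod : ‖((s, x) - (t, y) : ℝ × Space d)‖ ≤ |s - t| + ‖x - y‖ :=
    max_le (by simp) (by simp)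
  have hsub : perturb ξ ε s x - perturb ξ ε t y = (x - y) + ε • (ξ (s, x) - ξ (t, y)) := by
    simp only [perturb, smul_sub]; abel
  calc ‖perturb ξ ε s x - perturb ξ ε t y‖ ≤ ‖x - y‖ + |ε| * ‖ξ (s, x) - ξ (t, y)‖ := by
        rw [hsub, ← Real.norm_eq_abs, ← norm_smul]
        exact norm_add_le _ _
    _ ≤ ‖x - y‖ + 1 * (B * (|s - t| + ‖x - y‖)) := by
        gcongr
        exact (norm_sub_le_of_norm_fderiv_le hξ hB _ _).trans (by gcongr)
    _ = B * |s - t| + (1 + B) * ‖x - y‖ := by ring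

lemma exists_homeomorph_perturb (hξ : Differentiable ℝ ξ) (hB : ∀ z, ‖fderiv ℝ ξ z‖ ≤ B)
    (hε : |ε| * B < 1) :
    ∃ h : (ℝ × Space d) ≃ₜ (ℝ × Space d), ∀ t x, h (t, x) = (t, perturb ξ ε t x) := by
  have hB₀ : 0 ≤ B := (norm_nonneg _).trans (hB (0, 0))
  have happrox : ApproximatesLinearOn (fun z : ℝ × Space d => (z.1, perturb ξ ε z.1 z.2))
      (ContinuousLinearEquiv.refl ℝ (ℝ × Space d) : ℝ × Space d →L[ℝ] ℝ × Space d) univ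
      (|ε| * B).toNNReal := by
    intro z _ z' _
    have hdiff : ((z.1, perturb ξ ε z.1 z.2) - (z'.1, perturb ξ ε z'.1 z'.2)
        - (ContinuousLinearEquiv.refl ℝ (ℝ × Space d) : ℝ × Space d →L[ℝ] ℝ × Space d) (z - z') :
          ℝ × Space d) = (0, ε • (ξ z - ξ z')) := by
      ext1
      · simp
      · simp only [perturb, Prod.mk_sub_mk, ContinuousLinearEquiv.coe_refl,
          ContinuousLinearMap.coe_id', id_eq, Prod.snd_sub, smul_sub]
        abel
    simp only [hdiff]
    rw [Real.coe_toNNReal _ (by positivity), Prod.norm_mk, norm_zero, norm_smul, Real.norm_eq_abs,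
      mul_assoc]
    refine max_le (by positivity) ?_
    gcongr
    exact norm_sub_le_of_norm_fderiv_le hξ hB z z'
  have hnorm : ‖((ContinuousLinearEquiv.refl ℝ (ℝ × Space d)).symm :
      ℝ × Space d →L[ℝ] ℝ × Space d)‖₊ = 1 :=
    NNReal.coe_inj.1 ContinuousLinearMap.norm_id
  refine ⟨happrox.toHomeomorph _ (Or.inr ?_), fun t x => rfl⟩
  rwa [hnorm, inv_one, Real.toNNReal_lt_one]

lemma eventually_forall_perturb_mem (hξ : Continuous ξ) (hc : HasCompactSupport ξ)
    (hsub : tsupport ξ ⊆ univ ×ˢ interior Ω) :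
    ∀ᶠ ε in 𝓝 (0 : ℝ), ∀ t, ∀ x ∈ Ω, perturb ξ ε t x ∈ Ω := by
  obtain ⟨A, hA⟩ := hc.exists_bound_of_continuous hξ
  have hK : IsCompact (Prod.snd '' tsupport ξ) := hc.isCompact.image continuous_snd
  have hKΩ : Prod.snd '' tsupport ξ ⊆ interior Ω := by
    rintro _ ⟨z, hz, rfl⟩
    exact (hsub hz).2
  obtain ⟨δ, hδ, hδΩ⟩ := hK.exists_thickening_subset_open isOpen_interior hKΩ
  have hsmall : ∀ᶠ ε in 𝓝 (0 : ℝ), |ε| * A < δ :=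
    ContinuousAt.eventually_lt (by fun_prop) continuousAt_const (by simpa using hδ)
  filter_upwards [hsmall] with ε hε t x hx
  by_cases hz : (t, x) ∈ tsupport ξ
  · refine interior_subset (hδΩ (Metric.mem_thickening_iff.2 ⟨x, ⟨_, hz, rfl⟩, ?_⟩))
    rw [perturb, dist_eq_norm, add_sub_cancel_left, norm_smul, Real.norm_eq_abs]
    exact (mul_le_mul_of_nonneg_left (hA _) (abs_nonneg ε)).trans_lt hε
  · rwa [perturb_eq_self_of_notMem_tsupport ε hz]

lemma MemWp.map_perturb (hp : 0 < p) (hΩm : MeasurableSet Ω) {ν : Measure (Space d)}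
    (hν : MemWp p Ω ν) (hξ : Continuous ξ) (hc : HasCompactSupport ξ) {t : ℝ}
    (hΩ : ∀ x ∈ Ω, perturb ξ ε t x ∈ Ω) : MemWp p Ω (ν.map (perturb ξ ε t)) := by
  have hm : Measurable (perturb ξ ε t) := (continuous_perturb hξ ε t).measurable
  have hfin : ∀ f : Space d → Space d,
      ∫⁻ x, ‖f x‖ₑ ^ p ∂ν < ⊤ ↔ eLpNorm f (ENNReal.ofReal p) ν < ⊤ := fun f => by
    rw [eLpNorm_lt_top_iff_lintegral_rpow_enorm_lt_top (by simpa using hp) ENNReal.ofReal_ne_top,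
      ENNReal.toReal_ofReal hp.le]
  have := hν.isProb
  refine ⟨Measure.isProbabilityMeasure_map hm.aemeasurable, ?_, ?_⟩
  · rw [Measure.map_apply hm hΩm.compl]
    exact measure_mono_null (fun x hx hxΩ => hx (hΩ x hxΩ)) hν.concentrated
  · obtain ⟨A, hA⟩ := hc.exists_bound_of_continuous hξ
    have hid : MemLp (fun x : Space d => x) (ENNReal.ofReal p) ν :=
      ⟨measurable_id.aestronglyMeasurable, (hfin _).1 hν.moment⟩
    have hbd : MemLp (fun x => ξ (t, x)) (ENNReal.ofReal p) ν :=
      .of_bound (hξ.comp (Continuous.prodMk_right t)).aestronglyMeasurable A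
        (ae_of_all _ fun x => hA _)
    rw [lintegral_map (by fun_prop) hm]
    exact (hfin _).2 (hid.add (hbd.const_smul ε)).2

lemma IsLipschitzCurve.perturbCurve (hp : 1 ≤ p) (hΩm : MeasurableSet Ω)
    (hμ : IsLipschitzCurve p Ω μ) (hξ : Differentiable ℝ ξ) (hc : HasCompactSupport ξ)
    (hB : ∀ z, ‖fderiv ℝ ξ z‖ ≤ B) (hε : |ε| ≤ 1) (hΩ : ∀ t, ∀ x ∈ Ω, perturb ξ ε t x ∈ Ω) :
    IsLipschitzCurve p Ω (perturbCurve ξ ε μ) := by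
  have hp₀ : 0 < p := by linarith
  have hB₀ : 0 ≤ B := (norm_nonneg _).trans (hB (0, 0))
  have hm : ∀ t, Measurable (perturb ξ ε t) :=
    fun t => (continuous_perturb hξ.continuous ε t).measurable
  obtain ⟨C, hC⟩ := hμ.lip
  refine ⟨fun t ht => (hμ.mem t ht).map_perturb hp₀ hΩm hξ.continuous hc (hΩ t),
    B.toNNReal + (1 + B).toNNReal * C, fun s hs t ht => ?_⟩
  have := (hμ.mem s hs).isProb
  have hfin : wassersteinDist p (μ s) (μ t) ≠ ⊤ :=
    ne_top_of_le_ne_top (by finiteness) (hC s hs t ht)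
  calc wassersteinDist p ((μ s).map (perturb ξ ε s)) ((μ t).map (perturb ξ ε t))
      ≤ ENNReal.ofReal (B * |s - t|) + ENNReal.ofReal (1 + B) * wassersteinDist p (μ s) (μ t) :=
        wassersteinDist_map_le hp (hm s) (hm t) (by positivity) (by positivity)
          (norm_perturb_sub_le hξ hB hε s t) hfin
    _ ≤ ENNReal.ofReal (B * |s - t|) + ENNReal.ofReal (1 + B) * (C * ENNReal.ofReal |s - t|) := by
        gcongr
        exact hC s hs t ht
    _ = (B.toNNReal + (1 + B).toNNReal * C : ℝ≥0) * ENNReal.ofReal |s - t| := by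
        rw [ENNReal.ofReal_mul hB₀, ENNReal.coe_add, ENNReal.coe_mul, ← ENNReal.ofReal,
          ← ENNReal.ofReal]
        ring

lemma isTimeTest_comp_perturb (hξ : ContDiff ℝ 1 ξ) (hc : HasCompactSupport ξ) (ε : ℝ)
    {φ : Space d → ℝ} (hφ : ContDiff ℝ 1 φ) (hφc : HasCompactSupport φ) :
    IsTimeTest fun z : ℝ × Space d => φ (perturb ξ ε z.1 z.2) := by
  let χ : ℝ × Space d → ℝ := fun z => φ (perturb ξ ε z.1 z.2) - φ z.2
  have hχ : ContDiff ℝ 1 χ :=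
    (hφ.comp (contDiff_snd.add (hξ.const_smul ε))).sub (hφ.comp contDiff_snd)
  have hχc : HasCompactSupport χ := by
    refine hc.mono' fun z hz => ?_
    by_contra hn
    exact hz (sub_eq_zero.2 (congrArg φ (perturb_eq_self_of_notMem_tsupport ε hn)))
  convert (isTimeTest_of_hasCompactSupport hχ hχc).add (isTimeTest_comp_snd hφ hφc) using 1
  funext z
  simp [χ]

lemma fderiv_comp_perturb_apply (hξ : Differentiable ℝ ξ) (ε : ℝ)
    {φ : Space d → ℝ} (hφ : Differentiable ℝ φ) (v : ℝ → Space d → Space d) (t : ℝ) (x : Space d) :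
    fderiv ℝ (fun z : ℝ × Space d => φ (perturb ξ ε z.1 z.2)) (t, x) (1, v t x)
      = fderiv ℝ φ (perturb ξ ε t x) (perturbField ξ ε v t x) := by
  have hperturb : HasFDerivAt (fun z : ℝ × Space d => perturb ξ ε z.1 z.2)
      (ContinuousLinearMap.snd ℝ ℝ (Space d) + ε • fderiv ℝ ξ (t, x)) (t, x) :=
    hasFDerivAt_snd.add ((hξ (t, x)).hasFDerivAt.const_smul ε)
  have hcomp : fderiv ℝ (fun z : ℝ × Space d => φ (perturb ξ ε z.1 z.2)) (t, x) = _ :=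
    ((hφ (perturb ξ ε t x)).hasFDerivAt.comp (t, x) hperturb).fderiv
  rw [hcomp, perturbField, transportDeriv_eq hξ]
  simp

lemma IsVelocityField.perturbCurve (hp : 1 ≤ p) (hμ : IsLipschitzCurve p Ω μ)
    (hv : IsVelocityField p μ v) (hξ : ContDiff ℝ 1 ξ) (hc : HasCompactSupport ξ)
    (hB : ∀ z, ‖fderiv ℝ ξ z‖ ≤ B) {w : ℝ → Space d → Space d}
    (hwm : Measurable (Function.uncurry w))
    (hw : ∀ t x, w t (perturb ξ ε t x) = perturbField ξ ε v t x) :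
    IsVelocityField p (perturbCurve ξ ε μ) w := by
  have hξd : Differentiable ℝ ξ := hξ.differentiable one_ne_zero
  have hm : ∀ t, Measurable (perturb ξ ε t) :=
    fun t => (continuous_perturb hξ.continuous ε t).measurable
  have hwt : ∀ t, Measurable (w t) := fun t => hwm.comp measurable_prodMk_left
  have hflux : ∀ (φ : Space d → ℝ), ContDiff ℝ 1 φ → ∀ t,
      ∫ x, fderiv ℝ φ x (w t x) ∂(WGeod.perturbCurve ξ ε μ t) =
        ∫ x, fderiv ℝ (fun z : ℝ × Space d => φ (perturb ξ ε z.1 z.2)) (t, x) (1, v t x)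
          ∂(μ t) := by
    intro φ hφ t
    have happ : Measurable fun x => fderiv ℝ φ x (w t x) :=
      isBoundedBilinearMap_apply.continuous.measurable.comp
        ((hφ.continuous_fderiv one_ne_zero).measurable.prodMk (hwt t))
    rw [WGeod.perturbCurve, integral_map (hm t).aemeasurable happ.aestronglyMeasurable]
    simp only [hw, fderiv_comp_perturb_apply hξd ε (hφ.differentiable one_ne_zero)]
  have hmass : ∀ (φ : Space d → ℝ), ContDiff ℝ 1 φ → ∀ t,
      ∫ x, φ x ∂(WGeod.perturbCurve ξ ε μ t) = ∫ x, φ (perturb ξ ε t x) ∂(μ t) := fun φ hφ t =>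
    integral_map (hm t).aemeasurable hφ.continuous.aestronglyMeasurable
  refine ⟨hwm, ?_, fun φ hφ hφc => ?_, fun φ hφ hφc t₁ h₁ t₂ h₂ _ => ?_⟩
  · filter_upwards [hv.memLp, ae_restrict_mem measurableSet_Icc] with t ht htI
    have := (hμ.mem t htI).isProb
    rw [WGeod.perturbCurve, memLp_map_measure_iff (hwt t).aestronglyMeasurable (hm t).aemeasurable]
    exact (memLp_perturbField hξ hB ε hv.measurable ht).congr_norm
      ((hwt t).comp (hm t)).aestronglyMeasurable (ae_of_all _ fun x => by simp [hw])
  · simp_rw [hflux φ hφ]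
    exact ((isTimeTest_comp_perturb hξ hc ε hφ hφc).integrableOn_and_integral_sub_eq hp hμ hv).1
  · simp_rw [hflux φ hφ, hmass φ hφ]
    exact ((isTimeTest_comp_perturb hξ hc ε hφ hφc).integrableOn_and_integral_sub_eq hp hμ hv).2
      t₁ h₁ t₂ h₂

lemma IsVelocityField.exists_perturbCurve (hp : 1 ≤ p) (hμ : IsLipschitzCurve p Ω μ)
    (hv : IsVelocityField p μ v) (hξ : ContDiff ℝ 1 ξ) (hc : HasCompactSupport ξ)
    (hB : ∀ z, ‖fderiv ℝ ξ z‖ ≤ B) (hε : |ε| * B < 1) :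
    ∃ w, IsVelocityField p (WGeod.perturbCurve ξ ε μ) w ∧
      ∀ t, kinetic p (WGeod.perturbCurve ξ ε μ) w t = kinetic p μ (perturbField ξ ε v) t := by
  obtain ⟨h, hh⟩ := exists_homeomorph_perturb (hξ.differentiable one_ne_zero) hB hε
  let w : ℝ → Space d → Space d := fun t y => Function.uncurry (perturbField ξ ε v) (h.symm (t, y))
  have hwm : Measurable (Function.uncurry w) :=
    (measurable_perturbField hξ ε hv.measurable).comp h.symm.continuous.measurable
  have hw : ∀ t x, w t (perturb ξ ε t x) = perturbField ξ ε v t x := fun t x => by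
    simp only [w, ← hh, h.symm_apply_apply, Function.uncurry_apply_pair]
  refine ⟨w, hv.perturbCurve hp hμ hξ hc hB hwm hw, fun t => ?_⟩
  have hwt : Measurable (w t) := hwm.comp measurable_prodMk_left
  rw [kinetic, WGeod.perturbCurve, lintegral_map (hwt.enorm.pow_const p)
    (continuous_perturb hξ.continuous ε t).measurable]
  simp only [hw, kinetic]

end Perturbation

section ChangeOfVariables

variable {E : Type*} [NormedAddCommGroup E] [NormedSpace ℝ E] [FiniteDimensional ℝ E]
  [MeasurableSpace E] [BorelSpace E] (m : Measure E) [m.IsAddHaarMeasure] {f g : E → E}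
  {f' : E → E →L[ℝ] E}

lemma lintegral_eq_lintegral_abs_det_mul_comp (hf : ∀ x, HasFDerivAt f (f' x) x)
    (hbij : Function.Bijective f) (F : E → ℝ≥0∞) :
    ∫⁻ y, F y ∂m = ∫⁻ x, ENNReal.ofReal |(f' x).det| * F (f x) ∂m := by
  have hcov := lintegral_image_eq_lintegral_abs_det_fderiv_mul m MeasurableSet.univ
    (fun x _ => (hf x).hasFDerivWithinAt) hbij.injective.injOn F
  rwa [image_univ_of_surjective hbij.surjective, Measure.restrict_univ] at hcov

lemma map_withDensity_eq (hf : ∀ x, HasFDerivAt f (f' x) x) (hdet : ∀ x, (f' x).det ≠ 0)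
    (hgf : Function.LeftInverse g f) (hfg : Function.RightInverse g f) (u : E → ℝ≥0∞) :
    (m.withDensity u).map f =
      m.withDensity fun y => u (g y) / ENNReal.ofReal |(f' (g y)).det| := by
  have hfm : Measurable f :=
    (continuous_iff_continuousAt.2 fun x => (hf x).continuousAt).measurable
  ext A hA
  rw [Measure.map_apply hfm hA, withDensity_apply _ (hfm hA), withDensity_apply _ hA,
    ← lintegral_indicator hA, ← lintegral_indicator (hfm hA),
    lintegral_eq_lintegral_abs_det_mul_comp m hf ⟨hgf.injective, hfg.surjective⟩ (A.indicator _)]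
  refine lintegral_congr fun x => ?_
  have hdet₀ : ENNReal.ofReal |(f' x).det| ≠ 0 := by simpa using hdet x
  by_cases hx : f x ∈ A
  · rw [indicator_of_mem (mem_preimage.2 hx), indicator_of_mem hx, hgf,
      ENNReal.mul_div_cancel hdet₀ ENNReal.ofReal_ne_top]
  · rw [indicator_of_notMem (mt mem_preimage.1 hx), indicator_of_notMem hx, mul_zero]

end ChangeOfVariables

section InternalEnergy

lemma ae_rnDeriv_eq_zero_of_notMem {Ω : Set (Space d)} (hΩ : MeasurableSet Ω)
    {ν : Measure (Space d)} (hνΩ : ν Ωᶜ = 0) :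
    ∀ᵐ x ∂(volume : Measure (Space d)), x ∉ Ω → ν.rnDeriv volume x = 0 := by
  have hzero : ∫⁻ x in Ωᶜ, ν.rnDeriv volume x = 0 :=
    le_antisymm ((Measure.setLIntegral_rnDeriv_le _).trans hνΩ.le) zero_le
  rwa [lintegral_eq_zero_iff (Measure.measurable_rnDeriv _ _), Filter.EventuallyEq,
    ae_restrict_iff' hΩ.compl] at hzero

lemma Lq_map_le {q : ℝ} (hq : 0 < q) {Ω : Set (Space d)} (hΩ : MeasurableSet Ω)
    {ν : Measure (Space d)} [IsFiniteMeasure ν] (hν : ν ≪ volume) (hνΩ : ν Ωᶜ = 0)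
    {f g : Space d → Space d} {f' : Space d → Space d →L[ℝ] Space d}
    (hf : ∀ x, HasFDerivAt f (f' x) x) (hdet : ∀ x, (f' x).det ≠ 0)
    (hdetm : Measurable fun x => (f' x).det) (hg : Measurable g)
    (hgf : Function.LeftInverse g f) (hfg : Function.RightInverse g f) :
    Lq q Ω (ν.map f) ≤
      ∫⁻ x in Ω, ν.rnDeriv volume x ^ q * ENNReal.ofReal |(f' x).det| ^ (1 - q) := by
  set u := ν.rnDeriv volume
  let h : Space d → ℝ≥0∞ := fun y => u (g y) / ENNReal.ofReal |(f' (g y)).det|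
  have hh : Measurable h := ((Measure.measurable_rnDeriv _ _).comp hg).div
    ((hdetm.comp hg).abs.ennreal_ofReal)
  have hmap : ν.map f = volume.withDensity h := by
    conv_lhs => rw [← Measure.withDensity_rnDeriv_eq _ _ hν]
    exact map_withDensity_eq volume hf hdet hgf hfg u
  have hac : ν.map f ≪ volume := hmap ▸ withDensity_absolutelyContinuous _ _
  have hrn : (ν.map f).rnDeriv volume =ᵐ[volume] h := hmap ▸ Measure.rnDeriv_withDensity _ hh
  have hpull : ∀ x, ENNReal.ofReal |(f' x).det| * h (f x) ^ q =
      u x ^ q * ENNReal.ofReal |(f' x).det| ^ (1 - q) := fun x => by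
    have hdet₀ : ENNReal.ofReal |(f' x).det| ≠ 0 := by simpa using hdet x
    simp only [h, hgf x]
    rw [ENNReal.div_rpow_of_nonneg _ _ hq.le, ENNReal.rpow_sub _ _ hdet₀ ENNReal.ofReal_ne_top,
      ENNReal.rpow_one, div_eq_mul_inv, div_eq_mul_inv]
    ring
  rw [Lq, if_pos hac]
  calc ∫⁻ x in Ω, (ν.map f).rnDeriv volume x ^ q ≤ ∫⁻ x, (ν.map f).rnDeriv volume x ^ q :=
        setLIntegral_le_lintegral _ _
    _ = ∫⁻ x, h x ^ q := lintegral_congr_ae (hrn.mono fun x hx => by simp only [hx])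
    _ = ∫⁻ x, u x ^ q * ENNReal.ofReal |(f' x).det| ^ (1 - q) := by
        rw [lintegral_eq_lintegral_abs_det_mul_comp volume hf ⟨hgf.injective, hfg.surjective⟩]
        simp only [hpull]
    _ = ∫⁻ x in Ω, u x ^ q * ENNReal.ofReal |(f' x).det| ^ (1 - q) := by
        rw [← lintegral_indicator hΩ]
        refine lintegral_congr_ae ((ae_rnDeriv_eq_zero_of_notMem hΩ hνΩ).mono fun x hx => ?_)
        by_cases hxΩ : x ∈ Ω
        · simp only [indicator_of_mem hxΩ]
        · simp only [indicator_of_notMem hxΩ, u, hx hxΩ, ENNReal.zero_rpow_of_pos hq, zero_mul]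

end InternalEnergy

section Determinant

variable {E : Type*} [NormedAddCommGroup E] [NormedSpace ℝ E]

/-- The factor `det (1 + A) ^ (1 - q)` by which `∫ u^q` changes under a map with derivative
`1 + A`. -/
noncomputable def detFactor (q : ℝ) (A : E →L[ℝ] E) : ℝ := (1 + A).det ^ (1 - q)

lemma det_one_continuousLinearMap : (1 : E →L[ℝ] E).det = 1 := by
  simp [ContinuousLinearMap.det]

lemma detFactor_zero (q : ℝ) : detFactor q (0 : E →L[ℝ] E) = 1 := by
  rw [detFactor, add_zero, det_one_continuousLinearMap, Real.one_rpow]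

lemma measurable_detFactor [MeasurableSpace (E →L[ℝ] E)] [BorelSpace (E →L[ℝ] E)] (q : ℝ) :
    Measurable (detFactor q : (E →L[ℝ] E) → ℝ) :=
  (ContinuousLinearMap.continuous_det.comp
    (continuous_const.add continuous_id)).measurable.pow_const _

variable [FiniteDimensional ℝ E]

lemma contDiff_det {n : WithTop ℕ∞} : ContDiff ℝ n fun A : E →L[ℝ] E => A.det := by
  let b := Module.finBasis ℝ E
  have hdet : ∀ A : E →L[ℝ] E, A.det = (LinearMap.toMatrix b b (A : E →ₗ[ℝ] E)).det :=
    fun A => (LinearMap.det_toMatrix b _).symm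
  simp_rw [hdet, Matrix.det_apply, LinearMap.toMatrix_apply]
  refine ContDiff.sum fun σ _ => ContDiff.const_smul _ (contDiff_prod fun i _ => ?_)
  exact ((b.coord (σ i)).toContinuousLinearMap.comp
    (ContinuousLinearMap.apply ℝ E (b i))).contDiff

lemma exists_lipschitzOnWith_detFactor (E : Type*) [NormedAddCommGroup E] [NormedSpace ℝ E]
    [FiniteDimensional ℝ E] (q : ℝ) :
    ∃ r > 0, ∃ K, LipschitzOnWith K (detFactor q) (Metric.ball (0 : E →L[ℝ] E) r) ∧
      ∀ A ∈ Metric.ball (0 : E →L[ℝ] E) r, 0 < (1 + A).det := by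
  have hdet : ContDiff ℝ 1 fun A : E →L[ℝ] E => (1 + A).det :=
    contDiff_det.comp (contDiff_const.add contDiff_id)
  have hdet₀ : (1 + (0 : E →L[ℝ] E)).det = 1 := by rw [add_zero, det_one_continuousLinearMap]
  have hpos : ∀ᶠ A in 𝓝 (0 : E →L[ℝ] E), 0 < (1 + A).det :=
    hdet.continuous.continuousAt.eventually_const_lt (by beta_reduce; rw [hdet₀]; exact one_pos)
  have hfactor : ContDiffAt ℝ 1 (detFactor q) (0 : E →L[ℝ] E) :=
    hdet.contDiffAt.rpow_const_of_ne (hdet₀ ▸ one_ne_zero)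
  obtain ⟨K, s, hs, hK⟩ := hfactor.exists_lipschitzOnWith
  obtain ⟨r, hr, hrs⟩ := Metric.eventually_nhds_iff_ball.1 (hpos.and hs)
  exact ⟨r, hr, K, hK.mono fun A hA => (hrs A hA).2, fun A hA => (hrs A hA).1⟩

lemma hasDerivAt_det_one_add_smul (A : E →L[ℝ] E) :
    HasDerivAt (fun ε : ℝ => (1 + ε • A).det) (LinearMap.trace ℝ E A) 0 := by
  let b := Module.finBasis ℝ E
  let M := LinearMap.toMatrix b b (A : E →ₗ[ℝ] E)
  let P := (Matrix.det (1 + (Polynomial.X : Polynomial ℝ) • M.map Polynomial.C)).divX.divX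
  have hexpand : (fun ε : ℝ => (1 + ε • A).det) =
      fun ε => 1 + M.trace * ε + P.eval ε * ε ^ 2 := by
    funext ε
    rw [← Matrix.det_one_add_smul, ContinuousLinearMap.det, ← LinearMap.det_toMatrix b]
    simp [M, LinearMap.toMatrix_one]
  rw [hexpand, LinearMap.trace_eq_matrix_trace ℝ b]
  have hlin : HasDerivAt (fun ε => 1 + M.trace * ε) M.trace 0 :=
    ((hasDerivAt_id' (0 : ℝ)).const_mul M.trace).const_add 1 |>.congr_deriv (mul_one _)
  have hquad : HasDerivAt (fun ε => P.eval ε * ε ^ 2) 0 0 :=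
    ((P.hasDerivAt 0).mul (hasDerivAt_pow 2 0)).congr_deriv (by simp)
  exact (hlin.add hquad).congr_deriv (add_zero _)

lemma hasDerivAt_detFactor (q : ℝ) (A : E →L[ℝ] E) :
    HasDerivAt (fun ε : ℝ => detFactor q (ε • A)) ((1 - q) * LinearMap.trace ℝ E A) 0 := by
  have hdet₀ : ((1 : E →L[ℝ] E) + (0 : ℝ) • A).det = 1 := by
    rw [zero_smul ℝ A, add_zero, det_one_continuousLinearMap]
  have hpow := (hasDerivAt_det_one_add_smul A).rpow_const (p := 1 - q)
    (Or.inl (hdet₀ ▸ one_ne_zero))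
  rw [hdet₀, Real.one_rpow, mul_one] at hpow
  simpa only [detFactor, mul_comm] using hpow

end Determinant

section RelativeLipschitz

/-- `F` is Lipschitz on `(-r, r)` with a constant proportional to `|F 0|`. This scale-invariant
bound survives powers and products even where `F 0 = 0`, since `F` then vanishes on `(-r, r)`. -/
def IsRelLipschitz (C r : ℝ) (F : ℝ → ℝ) : Prop :=
  ∀ ε ∈ Metric.ball (0 : ℝ) r, ∀ ε' ∈ Metric.ball (0 : ℝ) r,
    |F ε - F ε'| ≤ C * |F 0| * |ε - ε'|

namespace IsRelLipschitz

variable {C C' r s α : ℝ} {F G : ℝ → ℝ}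

lemma const (hC : 0 ≤ C) (r c : ℝ) : IsRelLipschitz C r fun _ => c := fun ε _ ε' _ => by
  rw [sub_self, abs_zero]
  positivity

lemma mono (h : IsRelLipschitz C r F) (hC : C ≤ C') (hs : s ≤ r) : IsRelLipschitz C' s F :=
  fun ε hε ε' hε' => (h ε (Metric.ball_subset_ball hs hε) ε' (Metric.ball_subset_ball hs hε')).trans
    (by gcongr)

lemma const_mul (h : IsRelLipschitz C r F) (c : ℝ) : IsRelLipschitz C r fun ε => c * F ε :=
  fun ε hε ε' hε' => by
  calc |c * F ε - c * F ε'| = |c| * |F ε - F ε'| := by rw [← mul_sub, abs_mul]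
    _ ≤ |c| * (C * |F 0| * |ε - ε'|) := by gcongr; exact h ε hε ε' hε'
    _ = C * |c * F 0| * |ε - ε'| := by rw [abs_mul]; ring

lemma abs_sub_le (h : IsRelLipschitz C r F) (hC : 0 ≤ C) {ε : ℝ}
    (hε : ε ∈ Metric.ball (0 : ℝ) r) : |F ε - F 0| ≤ C * r * |F 0| := by
  have hε' : |ε| < r := by simpa using hε
  calc |F ε - F 0| ≤ C * |F 0| * |ε - 0| :=
        h ε hε 0 (Metric.mem_ball_self ((abs_nonneg ε).trans_lt hε'))
    _ ≤ C * |F 0| * r := by rw [sub_zero]; gcongr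
    _ = C * r * |F 0| := by ring

lemma eq_zero (h : IsRelLipschitz C r F) (h₀ : F 0 = 0) {ε : ℝ}
    (hε : ε ∈ Metric.ball (0 : ℝ) r) : F ε = 0 := by
  simpa [h₀] using h ε hε 0 (Metric.mem_ball_self (Metric.pos_of_mem_ball hε))

lemma div_mem_Icc (h : IsRelLipschitz C r F) (hC : 0 ≤ C) (hCr : C * r ≤ 1 / 2) (h₀ : 0 < F 0)
    {ε : ℝ} (hε : ε ∈ Metric.ball (0 : ℝ) r) : F ε / F 0 ∈ Icc (1 / 2 : ℝ) (3 / 2) := by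
  have hdist : |F ε - F 0| ≤ 1 / 2 * F 0 := by
    refine (h.abs_sub_le hC hε).trans ?_
    rw [abs_of_pos h₀]
    gcongr
  obtain ⟨hlower, hupper⟩ := abs_le.1 hdist
  exact ⟨(le_div_iff₀ h₀).2 (by linarith), (div_le_iff₀ h₀).2 (by linarith)⟩

lemma rpow {K : ℝ≥0} (hK : LipschitzOnWith K (fun x : ℝ => x ^ α) (Icc (1 / 2) (3 / 2)))
    (h : IsRelLipschitz C r F) (hC : 0 ≤ C) (hCr : C * r ≤ 1 / 2) (h₀ : 0 ≤ F 0) :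
    IsRelLipschitz (K * C) r fun ε => F ε ^ α := by
  intro ε hε ε' hε'
  rcases h₀.eq_or_lt with h₀ | h₀
  · beta_reduce
    rw [h.eq_zero h₀.symm hε, h.eq_zero h₀.symm hε', sub_self, abs_zero]
    positivity
  have hratio : ∀ {e}, e ∈ Metric.ball (0 : ℝ) r → F e / F 0 ∈ Icc (1 / 2 : ℝ) (3 / 2) :=
    h.div_mem_Icc hC hCr h₀
  have hscale : ∀ {e}, e ∈ Metric.ball (0 : ℝ) r → F e ^ α = F 0 ^ α * (F e / F 0) ^ α :=
    fun {e} he => by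
      rw [← Real.mul_rpow h₀.le ((by norm_num : (0 : ℝ) ≤ 1 / 2).trans (hratio he).1),
        mul_div_cancel₀ _ h₀.ne']
  have hdiv : |F ε / F 0 - F ε' / F 0| ≤ C * |ε - ε'| := by
    rw [← sub_div, abs_div, div_le_iff₀ (abs_pos.2 h₀.ne')]
    exact (h ε hε ε' hε').trans_eq (by ring)
  have hpow := hK.dist_le_mul _ (hratio hε) _ (hratio hε')
  rw [Real.dist_eq, Real.dist_eq] at hpow
  calc |F ε ^ α - F ε' ^ α| = |F 0 ^ α| * |(F ε / F 0) ^ α - (F ε' / F 0) ^ α| := by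
        rw [hscale hε, hscale hε', ← mul_sub, abs_mul]
    _ ≤ |F 0 ^ α| * (K * (C * |ε - ε'|)) := by gcongr; exact hpow.trans (by gcongr)
    _ = K * C * |F 0 ^ α| * |ε - ε'| := by ring

lemma mul (hF : IsRelLipschitz C r F) (hG : IsRelLipschitz C' r G) (hC : 0 ≤ C) (hC' : 0 ≤ C') :
    IsRelLipschitz ((1 + C * r) * C' + (1 + C' * r) * C) r fun ε => F ε * G ε := by
  intro ε hε ε' hε'
  have hFε : |F ε| ≤ (1 + C * r) * |F 0| := by
    linarith [hF.abs_sub_le hC hε, abs_sub_abs_le_abs_sub (F ε) (F 0)]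
  have hGε' : |G ε'| ≤ (1 + C' * r) * |G 0| := by
    linarith [hG.abs_sub_le hC' hε', abs_sub_abs_le_abs_sub (G ε') (G 0)]
  calc |F ε * G ε - F ε' * G ε'| = |F ε * (G ε - G ε') + G ε' * (F ε - F ε')| := by ring_nf
    _ ≤ |F ε| * |G ε - G ε'| + |G ε'| * |F ε - F ε'| := by
        simpa only [abs_mul] using abs_add_le (F ε * (G ε - G ε')) (G ε' * (F ε - F ε'))
    _ ≤ (1 + C * r) * |F 0| * (C' * |G 0| * |ε - ε'|)
        + (1 + C' * r) * |G 0| * (C * |F 0| * |ε - ε'|) := by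
        gcongr
        exacts [(abs_nonneg _).trans hFε, hG ε hε ε' hε', (abs_nonneg _).trans hGε',
          hF ε hε ε' hε']
    _ = ((1 + C * r) * C' + (1 + C' * r) * C) * |F 0 * G 0| * |ε - ε'| := by
        rw [abs_mul]; ring

lemma hasDerivAt_rpow (h : IsRelLipschitz C r F) (hr : 0 < r) (hα : α ≠ 0) {F' : ℝ}
    (hF : HasDerivAt F F' 0) :
    HasDerivAt (fun ε => F ε ^ α) (F' * α * F 0 ^ (α - 1)) 0 := by
  by_cases h₀ : F 0 = 0
  · have hball : ∀ᶠ ε in 𝓝 (0 : ℝ), ε ∈ Metric.ball (0 : ℝ) r := Metric.ball_mem_nhds 0 hr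
    have hF₀ : F =ᶠ[𝓝 0] fun _ => 0 := hball.mono fun ε hε => h.eq_zero h₀ hε
    have hpow₀ : (fun ε => F ε ^ α) =ᶠ[𝓝 0] fun _ => 0 :=
      hF₀.mono fun ε hε => by simp [hε, Real.zero_rpow hα]
    have hF' : F' = 0 := hF.unique ((hasDerivAt_const (0 : ℝ) (0 : ℝ)).congr_of_eventuallyEq hF₀)
    simpa [hF'] using (hasDerivAt_const (0 : ℝ) (0 : ℝ)).congr_of_eventuallyEq hpow₀
  · exact hF.rpow_const (Or.inl h₀)

end IsRelLipschitz

lemma exists_lipschitzOnWith_rpow_const {a b : ℝ} (ha : 0 < a) (α : ℝ) :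
    ∃ K, LipschitzOnWith K (fun x : ℝ => x ^ α) (Icc a b) := by
  have hcont : ContDiffOn ℝ 1 (fun x : ℝ => x ^ α) (Icc a b) := fun x hx =>
    (contDiffAt_id.rpow_const_of_ne (ha.trans_le hx.1).ne').contDiffWithinAt
  exact hcont.exists_lipschitzOnWith one_ne_zero (convex_Icc _ _) isCompact_Icc

end RelativeLipschitz

section ParametricIntegral

variable {X : Type*} [MeasurableSpace X] {M : Measure X} {H : ℝ → X → ℝ} {H' bound : X → ℝ}
  {r : ℝ}

lemma aestronglyMeasurable_of_hasDerivAt (hr : 0 < r)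
    (hmeas : ∀ ε ∈ Metric.ball (0 : ℝ) r, AEStronglyMeasurable (H ε) M)
    (hderiv : ∀ᵐ x ∂M, HasDerivAt (fun ε => H ε x) (H' x) 0) : AEStronglyMeasurable H' M := by
  obtain ⟨u, -, hu, hu₀⟩ := exists_seq_strictAnti_tendsto' hr
  have hune : Tendsto u atTop (𝓝[≠] 0) :=
    tendsto_nhdsWithin_iff.2 ⟨hu₀, Eventually.of_forall fun n => (hu n).1.ne'⟩
  have hball : ∀ n, u n ∈ Metric.ball (0 : ℝ) r := fun n => by
    simpa [abs_of_pos (hu n).1] using (hu n).2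
  refine aestronglyMeasurable_of_tendsto_ae atTop
    (f := fun n x => (u n)⁻¹ * (H (u n) x - H 0 x)) (fun n => ?_) ?_
  · exact ((hmeas _ (hball n)).sub (hmeas 0 (Metric.mem_ball_self hr))).const_mul _
  · filter_upwards [hderiv] with x hx
    simpa [Function.comp_def] using (hasDerivAt_iff_tendsto_slope_zero.1 hx).comp hune

variable (hmeas : ∀ ε ∈ Metric.ball (0 : ℝ) r, AEStronglyMeasurable (H ε) M)
  (hint : Integrable (H 0) M) (hbound : Integrable bound M)
  (hlip : ∀ᵐ x ∂M, ∀ ε ∈ Metric.ball (0 : ℝ) r, ∀ ε' ∈ Metric.ball (0 : ℝ) r,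
    |H ε x - H ε' x| ≤ bound x * |ε - ε'|)

include hmeas hint hbound hlip

lemma integrable_of_abs_sub_le {ε : ℝ} (hε : ε ∈ Metric.ball (0 : ℝ) r) :
    Integrable (H ε) M := by
  have hr : (0 : ℝ) ∈ Metric.ball (0 : ℝ) r := Metric.mem_ball_self (Metric.pos_of_mem_ball hε)
  have hdiff : Integrable (fun x => H ε x - H 0 x) M :=
    (hbound.mul_const |ε - 0|).mono' ((hmeas ε hε).sub hint.aestronglyMeasurable)
      (hlip.mono fun x hx => hx ε hε 0 hr)
  exact (hdiff.add hint).congr (ae_of_all _ fun x => sub_add_cancel _ _)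

lemma abs_integral_sub_integral_le_of_abs_sub_le {ε ε' : ℝ} (hε : ε ∈ Metric.ball (0 : ℝ) r)
    (hε' : ε' ∈ Metric.ball (0 : ℝ) r) :
    |∫ x, H ε x ∂M - ∫ x, H ε' x ∂M| ≤ (∫ x, bound x ∂M) * |ε - ε'| := by
  rw [← integral_sub (integrable_of_abs_sub_le hmeas hint hbound hlip hε)
    (integrable_of_abs_sub_le hmeas hint hbound hlip hε'), ← integral_mul_const,
    ← Real.norm_eq_abs]
  refine norm_integral_le_of_norm_le (hbound.mul_const |ε - ε'|) ?_
  filter_upwards [hlip] with x hx using hx ε hε ε' hε'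

lemma hasDerivAt_integral_of_abs_sub_le (hr : 0 < r)
    (hderiv : ∀ᵐ x ∂M, HasDerivAt (fun ε => H ε x) (H' x) 0) :
    Integrable H' M ∧ HasDerivAt (fun ε => ∫ x, H ε x ∂M) (∫ x, H' x ∂M) 0 := by
  have hball : Metric.ball (0 : ℝ) r ∈ 𝓝 (0 : ℝ) := Metric.ball_mem_nhds 0 hr
  refine hasDerivAt_integral_of_dominated_loc_of_lip (bound := bound) hball
    (mem_of_superset hball hmeas) hint (aestronglyMeasurable_of_hasDerivAt hr hmeas hderiv) ?_
    hbound hderiv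
  filter_upwards [hlip] with x hx
  refine LipschitzOnWith.of_dist_le_mul fun ε hε ε' hε' => (hx ε hε ε' hε').trans ?_
  rw [Real.coe_nnabs, Real.dist_eq]
  gcongr
  exact le_abs_self _

end ParametricIntegral

section PowerProduct

variable {X : Type*} [MeasurableSpace X] {M : Measure X} {α β C r : ℝ} {F V : ℝ → X → ℝ}
  {F' V' : X → ℝ}

lemma exists_isRelLipschitz_rpow_mul_rpow (α β : ℝ) (hC : 0 ≤ C) (hr : 0 < r) :
    ∃ C' s, 0 < s ∧ s ≤ r ∧ ∀ f g : ℝ → ℝ, 0 ≤ f 0 → 0 ≤ g 0 → IsRelLipschitz C r f →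
      IsRelLipschitz C r g → IsRelLipschitz C' s fun ε => f ε ^ α * g ε ^ β := by
  obtain ⟨K, hK⟩ := exists_lipschitzOnWith_rpow_const (b := 3 / 2) one_half_pos α
  obtain ⟨L, hL⟩ := exists_lipschitzOnWith_rpow_const (b := 3 / 2) one_half_pos β
  let s := min r (1 / (2 * (C + 1)))
  have hs : 0 < s := by positivity
  have hCs : C * s ≤ 1 / 2 := by
    calc C * s ≤ (C + 1) * (1 / (2 * (C + 1))) := by
          gcongr
          exacts [by linarith, min_le_right _ _]
      _ = 1 / 2 := by field_simp
  exact ⟨_, s, hs, min_le_left _ _, fun f g hf₀ hg₀ hf hg =>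
    ((hf.mono le_rfl (min_le_left _ _)).rpow hK hC hCs hf₀).mul
      ((hg.mono le_rfl (min_le_left _ _)).rpow hL hC hCs hg₀) (by positivity) (by positivity)⟩

lemma hasDerivAt_integral_rpow_mul_rpow (hα : α ≠ 0) (hβ : β ≠ 0) (hC : 0 ≤ C) (hr : 0 < r)
    (hFm : ∀ ε ∈ Metric.ball (0 : ℝ) r, AEStronglyMeasurable (F ε) M)
    (hVm : ∀ ε ∈ Metric.ball (0 : ℝ) r, AEStronglyMeasurable (V ε) M)
    (hF₀ : ∀ᵐ x ∂M, 0 ≤ F 0 x) (hV₀ : ∀ᵐ x ∂M, 0 ≤ V 0 x)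
    (hF : ∀ᵐ x ∂M, IsRelLipschitz C r fun ε => F ε x)
    (hV : ∀ᵐ x ∂M, IsRelLipschitz C r fun ε => V ε x)
    (hF' : ∀ᵐ x ∂M, HasDerivAt (fun ε => F ε x) (F' x) 0)
    (hV' : ∀ᵐ x ∂M, HasDerivAt (fun ε => V ε x) (V' x) 0)
    (hint : Integrable (fun x => F 0 x ^ α * V 0 x ^ β) M) :
    (∀ᶠ ε in 𝓝 (0 : ℝ), Integrable (fun x => F ε x ^ α * V ε x ^ β) M) ∧
    Integrable (fun x => α * (F 0 x ^ (α - 1) * V 0 x ^ β * F' x)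
      + β * (F 0 x ^ α * V 0 x ^ (β - 1) * V' x)) M ∧
    HasDerivAt (fun ε => ∫ x, F ε x ^ α * V ε x ^ β ∂M)
      (∫ x, (α * (F 0 x ^ (α - 1) * V 0 x ^ β * F' x)
        + β * (F 0 x ^ α * V 0 x ^ (β - 1) * V' x)) ∂M) 0 := by
  obtain ⟨C', s, hs, hsr, hrel⟩ := exists_isRelLipschitz_rpow_mul_rpow α β hC hr
  have hmeas : ∀ ε ∈ Metric.ball (0 : ℝ) s,
      AEStronglyMeasurable (fun x => F ε x ^ α * V ε x ^ β) M := fun ε hε =>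
    (((hFm ε (Metric.ball_subset_ball hsr hε)).aemeasurable.pow_const _).mul
      ((hVm ε (Metric.ball_subset_ball hsr hε)).aemeasurable.pow_const _)).aestronglyMeasurable
  have hbound : Integrable (fun x => C' * |F 0 x ^ α * V 0 x ^ β|) M := hint.abs.const_mul C'
  have hlip : ∀ᵐ x ∂M, IsRelLipschitz C' s fun ε => F ε x ^ α * V ε x ^ β := by
    filter_upwards [hF₀, hV₀, hF, hV] with x hF₀x hV₀x hFx hVx
    exact hrel _ _ hF₀x hV₀x hFx hVx
  refine ⟨mem_of_superset (Metric.ball_mem_nhds 0 hs) fun ε hε =>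
      integrable_of_abs_sub_le hmeas hint hbound hlip hε,
    hasDerivAt_integral_of_abs_sub_le hmeas hint hbound hlip hs ?_⟩
  filter_upwards [hF, hV, hF', hV'] with x hFx hVx hF'x hV'x
  refine ((hFx.hasDerivAt_rpow hr hα hF'x).mul (hVx.hasDerivAt_rpow hr hβ hV'x)).congr_deriv ?_
  ring

end PowerProduct

section NormPow

lemma abs_rpow_sub_rpow_le {p : ℝ} (hp : 1 ≤ p) {R x y : ℝ} (hx : x ∈ Icc 0 R)
    (hy : y ∈ Icc 0 R) : |x ^ p - y ^ p| ≤ p * R ^ (p - 1) * |x - y| := by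
  have hp₀ : 0 ≤ p := zero_le_one.trans hp
  refine (convex_Icc (0 : ℝ) R).norm_image_sub_le_of_norm_hasDerivWithin_le
    (f := fun x : ℝ => x ^ p) (f' := fun x => p * x ^ (p - 1))
    (fun z _ => (Real.hasDerivAt_rpow_const (Or.inr hp)).hasDerivWithinAt) (fun z hz => ?_) hy hx
  rw [Real.norm_of_nonneg (mul_nonneg hp₀ (Real.rpow_nonneg hz.1 _))]
  exact mul_le_mul_of_nonneg_left (Real.rpow_le_rpow hz.1 hz.2 (sub_nonneg.2 hp)) hp₀

variable {E : Type*} [NormedAddCommGroup E]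

lemma abs_norm_add_smul_rpow_sub_le [NormedSpace ℝ E] {p : ℝ} (hp : 1 ≤ p) {B : ℝ} (hB : 0 ≤ B)
    {a z : E} (hz : ‖z‖ ≤ B * (1 + ‖a‖)) {ε ε' : ℝ} (hε : |ε| ≤ 1) (hε' : |ε'| ≤ 1) :
    |‖a + ε • z‖ ^ p - ‖a + ε' • z‖ ^ p|
      ≤ p * (1 + B) ^ p * 2 ^ (p - 1) * (‖a‖ ^ p + 1) * |ε - ε'| := by
  let R := (1 + B) * (1 + ‖a‖)
  have hR : 0 < R := by positivity
  have hmem : ∀ e : ℝ, |e| ≤ 1 → ‖a + e • z‖ ∈ Icc 0 R := fun e he => by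
    refine ⟨norm_nonneg _, (norm_add_le _ _).trans ?_⟩
    rw [norm_smul, Real.norm_eq_abs]
    nlinarith [mul_le_mul he hz (norm_nonneg z) zero_le_one]
  have hsub : |‖a + ε • z‖ - ‖a + ε' • z‖| ≤ R * |ε - ε'| := by
    refine (abs_norm_sub_norm_le _ _).trans ?_
    rw [add_sub_add_left_eq_sub, ← sub_smul, norm_smul, Real.norm_eq_abs, mul_comm]
    gcongr
    exact hz.trans (mul_le_mul_of_nonneg_right (by linarith) (by positivity))
  have hpow : (1 + ‖a‖) ^ p ≤ 2 ^ (p - 1) * (‖a‖ ^ p + 1) := by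
    simpa [add_comm] using NNReal.coe_le_coe.2 (NNReal.rpow_add_le_mul_rpow_add_rpow 1 ‖a‖₊ hp)
  calc |‖a + ε • z‖ ^ p - ‖a + ε' • z‖ ^ p|
      ≤ p * R ^ (p - 1) * (R * |ε - ε'|) :=
        (abs_rpow_sub_rpow_le hp (hmem ε hε) (hmem ε' hε')).trans (by gcongr)
    _ = p * ((1 + B) ^ p * (1 + ‖a‖) ^ p) * |ε - ε'| := by
        rw [← Real.mul_rpow (by positivity) (by positivity), Real.rpow_sub_one hR.ne']
        change _ = p * R ^ p * |ε - ε'|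
        field_simp
    _ ≤ p * ((1 + B) ^ p * (2 ^ (p - 1) * (‖a‖ ^ p + 1))) * |ε - ε'| := by gcongr
    _ = p * (1 + B) ^ p * 2 ^ (p - 1) * (‖a‖ ^ p + 1) * |ε - ε'| := by ring

lemma hasDerivAt_norm_add_smul_rpow [InnerProductSpace ℝ E] {p : ℝ} (hp : 1 < p) (a z : E) :
    HasDerivAt (fun ε : ℝ => ‖a + ε • z‖ ^ p) (p * (‖a‖ ^ (p - 2) * inner ℝ z a)) 0 := by
  have hline : HasDerivAt (fun ε : ℝ => a + ε • z) z 0 := by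
    simpa using ((hasDerivAt_id (0 : ℝ)).smul_const z).const_add a
  convert! (hasFDerivAt_norm_rpow (a + (0 : ℝ) • z) hp).comp_hasDerivAt 0 hline using 1
  simp [real_inner_comm, mul_assoc]

end NormPow

section InternalAlong

lemma isRelLipschitz_integral {X : Type*} [MeasurableSpace X] {M : Measure X} {C r : ℝ}
    {H : ℝ → X → ℝ} (hmeas : ∀ ε ∈ Metric.ball (0 : ℝ) r, AEStronglyMeasurable (H ε) M)
    (h₀ : 0 ≤ᵐ[M] H 0) (hint : Integrable (H 0) M)
    (hH : ∀ᵐ x ∂M, IsRelLipschitz C r fun ε => H ε x) :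
    IsRelLipschitz C r fun ε => ∫ x, H ε x ∂M := fun ε hε ε' hε' => by
  have habs : ∫ x, C * |H 0 x| ∂M = C * |∫ x, H 0 x ∂M| := by
    rw [integral_const_mul, abs_of_nonneg (integral_nonneg_of_ae h₀)]
    exact congrArg (C * ·) (integral_congr_ae (h₀.mono fun x hx => abs_of_nonneg hx))
  rw [← habs]
  exact abs_integral_sub_integral_le_of_abs_sub_le hmeas hint (hint.abs.const_mul C) hH hε hε'

lemma exists_isRelLipschitz_detFactor_smul (E : Type*) [NormedAddCommGroup E] [NormedSpace ℝ E]
    [FiniteDimensional ℝ E] (q B : ℝ) :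
    ∃ C r, 0 ≤ C ∧ 0 < r ∧ ∀ A : E →L[ℝ] E, ‖A‖ ≤ B →
      (∀ ε ∈ Metric.ball (0 : ℝ) r, 0 < (1 + ε • A).det) ∧
      IsRelLipschitz C r fun ε => detFactor q (ε • A) := by
  obtain ⟨s, hs, K, hK, hdet⟩ := exists_lipschitzOnWith_detFactor E q
  refine ⟨K * |B|, s / (|B| + 1), by positivity, by positivity, fun A hA => ?_⟩
  have hAB : ‖A‖ ≤ |B| := hA.trans (le_abs_self B)
  have hmem : ∀ ε ∈ Metric.ball (0 : ℝ) (s / (|B| + 1)), ε • A ∈ Metric.ball 0 s := fun ε hε => by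
    rw [mem_ball_zero_iff, lt_div_iff₀ (by positivity)] at hε
    rw [mem_ball_zero_iff, norm_smul]
    exact (mul_le_mul_of_nonneg_left (hAB.trans (by linarith)) (norm_nonneg ε)).trans_lt hε
  refine ⟨fun ε hε => hdet _ (hmem ε hε), fun ε hε ε' hε' => ?_⟩
  have hlip := hK.dist_le_mul _ (hmem ε hε) _ (hmem ε' hε')
  rw [Real.dist_eq, dist_eq_norm, ← sub_smul ε ε' A, norm_smul, Real.norm_eq_abs] at hlip
  calc |detFactor q (ε • A) - detFactor q (ε' • A)| ≤ K * (|ε - ε'| * |B|) :=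
        hlip.trans (by gcongr)
    _ = K * |B| * |detFactor q ((0 : ℝ) • A)| * |ε - ε'| := by
        rw [zero_smul ℝ A, detFactor_zero, abs_one]; ring

lemma measurable_density (ν : Measure (Space d)) : Measurable (density ν) :=
  (Measure.measurable_rnDeriv _ _).ennreal_toReal

lemma density_nonneg (ν : Measure (Space d)) (x : Space d) : 0 ≤ density ν x :=
  ENNReal.toReal_nonneg

variable {q C r : ℝ} {Ω : Set (Space d)} {ν : Measure (Space d)}
  {D : Space d → Space d →L[ℝ] Space d}

lemma absolutelyContinuous_of_Lq_lt_top (hL : Lq q Ω ν < ⊤) : ν ≪ volume := by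
  by_contra hν
  rw [Lq, if_neg hν] at hL
  exact hL.ne rfl

lemma integrableOn_density_rpow (hL : Lq q Ω ν < ⊤) :
    IntegrableOn (fun x => density ν x ^ q) Ω := by
  have hint := hL.ne
  rw [Lq, if_pos (absolutelyContinuous_of_Lq_lt_top hL)] at hint
  simpa only [IntegrableOn, density, ← ENNReal.toReal_rpow] using
    integrable_toReal_of_lintegral_ne_top
      ((Measure.measurable_rnDeriv _ _).pow_const q).aemeasurable hint

lemma toReal_Lq (hL : Lq q Ω ν < ⊤) : (Lq q Ω ν).toReal = ∫ x in Ω, density ν x ^ q := by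
  have hfin := hL.ne
  rw [Lq, if_pos (absolutelyContinuous_of_Lq_lt_top hL)] at hfin ⊢
  have hm : Measurable fun x => ν.rnDeriv volume x ^ q :=
    (Measure.measurable_rnDeriv _ _).pow_const q
  simpa only [density, ← ENNReal.toReal_rpow] using
    (integral_toReal hm.aemeasurable (ae_lt_top hm hfin)).symm

/-- `∫_Ω u^q det (1 + ε D)^(1 - q)`, where `u` is the density of `ν`: the internal energy `L_q` of
the image of `ν` under a map with derivative `1 + ε D`, up to the mass that leaves `Ω`. -/
noncomputable def internalAlong (q : ℝ) (Ω : Set (Space d)) (ν : Measure (Space d))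
    (D : Space d → Space d →L[ℝ] Space d) (ε : ℝ) : ℝ :=
  ∫ x in Ω, density ν x ^ q * detFactor q (ε • D x)

lemma internalAlong_zero (hL : Lq q Ω ν < ⊤)
    (D : Space d → Space d →L[ℝ] Space d) : internalAlong q Ω ν D 0 = (Lq q Ω ν).toReal := by
  rw [toReal_Lq hL, internalAlong]
  refine integral_congr_ae (ae_of_all _ fun x => ?_)
  beta_reduce
  rw [zero_smul ℝ (D x), detFactor_zero, mul_one]

lemma measurable_density_rpow_mul_detFactor (hD : Measurable D) (ε : ℝ) :
    Measurable fun x => density ν x ^ q * detFactor q (ε • D x) :=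
  ((measurable_density ν).pow_const q).mul ((measurable_detFactor q).comp (hD.const_smul ε))

lemma density_rpow_mul_detFactor_nonneg {ε : ℝ} {x : Space d} (hdet : 0 < (1 + ε • D x).det) :
    0 ≤ density ν x ^ q * detFactor q (ε • D x) :=
  mul_nonneg (Real.rpow_nonneg (density_nonneg ν x) q) (Real.rpow_nonneg hdet.le _)

lemma internalAlong_nonneg {ε : ℝ} (hdet : ∀ x, 0 < (1 + ε • D x).det) :
    0 ≤ internalAlong q Ω ν D ε :=
  integral_nonneg fun x => density_rpow_mul_detFactor_nonneg (hdet x)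

lemma integrableOn_density_rpow_mul_detFactor_zero (hL : Lq q Ω ν < ⊤)
    (D : Space d → Space d →L[ℝ] Space d) :
    IntegrableOn (fun x => density ν x ^ q * detFactor q ((0 : ℝ) • D x)) Ω := by
  refine (integrableOn_density_rpow hL).congr (ae_of_all _ fun x => ?_)
  beta_reduce
  rw [zero_smul ℝ (D x), detFactor_zero, mul_one]

section

variable (hL : Lq q Ω ν < ⊤) (hD : Measurable D)
  (hDC : ∀ x, IsRelLipschitz C r fun ε => detFactor q (ε • D x))

include hL hD hDC

lemma integrableOn_density_rpow_mul_detFactor {ε : ℝ} (hε : ε ∈ Metric.ball (0 : ℝ) r) :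
    IntegrableOn (fun x => density ν x ^ q * detFactor q (ε • D x)) Ω :=
  integrable_of_abs_sub_le (H := fun ε x => density ν x ^ q * detFactor q (ε • D x))
    (fun ε _ => (measurable_density_rpow_mul_detFactor hD ε).aestronglyMeasurable)
    (integrableOn_density_rpow_mul_detFactor_zero hL D)
    ((integrableOn_density_rpow_mul_detFactor_zero hL D).abs.const_mul C)
    (ae_of_all _ fun x => (hDC x).const_mul _) hε

lemma isRelLipschitz_internalAlong : IsRelLipschitz C r (internalAlong q Ω ν D) :=
  isRelLipschitz_integral
    (fun ε _ => (measurable_density_rpow_mul_detFactor hD ε).aestronglyMeasurable)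
    (ae_of_all _ fun x => density_rpow_mul_detFactor_nonneg <| by
      rw [zero_smul ℝ (D x), add_zero, det_one_continuousLinearMap]; exact one_pos)
    (integrableOn_density_rpow_mul_detFactor_zero hL D) (ae_of_all _ fun x => (hDC x).const_mul _)

lemma hasDerivAt_internalAlong (hr : 0 < r) :
    HasDerivAt (internalAlong q Ω ν D)
      ((1 - q) * ∫ x in Ω, LinearMap.trace ℝ (Space d) (D x) * density ν x ^ q) 0 := by
  have hderiv := (hasDerivAt_integral_of_abs_sub_le
    (fun ε _ => (measurable_density_rpow_mul_detFactor hD ε).aestronglyMeasurable)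
    (integrableOn_density_rpow_mul_detFactor_zero hL D)
    ((integrableOn_density_rpow_mul_detFactor_zero hL D).abs.const_mul C)
    (ae_of_all _ fun x => (hDC x).const_mul _) hr
    (ae_of_all _ fun x => (hasDerivAt_detFactor q (D x)).const_mul (density ν x ^ q))).2
  rw [← integral_const_mul]
  refine hderiv.congr_deriv (integral_congr_ae (ae_of_all _ fun x => ?_))
  ring

lemma ofReal_internalAlong [SigmaFinite ν] (hq : 0 ≤ q) {ε : ℝ} (hε : ε ∈ Metric.ball (0 : ℝ) r)
    (hdet : ∀ x, 0 < (1 + ε • D x).det) :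
    ENNReal.ofReal (internalAlong q Ω ν D ε) =
      ∫⁻ x in Ω, ν.rnDeriv volume x ^ q * ENNReal.ofReal |(1 + ε • D x).det| ^ (1 - q) := by
  rw [internalAlong, ofReal_integral_eq_lintegral_ofReal
    (integrableOn_density_rpow_mul_detFactor hL hD hDC hε)
    (ae_of_all _ fun x => density_rpow_mul_detFactor_nonneg (hdet x))]
  refine lintegral_congr_ae (ae_restrict_of_ae ?_)
  filter_upwards [ν.rnDeriv_lt_top volume] with x hx
  rw [ENNReal.ofReal_mul (Real.rpow_nonneg (density_nonneg ν x) q), abs_of_pos (hdet x),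
    ENNReal.ofReal_rpow_of_pos (hdet x), ← ENNReal.ofReal_rpow_of_nonneg (density_nonneg ν x) hq,
    density, ENNReal.ofReal_toReal hx.ne, detFactor]

end

end InternalAlong

section KineticAlong

variable {X : Type*} [MeasurableSpace X] {E : Type*} [NormedAddCommGroup E] {p B : ℝ}
  {ν : Measure X} {a z : X → E}

lemma integrable_norm_rpow_of_memLp (hp : 0 < p) (ha : MemLp a (ENNReal.ofReal p) ν) :
    Integrable (fun x => ‖a x‖ ^ p) ν := by
  simpa only [ENNReal.toReal_ofReal hp.le] using
    ha.integrable_norm_rpow (by simpa using hp) ENNReal.ofReal_ne_top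

/-- `∫ |a + ε z|^p dν`: the kinetic energy carried by a velocity `a` that is varied in the
direction `z`. -/
noncomputable def kineticAlong [NormedSpace ℝ E] (p : ℝ) (ν : Measure X) (a z : X → E) (ε : ℝ) :
    ℝ :=
  ∫ x, ‖a x + ε • z x‖ ^ p ∂ν

lemma kineticAlong_nonneg [NormedSpace ℝ E] (p : ℝ) (ν : Measure X) (a z : X → E) (ε : ℝ) :
    0 ≤ kineticAlong p ν a z ε :=
  integral_nonneg fun _ => Real.rpow_nonneg (norm_nonneg _) p

lemma memLp_add_smul [NormedSpace ℝ E] [IsFiniteMeasure ν] (ha : MemLp a (ENNReal.ofReal p) ν)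
    (hz : AEStronglyMeasurable z ν) (hzB : ∀ x, ‖z x‖ ≤ B * (1 + ‖a x‖)) (ε : ℝ) :
    MemLp (fun x => a x + ε • z x) (ENNReal.ofReal p) ν := by
  have hbound : MemLp (fun x => B * (1 + ‖a x‖)) (ENNReal.ofReal p) ν :=
    ((memLp_const (1 : ℝ)).add ha.norm).const_mul B
  exact ha.add ((hbound.mono' hz (ae_of_all _ hzB)).const_smul ε)

lemma ofReal_kineticAlong [NormedSpace ℝ E] [IsFiniteMeasure ν] (hp : 0 < p)
    (ha : MemLp a (ENNReal.ofReal p) ν) (hz : AEStronglyMeasurable z ν)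
    (hzB : ∀ x, ‖z x‖ ≤ B * (1 + ‖a x‖)) (ε : ℝ) :
    ENNReal.ofReal (kineticAlong p ν a z ε) = ∫⁻ x, ‖a x + ε • z x‖ₑ ^ p ∂ν := by
  rw [kineticAlong, ofReal_integral_eq_lintegral_ofReal
    (integrable_norm_rpow_of_memLp hp (memLp_add_smul ha hz hzB ε))
    (ae_of_all _ fun x => Real.rpow_nonneg (norm_nonneg _) p)]
  refine lintegral_congr fun x => ?_
  rw [← ENNReal.ofReal_rpow_of_nonneg (norm_nonneg _) hp.le, ofReal_norm]

section

variable [IsProbabilityMeasure ν] (hB : 0 ≤ B) (ha : MemLp a (ENNReal.ofReal p) ν)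
  (hz : AEStronglyMeasurable z ν) (hzB : ∀ x, ‖z x‖ ≤ B * (1 + ‖a x‖))

include hB ha hz hzB

lemma isRelLipschitz_kineticAlong [NormedSpace ℝ E] (hp : 1 ≤ p) {V₀ : ℝ} (hV₀ : 0 < V₀)
    (hV : V₀ ≤ kineticAlong p ν a z 0) :
    IsRelLipschitz (p * (1 + B) ^ p * 2 ^ (p - 1) * (1 + V₀⁻¹)) 1 (kineticAlong p ν a z) := by
  intro ε hε ε' hε'
  have hp₀ : 0 < p := one_pos.trans_le hp
  have hint : ∀ e, Integrable (fun x => ‖a x + e • z x‖ ^ p) ν := fun e =>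
    integrable_norm_rpow_of_memLp hp₀ (memLp_add_smul ha hz hzB e)
  have ha' : Integrable (fun x => ‖a x‖ ^ p) ν := integrable_norm_rpow_of_memLp hp₀ ha
  have hbound : ∫ x, p * (1 + B) ^ p * 2 ^ (p - 1) * (‖a x‖ ^ p + 1) ∂ν =
      p * (1 + B) ^ p * 2 ^ (p - 1) * (kineticAlong p ν a z 0 + 1) := by
    rw [integral_const_mul, integral_add ha' (integrable_const 1)]
    simp [kineticAlong]
  have hone : 1 ≤ V₀⁻¹ * kineticAlong p ν a z 0 := by
    rw [← inv_mul_cancel₀ hV₀.ne']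
    gcongr
  calc |kineticAlong p ν a z ε - kineticAlong p ν a z ε'|
      ≤ p * (1 + B) ^ p * 2 ^ (p - 1) * (kineticAlong p ν a z 0 + 1) * |ε - ε'| := by
        rw [← hbound]
        refine abs_integral_sub_integral_le_of_abs_sub_le (r := 1)
          (H := fun ε x => ‖a x + ε • z x‖ ^ p) (fun e _ => (hint e).aestronglyMeasurable) (hint 0)
          ((ha'.add (integrable_const 1)).const_mul _) (ae_of_all _ fun x e he e' he' => ?_) hε hε'
        exact abs_norm_add_smul_rpow_sub_le hp hB (hzB x) (mem_ball_zero_iff.1 he).le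
          (mem_ball_zero_iff.1 he').le
    _ ≤ p * (1 + B) ^ p * 2 ^ (p - 1) * (1 + V₀⁻¹) * |kineticAlong p ν a z 0| * |ε - ε'| := by
        rw [abs_of_nonneg (hV₀.le.trans hV), mul_assoc _ (1 + V₀⁻¹)]
        gcongr
        linarith

lemma hasDerivAt_kineticAlong [InnerProductSpace ℝ E] (hp : 1 < p) :
    Integrable (fun x => ‖a x‖ ^ (p - 2) * inner ℝ (z x) (a x)) ν ∧
    HasDerivAt (kineticAlong p ν a z) (p * ∫ x, ‖a x‖ ^ (p - 2) * inner ℝ (z x) (a x) ∂ν) 0 := by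
  have hp₀ : 0 < p := one_pos.trans hp
  have hint : ∀ e : ℝ, Integrable (fun x => ‖a x + e • z x‖ ^ p) ν := fun e =>
    integrable_norm_rpow_of_memLp hp₀ (memLp_add_smul ha hz hzB e)
  rw [← integral_const_mul, ← integrable_const_mul_iff (IsUnit.mk0 p hp₀.ne')]
  exact hasDerivAt_integral_of_abs_sub_le (fun e _ => (hint e).aestronglyMeasurable) (hint 0)
    (((integrable_norm_rpow_of_memLp hp₀ ha).add (integrable_const 1)).const_mul
      (p * (1 + B) ^ p * 2 ^ (p - 1)))
    (ae_of_all _ fun x e he e' he' => abs_norm_add_smul_rpow_sub_le hp.le hB (hzB x)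
      (mem_ball_zero_iff.1 he).le (mem_ball_zero_iff.1 he').le) one_pos
    (ae_of_all _ fun x => hasDerivAt_norm_add_smul_rpow hp (a x) (z x))

end

end KineticAlong

section DensityIntegral

variable {Ω : Set (Space d)} {ν : Measure (Space d)} {f : Space d → ℝ}

lemma integrable_density_mul [SigmaFinite ν] (hν : ν ≪ volume) (hf : Integrable f ν) :
    Integrable (fun x => density ν x * f x) :=
  (integrable_rnDeriv_smul_iff hν).2 hf

lemma setIntegral_density_mul [SigmaFinite ν] (hΩ : MeasurableSet Ω) (hν : ν ≪ volume)
    (hνΩ : ν Ωᶜ = 0) : ∫ x in Ω, density ν x * f x = ∫ x, f x ∂ν := by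
  rw [← integral_rnDeriv_smul hν]
  refine setIntegral_eq_integral_of_ae_compl_eq_zero ?_
  filter_upwards [ae_rnDeriv_eq_zero_of_notMem hΩ hνΩ] with x hx hxΩ
  simp [density, hx hxΩ]

end DensityIntegral

section JointMeasurability

lemma exists_measurable_rnDeriv (κ : Kernel ℝ (Space d)) [IsMarkovKernel κ] :
    ∃ U : ℝ × Space d → ℝ≥0∞, Measurable U ∧
      ∀ t, κ t ≪ volume → (fun x => U (t, x)) =ᵐ[volume] (κ t).rnDeriv volume := by
  -- `Kernel.rnDeriv` needs a finite reference kernel, so pass through a finite measure equivalent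
  -- to Lebesgue measure.
  let σ : Measure (Space d) := (volume : Measure (Space d)).toFinite
  have hvolσ : (volume : Measure (Space d)) ≪ σ := absolutelyContinuous_toFinite volume
  refine ⟨fun z => Kernel.rnDeriv κ (Kernel.const ℝ σ) z.1 z.2 * σ.rnDeriv volume z.2,
    (Kernel.measurable_rnDeriv _ _).mul
      ((Measure.measurable_rnDeriv _ _).comp measurable_snd), fun t ht => ?_⟩
  have hkernel : Kernel.rnDeriv κ (Kernel.const ℝ σ) t =ᵐ[volume] (κ t).rnDeriv σ :=
    hvolσ.ae_le (Kernel.rnDeriv_eq_rnDeriv_measure (κ := κ) (η := Kernel.const ℝ σ) (a := t))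
  have hchain : (κ t).rnDeriv σ * σ.rnDeriv volume =ᵐ[volume] (κ t).rnDeriv volume :=
    Measure.rnDeriv_mul_rnDeriv (ht.trans hvolσ)
  filter_upwards [hkernel, hchain] with x hxκ hxσ
  rw [hxκ, ← hxσ, Pi.mul_apply]

variable {I : Measure ℝ} {μ : ℝ → Measure (Space d)} (κ : Kernel ℝ (Space d)) [IsMarkovKernel κ]
  (hκ : ∀ᵐ t ∂I, κ t = μ t)

include hκ

lemma aestronglyMeasurable_setIntegral_density_rpow_mul (hac : ∀ᵐ t ∂I, μ t ≪ volume) (q : ℝ)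
    (Ω : Set (Space d)) {g : ℝ × Space d → ℝ} (hg : Measurable g) :
    AEStronglyMeasurable (fun t => ∫ x in Ω, density (μ t) x ^ q * g (t, x)) I := by
  obtain ⟨U, hU, hU_eq⟩ := exists_measurable_rnDeriv κ
  have hm : Measurable fun z : ℝ × Space d => (U z).toReal ^ q * g z :=
    (hU.ennreal_toReal.pow_const q).mul hg
  refine (hm.stronglyMeasurable.integral_prod_right' (ν := volume.restrict Ω)).aestronglyMeasurable
    |>.congr ?_
  filter_upwards [hκ, hac] with t hκt hact
  refine integral_congr_ae (ae_restrict_of_ae ?_)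
  filter_upwards [hU_eq t (hκt ▸ hact)] with x hx
  rw [hx, density, hκt]

lemma aestronglyMeasurable_kineticAlong (p : ℝ) {v z : ℝ → Space d → Space d}
    (hv : Measurable (Function.uncurry v)) (hz : Measurable (Function.uncurry z)) (ε : ℝ) :
    AEStronglyMeasurable (fun t => kineticAlong p (μ t) (v t) (z t) ε) I := by
  have hm : Measurable fun y : ℝ × Space d =>
      ‖Function.uncurry v y + ε • Function.uncurry z y‖ ^ p :=
    (hv.add (hz.const_smul ε)).norm.pow_const p
  refine (hm.stronglyMeasurable.integral_kernel_prod_right' (κ := κ)).aestronglyMeasurable.congr ?_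
  filter_upwards [hκ] with t hκt
  rw [kineticAlong, hκt]
  rfl

end JointMeasurability

section TimeRegularity

lemma measurableSet_absolutelyContinuous_volume (κ : Kernel ℝ (Space d)) [IsMarkovKernel κ] :
    MeasurableSet {t | κ t ≪ (volume : Measure (Space d))} := by
  let σ : Measure (Space d) := (volume : Measure (Space d)).toFinite
  have hσ : {t | κ t ≪ (volume : Measure (Space d))} = {t | κ t ≪ Kernel.const ℝ σ t} :=
    Set.ext fun t => ⟨fun h => h.trans (absolutelyContinuous_toFinite volume),
      fun h => h.trans (toFinite_absolutelyContinuous volume)⟩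
  rw [hσ]
  exact Kernel.measurableSet_absolutelyContinuous κ (Kernel.const ℝ σ)

lemma aemeasurable_Lq {I : Measure ℝ} {μ : ℝ → Measure (Space d)} (κ : Kernel ℝ (Space d))
    [IsMarkovKernel κ] (hκ : ∀ᵐ t ∂I, κ t = μ t) (q : ℝ) (Ω : Set (Space d)) :
    AEMeasurable (fun t => Lq q Ω (μ t)) I := by
  classical
  obtain ⟨U, hU, hU_eq⟩ := exists_measurable_rnDeriv κ
  refine ⟨fun t => if κ t ≪ (volume : Measure (Space d)) then ∫⁻ x in Ω, U (t, x) ^ q else ⊤,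
    Measurable.ite (measurableSet_absolutelyContinuous_volume κ)
      (hU.pow_const q).lintegral_prod_right' measurable_const, ?_⟩
  filter_upwards [hκ] with t hκt
  rw [Lq, ← hκt]
  split_ifs with hac
  · exact lintegral_congr_ae (ae_restrict_of_ae <| (hU_eq t hac).mono fun x hx => by
      simp only [hx])
  · rfl

lemma ae_Icc_of_forall_ae_Icc {P : ℝ → Prop}
    (h : ∀ a b : ℝ, 0 < a → a < b → b < 1 → ∀ᵐ t ∂(volume.restrict (Icc a b)), P t) :
    ∀ᵐ t ∂(volume.restrict (Icc (0 : ℝ) 1)), P t := by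
  obtain ⟨u, -, hu, hu_lim⟩ := exists_seq_strictAnti_tendsto' (one_half_pos (α := ℝ))
  have hcover : Ioo (0 : ℝ) 1 ⊆ ⋃ n, Icc (u n) (1 - u n) := fun t ht => by
    obtain ⟨n, hn⟩ := (hu_lim.eventually_lt_const (lt_min ht.1 (sub_pos.2 ht.2))).exists
    obtain ⟨hleft, hright⟩ := lt_min_iff.1 hn
    exact mem_iUnion.2 ⟨n, hleft.le, by linarith⟩
  rw [← restrict_Ioo_eq_restrict_Icc]
  refine ae_restrict_of_ae_restrict_of_subset hcover ((ae_restrict_iUnion_iff _ _).2 fun n => ?_)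
  exact h _ _ (hu n).1 (by linarith [(hu n).2]) (by linarith [(hu n).1])

lemma ae_Lq_lt_top {p q α β : ℝ} (hα : 0 < α) (hβ : 0 < β) {Ω : Set (Space d)}
    {μ : ℝ → Measure (Space d)} {v : ℝ → Space d → Space d}
    (hv : Measurable (Function.uncurry v)) (κ : Kernel ℝ (Space d)) [IsMarkovKernel κ]
    (hκ : ∀ᵐ t ∂(volume.restrict (Icc (0 : ℝ) 1)), κ t = μ t)
    (hfin : energyOf p q α β Ω μ v < ⊤)
    (hpos : ∀ᵐ t ∂(volume.restrict (Icc (0 : ℝ) 1)), 0 < kinetic p μ v t) :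
    ∀ᵐ t ∂(volume.restrict (Icc (0 : ℝ) 1)), Lq q Ω (μ t) < ⊤ := by
  have hkinetic : AEMeasurable (kinetic p μ v) (volume.restrict (Icc (0 : ℝ) 1)) :=
    (measurable_kinetic κ p hv).aemeasurable.congr <| hκ.mono fun t ht => by
      simp only [kinetic, ht]
  filter_upwards [ae_lt_top' (((aemeasurable_Lq κ hκ q Ω).pow_const α).mul
    (hkinetic.pow_const β)) hfin.ne, hpos] with t hfin_t hpos_t
  refine lt_top_iff_ne_top.2 fun htop => hfin_t.ne ?_
  rw [Pi.mul_apply, htop, ENNReal.top_rpow_of_pos hα, ENNReal.top_mul]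
  exact (ENNReal.rpow_pos_of_nonneg hpos_t hβ.le).ne'

end TimeRegularity

section SpatialDerivative

/-- The derivative in space of `ξ` at `z = (t, x)`, as a linear map. -/
noncomputable def spatialDeriv (ξ : ℝ × Space d → Space d) (z : ℝ × Space d) :
    Space d →L[ℝ] Space d :=
  (fderiv ℝ ξ z).comp (ContinuousLinearMap.inr ℝ ℝ (Space d))

variable {ξ : ℝ × Space d → Space d} {B ε : ℝ}

lemma norm_spatialDeriv_le (hB : ∀ z, ‖fderiv ℝ ξ z‖ ≤ B) (z : ℝ × Space d) :
    ‖spatialDeriv ξ z‖ ≤ B :=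
  calc ‖spatialDeriv ξ z‖
      ≤ ‖fderiv ℝ ξ z‖ * ‖ContinuousLinearMap.inr ℝ ℝ (Space d)‖ :=
        ContinuousLinearMap.opNorm_comp_le _ _
    _ ≤ ‖fderiv ℝ ξ z‖ * 1 := by
        gcongr
        exact ContinuousLinearMap.norm_inr_le_one ℝ ℝ (Space d)
    _ ≤ B := (mul_one _).trans_le (hB z)

lemma measurable_spatialDeriv (hξ : ContDiff ℝ 1 ξ) : Measurable (spatialDeriv ξ) :=
  ((hξ.continuous_fderiv one_ne_zero).clm_comp continuous_const).measurable

lemma divergence_eq_trace (hξ : Differentiable ℝ ξ) (t : ℝ) (x : Space d) :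
    divergence ξ t x = LinearMap.trace ℝ (Space d) (spatialDeriv ξ (t, x)) := by
  rw [divergence, (hasFDerivAt_slice hξ t x).fderiv,
    LinearMap.trace_eq_sum_inner _ (EuclideanSpace.basisFun (Fin d) ℝ)]
  simp [spatialDeriv, EuclideanSpace.inner_single_left]

lemma abs_divergence_le (hξ : Differentiable ℝ ξ) (hB : ∀ z, ‖fderiv ℝ ξ z‖ ≤ B) (t : ℝ)
    (x : Space d) : |divergence ξ t x| ≤ d * B := by
  have hterm : ∀ i : Fin d,
      |fderiv ℝ (fun y => ξ (t, y)) x (EuclideanSpace.single i 1) i| ≤ B := fun i =>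
    calc |fderiv ℝ (fun y => ξ (t, y)) x (EuclideanSpace.single i 1) i|
        ≤ ‖spatialDeriv ξ (t, x) (EuclideanSpace.single i 1)‖ := by
          rw [(hasFDerivAt_slice hξ t x).fderiv]
          exact PiLp.norm_apply_le (spatialDeriv ξ (t, x) (EuclideanSpace.single i 1)) i
      _ ≤ ‖spatialDeriv ξ (t, x)‖ := by
          simpa using (spatialDeriv ξ (t, x)).le_opNorm (EuclideanSpace.single i 1)
      _ ≤ B := norm_spatialDeriv_le hB _
  calc |divergence ξ t x| ≤ ∑ _i : Fin d, B :=
        (Finset.abs_sum_le_sum_abs _ _).trans (Finset.sum_le_sum fun i _ => hterm i)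
    _ = d * B := by simp

lemma measurable_divergence (hξ : ContDiff ℝ 1 ξ) :
    Measurable fun z : ℝ × Space d => divergence ξ z.1 z.2 := by
  simp only [divergence_eq_trace (hξ.differentiable one_ne_zero)]
  exact ((LinearMap.trace ℝ (Space d)).comp
    (ContinuousLinearMap.coeLM ℝ)).continuous_of_finiteDimensional.measurable.comp
      (measurable_spatialDeriv hξ)

lemma transportDeriv_eq_zero (hξ : Differentiable ℝ ξ) {t : ℝ} {x : Space d}
    (h : (t, x) ∉ tsupport ξ) (w : Space d) : transportDeriv ξ t x w = 0 := by
  have hderiv : fderiv ℝ ξ (t, x) = 0 :=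
    image_eq_zero_of_notMem_tsupport fun h' => h (tsupport_fderiv_subset ℝ h')
  rw [transportDeriv_eq hξ, hderiv, zero_apply]

lemma hasFDerivAt_perturb (hξ : Differentiable ℝ ξ) (ε t : ℝ) (x : Space d) :
    HasFDerivAt (perturb ξ ε t) (1 + ε • spatialDeriv ξ (t, x)) x :=
  (hasFDerivAt_id x).add ((hasFDerivAt_slice hξ t x).const_smul ε)

lemma exists_measurable_inverse_perturb (hξ : Differentiable ℝ ξ)
    (hB : ∀ z, ‖fderiv ℝ ξ z‖ ≤ B) (hε : |ε| * B < 1) (t : ℝ) :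
    ∃ g : Space d → Space d, Measurable g ∧
      Function.LeftInverse g (perturb ξ ε t) ∧ Function.RightInverse g (perturb ξ ε t) := by
  obtain ⟨h, hh⟩ := exists_homeomorph_perturb hξ hB hε
  have hfst : ∀ y, (h.symm (t, y)).1 = t := fun y => by
    simpa only [hh] using congrArg Prod.fst (h.apply_symm_apply (t, y))
  have hsnd : ∀ y, perturb ξ ε (h.symm (t, y)).1 (h.symm (t, y)).2 = y := fun y => by
    simpa only [hh] using congrArg Prod.snd (h.apply_symm_apply (t, y))
  refine ⟨fun y => (h.symm (t, y)).2,
    (h.symm.continuous.comp (Continuous.prodMk_right t)).measurable.snd, fun x => ?_, fun y => ?_⟩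
  · simp only [← hh, h.symm_apply_apply]
  · simpa only [hfst] using hsnd y

end SpatialDerivative

lemma exists_subset_Icc_of_isCompact {a b : ℝ} (hab : a < b) {K : Set ℝ} (hK : IsCompact K)
    (hKab : K ⊆ Ioo a b) : ∃ s t, a < s ∧ s < t ∧ t < b ∧ K ⊆ Icc s t := by
  obtain ⟨m, hm⟩ := exists_between hab
  obtain ⟨n, hn⟩ := exists_between hm.2
  have hn' : n ∈ Ioo a b := ⟨hm.1.trans hn.1, hn.2⟩
  have hL : IsCompact (insert m (insert n K)) := (hK.insert n).insert m
  have hLab : insert m (insert n K) ⊆ Ioo a b := insert_subset hm (insert_subset hn' hKab)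
  have hne : (insert m (insert n K)).Nonempty := ⟨m, mem_insert m _⟩
  refine ⟨sInf _, sSup _, (hLab (hL.sInf_mem hne)).1, ?_, (hLab (hL.sSup_mem hne)).2,
    fun t ht => ⟨csInf_le hL.bddBelow (Or.inr (Or.inr ht)),
      le_csSup hL.bddAbove (Or.inr (Or.inr ht))⟩⟩
  exact ((csInf_le hL.bddBelow (mem_insert m _)).trans_lt hn.1).trans_le
    (le_csSup hL.bddAbove (Or.inr (mem_insert n K)))

lemma IsAdmissible.perturbCurve {p B ε : ℝ} (hp : 1 ≤ p) {Ω : Set (Space d)}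
    (hΩm : MeasurableSet Ω) {μ₀ μ₁ : Measure (Space d)} {μ : ℝ → Measure (Space d)}
    (hμ : IsAdmissible p Ω μ₀ μ₁ μ) {ξ : ℝ × Space d → Space d} (hξ : Differentiable ℝ ξ)
    (hc : HasCompactSupport ξ) (hsub : tsupport ξ ⊆ Ioo (0 : ℝ) 1 ×ˢ univ)
    (hB : ∀ z, ‖fderiv ℝ ξ z‖ ≤ B) (hε : |ε| ≤ 1) (hΩ : ∀ t, ∀ x ∈ Ω, perturb ξ ε t x ∈ Ω) :
    IsAdmissible p Ω μ₀ μ₁ (perturbCurve ξ ε μ) := by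
  have hend : ∀ t ∉ Ioo (0 : ℝ) 1, WGeod.perturbCurve ξ ε μ t = μ t := fun t ht => by
    have hid : perturb ξ ε t = id := funext fun x =>
      perturb_eq_self_of_notMem_tsupport ε fun h => ht (hsub h).1
    rw [WGeod.perturbCurve, hid, Measure.map_id]
  exact ⟨hμ.curve.perturbCurve hp hΩm hξ hc hB hε hΩ, (hend 0 (by simp)).trans hμ.init,
    (hend 1 (by simp)).trans hμ.final⟩

section Variation

/-- The internal energy of the perturbed curve `perturbCurve ξ ε μ` at time `t`, up to the mass that
leaves `Ω`, as a function of `ε`. -/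
noncomputable def internalVariation (q : ℝ) (Ω : Set (Space d)) (μ : ℝ → Measure (Space d))
    (ξ : ℝ × Space d → Space d) (ε t : ℝ) : ℝ :=
  internalAlong q Ω (μ t) (fun x => spatialDeriv ξ (t, x)) ε

/-- The kinetic energy, at time `t`, of the velocity field that the perturbed curve
`perturbCurve ξ ε μ` inherits from the velocity field `v` of `μ`, as a function of `ε`. -/
noncomputable def kineticVariation (p : ℝ) (μ : ℝ → Measure (Space d))
    (v : ℝ → Space d → Space d) (ξ : ℝ × Space d → Space d) (ε t : ℝ) : ℝ :=
  kineticAlong p (μ t) (v t) (fun x => transportDeriv ξ t x (v t x)) ε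

variable {ξ : ℝ × Space d → Space d} {p q B C r ε t : ℝ} {Ω : Set (Space d)}
  {μ : ℝ → Measure (Space d)} {v : ℝ → Space d → Space d}

section Internal

lemma internalVariation_zero (hL : Lq q Ω (μ t) < ⊤) :
    internalVariation q Ω μ ξ 0 t = (Lq q Ω (μ t)).toReal :=
  internalAlong_zero hL _

lemma internalVariation_nonneg (hdet : ∀ z, 0 < (1 + ε • spatialDeriv ξ z).det) :
    0 ≤ internalVariation q Ω μ ξ ε t :=
  internalAlong_nonneg fun x => hdet (t, x)

lemma aestronglyMeasurable_internalVariation {I : Measure ℝ} (κ : Kernel ℝ (Space d))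
    [IsMarkovKernel κ] (hκ : ∀ᵐ t ∂I, κ t = μ t) (hac : ∀ᵐ t ∂I, μ t ≪ volume)
    (hξ : ContDiff ℝ 1 ξ) (ε : ℝ) : AEStronglyMeasurable (internalVariation q Ω μ ξ ε) I :=
  aestronglyMeasurable_setIntegral_density_rpow_mul κ hκ hac q Ω
    ((measurable_detFactor q).comp ((measurable_spatialDeriv hξ).const_smul ε))

variable (hξ : ContDiff ℝ 1 ξ) (hL : Lq q Ω (μ t) < ⊤)
  (hlip : ∀ z, IsRelLipschitz C r fun ε => detFactor q (ε • spatialDeriv ξ z))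

include hξ hL

lemma integrableOn_pressureIntegrand (hB : ∀ z, ‖fderiv ℝ ξ z‖ ≤ B) :
    IntegrableOn (pressureIntegrand q μ ξ t) Ω :=
  (integrableOn_density_rpow hL).bdd_mul
    ((measurable_divergence hξ).comp measurable_prodMk_left).aestronglyMeasurable
    (ae_of_all _ fun x => abs_divergence_le (hξ.differentiable one_ne_zero) hB t x)

lemma abs_integral_pressureIntegrand_le (hB : ∀ z, ‖fderiv ℝ ξ z‖ ≤ B) :
    |∫ x in Ω, pressureIntegrand q μ ξ t x| ≤ d * B * (Lq q Ω (μ t)).toReal := by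
  rw [toReal_Lq hL, ← integral_const_mul, ← Real.norm_eq_abs]
  refine norm_integral_le_of_norm_le ((integrableOn_density_rpow hL).const_mul _)
    (ae_of_all _ fun x => ?_)
  rw [pressureIntegrand, norm_mul, Real.norm_of_nonneg (Real.rpow_nonneg (density_nonneg _ x) q)]
  exact mul_le_mul_of_nonneg_right (abs_divergence_le (hξ.differentiable one_ne_zero) hB t x)
    (Real.rpow_nonneg (density_nonneg _ x) q)

include hlip

lemma isRelLipschitz_internalVariation :
    IsRelLipschitz C r fun ε => internalVariation q Ω μ ξ ε t :=
  isRelLipschitz_internalAlong hL ((measurable_spatialDeriv hξ).comp measurable_prodMk_left)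
    fun x => hlip (t, x)

lemma hasDerivAt_internalVariation (hr : 0 < r) :
    HasDerivAt (fun ε => internalVariation q Ω μ ξ ε t)
      ((1 - q) * ∫ x in Ω, pressureIntegrand q μ ξ t x) 0 := by
  have hD : Measurable fun x => spatialDeriv ξ (t, x) :=
    (measurable_spatialDeriv hξ).comp measurable_prodMk_left
  simp only [pressureIntegrand, divergence_eq_trace (hξ.differentiable one_ne_zero)]
  exact hasDerivAt_internalAlong hL hD (fun x => hlip (t, x)) hr

lemma Lq_perturbCurve_le [IsFiniteMeasure (μ t)] (hq : 0 < q) (hΩ : MeasurableSet Ω)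
    (hνΩ : μ t Ωᶜ = 0) (hB : ∀ z, ‖fderiv ℝ ξ z‖ ≤ B) (hεB : |ε| * B < 1)
    (hε : ε ∈ Metric.ball (0 : ℝ) r) (hdet : ∀ z, 0 < (1 + ε • spatialDeriv ξ z).det) :
    Lq q Ω (perturbCurve ξ ε μ t) ≤ ENNReal.ofReal (internalVariation q Ω μ ξ ε t) := by
  have hξd : Differentiable ℝ ξ := hξ.differentiable one_ne_zero
  have hD : Measurable fun x => spatialDeriv ξ (t, x) :=
    (measurable_spatialDeriv hξ).comp measurable_prodMk_left
  obtain ⟨g, hg, hgf, hfg⟩ := exists_measurable_inverse_perturb hξd hB hεB t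
  rw [internalVariation, ofReal_internalAlong hL hD (fun x => hlip (t, x)) hq.le hε
    fun x => hdet (t, x)]
  exact Lq_map_le hq hΩ (absolutelyContinuous_of_Lq_lt_top hL) hνΩ
    (fun x => hasFDerivAt_perturb hξd ε t x) (fun x => (hdet (t, x)).ne')
    ((contDiff_det (n := 0)).continuous.measurable.comp (measurable_const.add (hD.const_smul ε)))
    hg hgf hfg

end Internal

section Kinetic

lemma kineticVariation_nonneg (p : ℝ) (μ : ℝ → Measure (Space d)) (v : ℝ → Space d → Space d)
    (ξ : ℝ × Space d → Space d) (ε t : ℝ) : 0 ≤ kineticVariation p μ v ξ ε t :=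
  kineticAlong_nonneg p _ _ _ ε

lemma aestronglyMeasurable_kineticVariation {I : Measure ℝ} (κ : Kernel ℝ (Space d))
    [IsMarkovKernel κ] (hκ : ∀ᵐ t ∂I, κ t = μ t) (hξ : ContDiff ℝ 1 ξ)
    (hv : Measurable (Function.uncurry v)) (p ε : ℝ) :
    AEStronglyMeasurable (kineticVariation p μ v ξ ε) I :=
  aestronglyMeasurable_kineticAlong κ hκ p hv (measurable_transportDeriv hξ hv) ε

variable (hξ : ContDiff ℝ 1 ξ) (hB : ∀ z, ‖fderiv ℝ ξ z‖ ≤ B)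
  (hv : Measurable (Function.uncurry v)) (hvp : MemLp (v t) (ENNReal.ofReal p) (μ t))

include hξ hB hv hvp

lemma ofReal_kineticVariation [IsFiniteMeasure (μ t)] (hp : 0 < p) (ε : ℝ) :
    ENNReal.ofReal (kineticVariation p μ v ξ ε t) = kinetic p μ (perturbField ξ ε v) t :=
  ofReal_kineticAlong hp hvp
    ((measurable_transportDeriv hξ hv).comp measurable_prodMk_left).aestronglyMeasurable
    (fun x => norm_transportDeriv_le (hξ.differentiable one_ne_zero) hB t x (v t x)) ε

lemma ofReal_kineticVariation_zero [IsFiniteMeasure (μ t)] (hp : 0 < p) :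
    ENNReal.ofReal (kineticVariation p μ v ξ 0 t) = kinetic p μ v t := by
  rw [ofReal_kineticVariation hξ hB hv hvp hp]
  simp only [kinetic, perturbField, zero_smul, add_zero]

lemma isRelLipschitz_kineticVariation [IsProbabilityMeasure (μ t)] (hp : 1 ≤ p) {V₀ : ℝ}
    (hV₀ : 0 < V₀) (hV : ENNReal.ofReal V₀ ≤ kinetic p μ v t) :
    IsRelLipschitz (p * (1 + B) ^ p * 2 ^ (p - 1) * (1 + V₀⁻¹)) 1
      fun ε => kineticVariation p μ v ξ ε t := by
  rw [← ofReal_kineticVariation_zero hξ hB hv hvp (one_pos.trans_le hp),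
    ENNReal.ofReal_le_ofReal_iff (kineticVariation_nonneg p μ v ξ 0 t)] at hV
  exact isRelLipschitz_kineticAlong ((norm_nonneg _).trans (hB 0)) hvp
    ((measurable_transportDeriv hξ hv).comp measurable_prodMk_left).aestronglyMeasurable
    (fun x => norm_transportDeriv_le (hξ.differentiable one_ne_zero) hB t x (v t x)) hp hV₀ hV

lemma hasDerivAt_kineticVariation [IsProbabilityMeasure (μ t)] (hp : 1 < p)
    (hΩ : MeasurableSet Ω) (hμΩ : μ t Ωᶜ = 0) (hac : μ t ≪ volume) :
    IntegrableOn (momentumIntegrand p μ v ξ t) Ω ∧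
    HasDerivAt (fun ε => kineticVariation p μ v ξ ε t)
      (p * ∫ x in Ω, momentumIntegrand p μ v ξ t x) 0 := by
  obtain ⟨hint, hderiv⟩ := hasDerivAt_kineticAlong ((norm_nonneg _).trans (hB 0)) hvp
    ((measurable_transportDeriv hξ hv).comp measurable_prodMk_left).aestronglyMeasurable
    (fun x => norm_transportDeriv_le (hξ.differentiable one_ne_zero) hB t x (v t x)) hp
  rw [← setIntegral_density_mul hΩ hac hμΩ] at hderiv
  have hmomentum : momentumIntegrand p μ v ξ t = fun x =>
      density (μ t) x * (‖v t x‖ ^ (p - 2) * inner ℝ (transportDeriv ξ t x (v t x)) (v t x)) :=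
    funext fun x => mul_assoc _ _ _
  rw [hmomentum]
  exact ⟨(integrable_density_mul hac hint).integrableOn, hderiv⟩

end Kinetic

lemma IsVelocityField.ae_isRelLipschitz_kineticVariation (hv : IsVelocityField p μ v)
    (hμ : IsLipschitzCurve p Ω μ) (hp : 1 ≤ p) (hξ : ContDiff ℝ 1 ξ)
    (hB : ∀ z, ‖fderiv ℝ ξ z‖ ≤ B) {a b V₀ : ℝ} (hsupp : Prod.fst '' tsupport ξ ⊆ Icc a b)
    (hV₀ : 0 < V₀)
    (hV : ∀ᵐ t ∂(volume.restrict (Icc a b)), ENNReal.ofReal V₀ ≤ kinetic p μ v t) :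
    ∀ᵐ t ∂(volume.restrict (Icc (0 : ℝ) 1)),
      IsRelLipschitz (p * (1 + B) ^ p * 2 ^ (p - 1) * (1 + V₀⁻¹)) 1
        fun ε => kineticVariation p μ v ξ ε t := by
  have hB₀ : 0 ≤ B := (norm_nonneg _).trans (hB 0)
  rw [ae_restrict_iff' measurableSet_Icc] at hV
  filter_upwards [ae_restrict_of_ae hV, ae_restrict_mem measurableSet_Icc, hv.memLp]
    with t hVt ht hvp
  have := (hμ.mem t ht).isProb
  by_cases htab : t ∈ Icc a b
  · exact isRelLipschitz_kineticVariation hξ hB hv.measurable hvp hp hV₀ (hVt htab)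
  · have hzero : ∀ x, transportDeriv ξ t x (v t x) = 0 := fun x =>
      transportDeriv_eq_zero (hξ.differentiable one_ne_zero)
        (fun h => htab (hsupp (mem_image_of_mem Prod.fst h))) _
    simp only [kineticVariation, kineticAlong, hzero, smul_zero]
    exact .const (by positivity) _ _

end Variation

lemma ofReal_rpow_mul_rpow {a b α β : ℝ} (ha : 0 ≤ a) (hb : 0 ≤ b) (hα : 0 ≤ α) (hβ : 0 ≤ β) :
    ENNReal.ofReal (a ^ α * b ^ β) = ENNReal.ofReal a ^ α * ENNReal.ofReal b ^ β := by
  rw [ENNReal.ofReal_mul (Real.rpow_nonneg ha α), ENNReal.ofReal_rpow_of_nonneg ha hα,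
    ENNReal.ofReal_rpow_of_nonneg hb hβ]

section EnergyVariation

variable {ξ : ℝ × Space d → Space d} {p q α β B C r ε : ℝ} {Ω : Set (Space d)}
  {μ : ℝ → Measure (Space d)} {v : ℝ → Space d → Space d}

section

variable (hα : 0 ≤ α) (hβ : 0 ≤ β) (hμ : IsLipschitzCurve p Ω μ) (hξ : ContDiff ℝ 1 ξ)
  (hB : ∀ z, ‖fderiv ℝ ξ z‖ ≤ B)
  (hL : ∀ᵐ t ∂(volume.restrict (Icc (0 : ℝ) 1)), Lq q Ω (μ t) < ⊤)

include hα hβ hμ hξ hB hL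

lemma IsTangentField.energy_eq_lintegral_variation (hp : 0 < p) (hv : IsTangentField p μ v) :
    energy p q α β Ω μ = ∫⁻ t in Icc (0 : ℝ) 1, ENNReal.ofReal
      (internalVariation q Ω μ ξ 0 t ^ α * kineticVariation p μ v ξ 0 t ^ β) := by
  rw [energy_eq hp q α β Ω μ v hv, energyOf]
  refine lintegral_congr_ae ?_
  filter_upwards [hL, ae_restrict_mem measurableSet_Icc, hv.velocity.memLp] with t hLt ht hvp
  have := (hμ.mem t ht).isProb
  rw [internalVariation_zero hLt, ofReal_rpow_mul_rpow ENNReal.toReal_nonneg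
    (kineticVariation_nonneg p μ v ξ 0 t) hα hβ, ENNReal.ofReal_toReal hLt.ne,
    ofReal_kineticVariation_zero hξ hB hv.velocity.measurable hvp hp]

lemma IsVelocityField.energy_perturbCurve_le (hp : 1 < p) (hq : 0 < q) (hΩm : MeasurableSet Ω)
    (hv : IsVelocityField p μ v) (hc : HasCompactSupport ξ) (hε₁ : |ε| ≤ 1) (hεB : |ε| * B < 1)
    (hΩ : ∀ t, ∀ x ∈ Ω, perturb ξ ε t x ∈ Ω)
    (hlip : ∀ z, IsRelLipschitz C r fun ε => detFactor q (ε • spatialDeriv ξ z))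
    (hε : ε ∈ Metric.ball (0 : ℝ) r) (hdet : ∀ z, 0 < (1 + ε • spatialDeriv ξ z).det) :
    energy p q α β Ω (WGeod.perturbCurve ξ ε μ) ≤ ∫⁻ t in Icc (0 : ℝ) 1, ENNReal.ofReal
      (internalVariation q Ω μ ξ ε t ^ α * kineticVariation p μ v ξ ε t ^ β) := by
  have hp₀ : 0 < p := one_pos.trans hp
  obtain ⟨κ, _, hκ⟩ := (hμ.perturbCurve hp.le hΩm (hξ.differentiable one_ne_zero) hc hB hε₁
    hΩ).exists_kernel hp.le
  obtain ⟨w, hw, hw_kinetic⟩ := hv.exists_perturbCurve hp.le hμ hξ hc hB hεB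
  obtain ⟨u, hu⟩ := hw.exists_isTangentField hp hκ
  rw [energy_eq hp₀ q α β Ω _ _ hu, energyOf]
  refine lintegral_mono_ae ?_
  filter_upwards [hu.minimal w hw, hL, ae_restrict_mem measurableSet_Icc, hv.memLp]
    with t huw hLt ht hvp
  have := (hμ.mem t ht).isProb
  have hinternal : Lq q Ω (WGeod.perturbCurve ξ ε μ t) ≤
      ENNReal.ofReal (internalVariation q Ω μ ξ ε t) :=
    Lq_perturbCurve_le hξ hLt hlip hq hΩm (hμ.mem t ht).concentrated hB hεB hε hdet
  have hkinetic : kinetic p (WGeod.perturbCurve ξ ε μ) u t ≤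
      ENNReal.ofReal (kineticVariation p μ v ξ ε t) := by
    rw [ofReal_kineticVariation hξ hB hv.measurable hvp hp₀, ← hw_kinetic, kinetic_eq hp₀,
      kinetic_eq hp₀]
    gcongr
  rw [ofReal_rpow_mul_rpow (internalVariation_nonneg hdet) (kineticVariation_nonneg p μ v ξ ε t)
    hα hβ]
  gcongr

lemma IsMinimizer.isLocalMin_integral_variation (hp : 1 < p) (hq : 0 < q)
    (hΩm : MeasurableSet Ω) {μ₀ μ₁ : Measure (Space d)} (hmin : IsMinimizer p q α β Ω μ₀ μ₁ μ)
    (hv : IsTangentField p μ v) (hc : HasCompactSupport ξ)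
    (hsub : tsupport ξ ⊆ Ioo (0 : ℝ) 1 ×ˢ interior Ω)
    (hlip : ∀ z, IsRelLipschitz C r fun ε => detFactor q (ε • spatialDeriv ξ z)) (hr : 0 < r)
    (hdet : ∀ ε ∈ Metric.ball (0 : ℝ) r, ∀ z, 0 < (1 + ε • spatialDeriv ξ z).det)
    (hint : ∀ᶠ ε in 𝓝 (0 : ℝ), IntegrableOn (fun t =>
      internalVariation q Ω μ ξ ε t ^ α * kineticVariation p μ v ξ ε t ^ β) (Icc (0 : ℝ) 1)) :
    IsLocalMin (fun ε => ∫ t in Icc (0 : ℝ) 1,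
      internalVariation q Ω μ ξ ε t ^ α * kineticVariation p μ v ξ ε t ^ β) 0 := by
  have hnonneg : ∀ ε ∈ Metric.ball (0 : ℝ) r, ∀ t,
      0 ≤ internalVariation q Ω μ ξ ε t ^ α * kineticVariation p μ v ξ ε t ^ β := fun ε hε t =>
    mul_nonneg (Real.rpow_nonneg (internalVariation_nonneg (hdet ε hε)) α)
      (Real.rpow_nonneg (kineticVariation_nonneg p μ v ξ ε t) β)
  have hsmall₁ : ∀ᶠ ε : ℝ in 𝓝 0, |ε| ≤ 1 :=
    (ContinuousAt.eventually_lt (by fun_prop) continuousAt_const (by simp)).mono fun _ => le_of_lt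
  have hsmall_B : ∀ᶠ ε : ℝ in 𝓝 0, |ε| * B < 1 :=
    ContinuousAt.eventually_lt (by fun_prop) continuousAt_const (by simp)
  filter_upwards [Metric.ball_mem_nhds 0 hr, hsmall₁, hsmall_B, hint,
    eventually_forall_perturb_mem hξ.continuous hc (hsub.trans (prod_mono (subset_univ _) le_rfl))]
    with ε hε hε₁ hεB hint_ε hΩ
  have hadm : IsAdmissible p Ω μ₀ μ₁ (perturbCurve ξ ε μ) :=
    hmin.admissible.perturbCurve hp.le hΩm (hξ.differentiable one_ne_zero) hc
      (hsub.trans (prod_mono le_rfl (subset_univ _))) hB hε₁ hΩ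
  have henergy := (hmin.le _ hadm).trans <| hv.velocity.energy_perturbCurve_le hα hβ hμ hξ hB hL hp
    hq hΩm hc hε₁ hεB hΩ hlip hε (hdet ε hε)
  rwa [hv.energy_eq_lintegral_variation hα hβ hμ hξ hB hL (one_pos.trans hp),
    ← ofReal_integral_eq_lintegral_ofReal hint.self_of_nhds
      (ae_of_all _ (hnonneg 0 (Metric.mem_ball_self hr))),
    ← ofReal_integral_eq_lintegral_ofReal hint_ε (ae_of_all _ (hnonneg ε hε)),
    ENNReal.ofReal_le_ofReal_iff (integral_nonneg (hnonneg ε hε))] at henergy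

end

end EnergyVariation

section FirstVariation

variable {ξ : ℝ × Space d → Space d} {p q α β B C r : ℝ} {Ω : Set (Space d)}
  {μ : ℝ → Measure (Space d)} {v : ℝ → Space d → Space d}

lemma exists_isRelLipschitz_variation (hp : 1 ≤ p) (hμ : IsLipschitzCurve p Ω μ)
    (hv : IsVelocityField p μ v) (hξ : ContDiff ℝ 1 ξ) (hc : HasCompactSupport ξ)
    (hsub : tsupport ξ ⊆ Ioo (0 : ℝ) 1 ×ˢ univ) (hB : ∀ z, ‖fderiv ℝ ξ z‖ ≤ B)
    (hV : ∀ a b : ℝ, 0 < a → a < b → b < 1 → ∃ V₀ : ℝ, 0 < V₀ ∧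
      ∀ᵐ t ∂(volume.restrict (Icc a b)), ENNReal.ofReal V₀ ≤ kinetic p μ v t) (q : ℝ) :
    ∃ C r : ℝ, 0 ≤ C ∧ 0 < r ∧
      (∀ ε ∈ Metric.ball (0 : ℝ) r, ∀ z, 0 < (1 + ε • spatialDeriv ξ z).det) ∧
      (∀ z, IsRelLipschitz C r fun ε => detFactor q (ε • spatialDeriv ξ z)) ∧
      ∀ᵐ t ∂(volume.restrict (Icc (0 : ℝ) 1)),
        IsRelLipschitz C r fun ε => kineticVariation p μ v ξ ε t := by
  obtain ⟨C₁, r₁, hC₁, hr₁, hdet⟩ := exists_isRelLipschitz_detFactor_smul (Space d) q B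
  obtain ⟨a, b, ha, hab, hb, hsupp⟩ :=
    exists_subset_Icc_of_isCompact one_pos (hc.isCompact.image continuous_fst)
      (image_subset_iff.2 fun z hz => (hsub hz).1)
  obtain ⟨V₀, hV₀, hV⟩ := hV a b ha hab hb
  have hkinetic := hv.ae_isRelLipschitz_kineticVariation hμ hp hξ hB hsupp hV₀ hV
  have hbound : ∀ z, ‖spatialDeriv ξ z‖ ≤ B := norm_spatialDeriv_le hB
  refine ⟨max C₁ (p * (1 + B) ^ p * 2 ^ (p - 1) * (1 + V₀⁻¹)), min r₁ 1,
    hC₁.trans (le_max_left _ _), lt_min hr₁ one_pos, fun ε hε z => ?_, fun z => ?_, ?_⟩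
  · exact (hdet _ (hbound z)).1 ε (Metric.ball_subset_ball (min_le_left _ _) hε)
  · exact (hdet _ (hbound z)).2.mono (le_max_left _ _) (min_le_left _ _)
  · exact hkinetic.mono fun t ht => ht.mono (le_max_right _ _) (min_le_right _ _)

section

variable (hμ : IsLipschitzCurve p Ω μ) (hξ : ContDiff ℝ 1 ξ) (hB : ∀ z, ‖fderiv ℝ ξ z‖ ≤ B)
  (hL : ∀ᵐ t ∂(volume.restrict (Icc (0 : ℝ) 1)), Lq q Ω (μ t) < ⊤)

include hμ hξ hB

lemma IsVelocityField.ae_kineticVariation_zero (hp : 0 < p) (hv : IsVelocityField p μ v) :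
    ∀ᵐ t ∂(volume.restrict (Icc (0 : ℝ) 1)),
      kineticVariation p μ v ξ 0 t = (kinetic p μ v t).toReal := by
  filter_upwards [ae_restrict_mem measurableSet_Icc, hv.memLp] with t ht hvp
  have := (hμ.mem t ht).isProb
  rw [← ofReal_kineticVariation_zero hξ hB hv.measurable hvp hp,
    ENNReal.toReal_ofReal (kineticVariation_nonneg p μ v ξ 0 t)]

include hL

lemma IsVelocityField.ae_integrableOn_pressureIntegrand_and_momentumIntegrand (hp : 1 < p)
    (hΩ : MeasurableSet Ω) (hv : IsVelocityField p μ v) :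
    ∀ᵐ t ∂(volume.restrict (Icc (0 : ℝ) 1)),
      IntegrableOn (pressureIntegrand q μ ξ t) Ω ∧
        IntegrableOn (momentumIntegrand p μ v ξ t) Ω := by
  filter_upwards [hL, ae_restrict_mem measurableSet_Icc, hv.memLp] with t hLt ht hvp
  have := (hμ.mem t ht).isProb
  exact ⟨integrableOn_pressureIntegrand hξ hLt hB, (hasDerivAt_kineticVariation hξ hB hv.measurable
    hvp hp hΩ (hμ.mem t ht).concentrated (absolutelyContinuous_of_Lq_lt_top hLt)).1⟩

lemma IsTangentField.integrableOn_variation_zero (hp : 1 ≤ p) (hα : 0 ≤ α) (hβ : 0 ≤ β)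
    (hv : IsTangentField p μ v) (hfin : energy p q α β Ω μ < ⊤) :
    IntegrableOn (fun t => internalVariation q Ω μ ξ 0 t ^ α * kineticVariation p μ v ξ 0 t ^ β)
      (Icc (0 : ℝ) 1) := by
  obtain ⟨κ, _, hκ⟩ := hμ.exists_kernel hp
  have hκ : ∀ᵐ t ∂(volume.restrict (Icc (0 : ℝ) 1)), κ t = μ t :=
    ae_restrict_of_forall_mem measurableSet_Icc hκ
  have hinternal := aestronglyMeasurable_internalVariation (q := q) (Ω := Ω) κ hκ
    (hL.mono fun t => absolutelyContinuous_of_Lq_lt_top) hξ 0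
  have hkinetic := aestronglyMeasurable_kineticVariation κ hκ hξ hv.velocity.measurable p 0
  refine ⟨(hinternal.aemeasurable.pow_const α).aestronglyMeasurable.mul
    (hkinetic.aemeasurable.pow_const β).aestronglyMeasurable, ?_⟩
  have hnonneg : ∀ᵐ t ∂(volume.restrict (Icc (0 : ℝ) 1)),
      0 ≤ internalVariation q Ω μ ξ 0 t ^ α * kineticVariation p μ v ξ 0 t ^ β := by
    filter_upwards [hL] with t hLt
    rw [internalVariation_zero hLt]
    exact mul_nonneg (Real.rpow_nonneg ENNReal.toReal_nonneg α)
      (Real.rpow_nonneg (kineticVariation_nonneg p μ v ξ 0 t) β)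
  rwa [hasFiniteIntegral_iff_ofReal hnonneg,
    ← hv.energy_eq_lintegral_variation hα hβ hμ hξ hB hL (one_pos.trans_le hp)]

variable (hint : IntegrableOn (fun t =>
  internalVariation q Ω μ ξ 0 t ^ α * kineticVariation p μ v ξ 0 t ^ β) (Icc (0 : ℝ) 1))

include hint

lemma IsVelocityField.integrableOn_pressureTerm (hp : 1 ≤ p) (hv : IsVelocityField p μ v) :
    IntegrableOn (pressureTerm p q α β Ω μ v ξ) (Icc (0 : ℝ) 1) := by
  obtain ⟨κ, _, hκ⟩ := hμ.exists_kernel hp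
  have hκ : ∀ᵐ t ∂(volume.restrict (Icc (0 : ℝ) 1)), κ t = μ t :=
    ae_restrict_of_forall_mem measurableSet_Icc hκ
  have hac := hL.mono fun t => absolutelyContinuous_of_Lq_lt_top
  have hzero := hv.ae_kineticVariation_zero hμ hξ hB (one_pos.trans_le hp)
  have hkinetic := ((aestronglyMeasurable_kineticVariation κ hκ hξ hv.measurable p 0).congr
    hzero).aemeasurable
  have hpressure : AEStronglyMeasurable (fun t => ∫ x in Ω, pressureIntegrand q μ ξ t x)
      (volume.restrict (Icc (0 : ℝ) 1)) := by
    simp only [pressureIntegrand, mul_comm (divergence ξ _ _)]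
    exact aestronglyMeasurable_setIntegral_density_rpow_mul κ hκ hac q Ω (measurable_divergence hξ)
  refine (hint.const_mul (d * B)).mono' (((((aemeasurable_Lq κ hκ q Ω).ennreal_toReal.pow_const
    (α - 1)).mul (hkinetic.pow_const β)).aestronglyMeasurable).mul hpressure) ?_
  filter_upwards [hL, hzero] with t hLt hVt
  have hrpow : ∀ x : ℝ, 0 ≤ x → x ^ (α - 1) * x ≤ x ^ α := fun x hx => by
    rcases hx.eq_or_lt with rfl | hx
    · simpa using Real.rpow_nonneg le_rfl α
    · rw [Real.rpow_sub_one hx.ne', div_mul_cancel₀ _ hx.ne']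
  have hdB : 0 ≤ d * B := mul_nonneg d.cast_nonneg ((norm_nonneg _).trans (hB 0))
  rw [hVt, internalVariation_zero hLt, pressureTerm, norm_mul, Real.norm_eq_abs (∫ _ in _, _),
    Real.norm_of_nonneg (by positivity)]
  calc (Lq q Ω (μ t)).toReal ^ (α - 1) * (kinetic p μ v t).toReal ^ β *
        |∫ x in Ω, pressureIntegrand q μ ξ t x|
      ≤ (Lq q Ω (μ t)).toReal ^ (α - 1) * (kinetic p μ v t).toReal ^ β *
        (d * B * (Lq q Ω (μ t)).toReal) := by
        gcongr; exact abs_integral_pressureIntegrand_le hξ hLt hB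
    _ = d * B * ((Lq q Ω (μ t)).toReal ^ (α - 1) * (Lq q Ω (μ t)).toReal *
        (kinetic p μ v t).toReal ^ β) := by ring
    _ ≤ d * B * ((Lq q Ω (μ t)).toReal ^ α * (kinetic p μ v t).toReal ^ β) := by
        gcongr; exact hrpow _ ENNReal.toReal_nonneg

lemma IsVelocityField.hasDerivAt_integral_variation (hp : 1 < p) (hα : α ≠ 0) (hβ : β ≠ 0)
    (hC : 0 ≤ C) (hr : 0 < r) (hΩ : MeasurableSet Ω) (hv : IsVelocityField p μ v)
    (hlip : ∀ z, IsRelLipschitz C r fun ε => detFactor q (ε • spatialDeriv ξ z))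
    (hkinetic : ∀ᵐ t ∂(volume.restrict (Icc (0 : ℝ) 1)),
      IsRelLipschitz C r fun ε => kineticVariation p μ v ξ ε t) :
    (∀ᶠ ε in 𝓝 (0 : ℝ), IntegrableOn (fun t =>
      internalVariation q Ω μ ξ ε t ^ α * kineticVariation p μ v ξ ε t ^ β) (Icc (0 : ℝ) 1)) ∧
    IntegrableOn (fun t => α * (1 - q) * pressureTerm p q α β Ω μ v ξ t +
      p * β * momentumTerm p q α β Ω μ v ξ t) (Icc (0 : ℝ) 1) ∧
    HasDerivAt (fun ε => ∫ t in Icc (0 : ℝ) 1,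
        internalVariation q Ω μ ξ ε t ^ α * kineticVariation p μ v ξ ε t ^ β)
      (∫ t in Icc (0 : ℝ) 1, α * (1 - q) * pressureTerm p q α β Ω μ v ξ t +
        p * β * momentumTerm p q α β Ω μ v ξ t) 0 := by
  obtain ⟨κ, _, hκ⟩ := hμ.exists_kernel hp.le
  have hκ : ∀ᵐ t ∂(volume.restrict (Icc (0 : ℝ) 1)), κ t = μ t :=
    ae_restrict_of_forall_mem measurableSet_Icc hκ
  have hac := hL.mono fun t => absolutelyContinuous_of_Lq_lt_top
  have hkinetic_deriv : ∀ᵐ t ∂(volume.restrict (Icc (0 : ℝ) 1)), HasDerivAt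
      (fun ε => kineticVariation p μ v ξ ε t) (p * ∫ x in Ω, momentumIntegrand p μ v ξ t x) 0 := by
    filter_upwards [ae_restrict_mem measurableSet_Icc, hv.memLp, hac] with t ht hvp hact
    have := (hμ.mem t ht).isProb
    exact (hasDerivAt_kineticVariation hξ hB hv.measurable hvp hp hΩ
      (hμ.mem t ht).concentrated hact).2
  obtain ⟨hint_ε, hint', hderiv⟩ := hasDerivAt_integral_rpow_mul_rpow hα hβ hC hr
    (fun ε _ => aestronglyMeasurable_internalVariation κ hκ hac hξ ε)
    (fun ε _ => aestronglyMeasurable_kineticVariation κ hκ hξ hv.measurable p ε)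
    (hL.mono fun t ht => (internalVariation_zero ht).symm ▸ ENNReal.toReal_nonneg)
    (ae_of_all _ (kineticVariation_nonneg p μ v ξ 0))
    (hL.mono fun t ht => isRelLipschitz_internalVariation hξ ht hlip) hkinetic
    (hL.mono fun t ht => hasDerivAt_internalVariation hξ ht hlip hr) hkinetic_deriv hint
  refine ⟨hint_ε, hint'.congr ?hae, (integral_congr_ae ?hae) ▸ hderiv⟩
  filter_upwards [hL, hv.ae_kineticVariation_zero hμ hξ hB (one_pos.trans hp)] with t hLt hVt
  rw [internalVariation_zero hLt, hVt, pressureTerm, momentumTerm]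
  ring

end

theorem IsMinimizer.firstVariation (hp : 1 < p) (hq : 0 < q) (hα : 0 < α) (hβ : 0 < β)
    (hΩ : MeasurableSet Ω) {μ₀ μ₁ : Measure (Space d)} (hμ : IsMinimizer p q α β Ω μ₀ μ₁ μ)
    (hfin : energy p q α β Ω μ < ⊤) (hv : IsTangentField p μ v)
    (hV : ∀ a b : ℝ, 0 < a → a < b → b < 1 → ∃ V₀ : ℝ, 0 < V₀ ∧
      ∀ᵐ t ∂(volume.restrict (Icc a b)), ENNReal.ofReal V₀ ≤ kinetic p μ v t)
    (hL : ∀ᵐ t ∂(volume.restrict (Icc (0 : ℝ) 1)), Lq q Ω (μ t) < ⊤)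
    (hξ : ContDiff ℝ 1 ξ) (hc : HasCompactSupport ξ)
    (hsub : tsupport ξ ⊆ Ioo (0 : ℝ) 1 ×ˢ interior Ω) :
    (∀ᵐ t ∂(volume.restrict (Icc (0 : ℝ) 1)),
      IntegrableOn (pressureIntegrand q μ ξ t) Ω ∧ IntegrableOn (momentumIntegrand p μ v ξ t) Ω) ∧
    IntegrableOn (pressureTerm p q α β Ω μ v ξ) (Icc (0 : ℝ) 1) ∧
    IntegrableOn (momentumTerm p q α β Ω μ v ξ) (Icc (0 : ℝ) 1) ∧
    (α * (1 - q) * (∫ t in Icc (0 : ℝ) 1, pressureTerm p q α β Ω μ v ξ t)) +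
      (p * β * (∫ t in Icc (0 : ℝ) 1, momentumTerm p q α β Ω μ v ξ t)) = 0 := by
  have hcurve := hμ.admissible.curve
  obtain ⟨B, hB⟩ :=
    (hc.fderiv ℝ).exists_bound_of_continuous (hξ.continuous_fderiv one_ne_zero)
  obtain ⟨C, r, hC, hr, hdet, hlip, hkinetic⟩ := exists_isRelLipschitz_variation hp.le hcurve
    hv.velocity hξ hc (hsub.trans (prod_mono le_rfl (subset_univ _))) hB hV q
  have hint := hv.integrableOn_variation_zero hcurve hξ hB hL hp.le hα.le hβ.le hfin
  obtain ⟨hint_ε, hint_sum, hderiv⟩ := hv.velocity.hasDerivAt_integral_variation hcurve hξ hB hL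
    hint hp hα.ne' hβ.ne' hC hr hΩ hlip hkinetic
  have hmin := hμ.isLocalMin_integral_variation hα.le hβ.le hcurve hξ hB hL hp hq hΩ hv hc hsub
    hlip hr hdet hint_ε
  have hpressure := hv.velocity.integrableOn_pressureTerm hcurve hξ hB hL hint hp.le
  have hmomentum : IntegrableOn (momentumTerm p q α β Ω μ v ξ) (Icc (0 : ℝ) 1) := by
    have hpβ : p * β ≠ 0 := (mul_pos (one_pos.trans hp) hβ).ne'
    refine (integrable_const_mul_iff hpβ.isUnit _).1 ?_
    exact (hint_sum.sub (hpressure.const_mul (α * (1 - q)))).congr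
      (ae_of_all _ fun t => add_sub_cancel_left _ _)
  refine ⟨hv.velocity.ae_integrableOn_pressureIntegrand_and_momentumIntegrand hcurve hξ hB hL hp hΩ,
    hpressure, hmomentum, ?_⟩
  rw [← integral_const_mul, ← integral_const_mul,
    ← integral_add (hpressure.const_mul _) (hmomentum.const_mul _)]
  exact hmin.hasDerivAt_eq_zero hderiv

end FirstVariation

end WGeod

theorem mainTheorem2_general (d : ℕ) (p q α β : ℝ) (hp : 1 < p) (hq : 0 < q) (hα : 0 < α)
    (hβ : 0 < β) (Ω : Set (WGeod.Space d)) (hΩ : MeasurableSet Ω)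
    (μ₀ μ₁ : Measure (WGeod.Space d)) (μ : ℝ → Measure (WGeod.Space d))
    (hμ : WGeod.IsMinimizer p q α β Ω μ₀ μ₁ μ)
    (hfin : WGeod.energy p q α β Ω μ < ⊤)
    (v : ℝ → WGeod.Space d → WGeod.Space d) (hv : WGeod.IsTangentField p μ v)
    (hV : ∀ a b : ℝ, 0 < a → a < b → b < 1 → ∃ V₀ : ℝ, 0 < V₀ ∧
      ∀ᵐ t ∂(volume.restrict (Icc a b)), ENNReal.ofReal V₀ ≤ WGeod.kinetic p μ v t) :
    (∀ᵐ t ∂(volume.restrict (Icc (0 : ℝ) 1)), μ t ≪ volume) ∧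
    ∀ ξ : ℝ × WGeod.Space d → WGeod.Space d, ContDiff ℝ 1 ξ → HasCompactSupport ξ →
      tsupport ξ ⊆ Ioo (0 : ℝ) 1 ×ˢ interior Ω →
      (∀ᵐ t ∂(volume.restrict (Icc (0 : ℝ) 1)),
        IntegrableOn (WGeod.pressureIntegrand q μ ξ t) Ω ∧
        IntegrableOn (WGeod.momentumIntegrand p μ v ξ t) Ω) ∧
      IntegrableOn (WGeod.pressureTerm p q α β Ω μ v ξ) (Icc (0 : ℝ) 1) ∧
      IntegrableOn (WGeod.momentumTerm p q α β Ω μ v ξ) (Icc (0 : ℝ) 1) ∧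
      (α * (1 - q) * (∫ t in Icc (0 : ℝ) 1, WGeod.pressureTerm p q α β Ω μ v ξ t)) +
        (p * β * (∫ t in Icc (0 : ℝ) 1, WGeod.momentumTerm p q α β Ω μ v ξ t)) = 0 := by
  obtain ⟨κ, _, hκ⟩ := hμ.admissible.curve.exists_kernel hp.le
  have hpos : ∀ᵐ t ∂(volume.restrict (Icc (0 : ℝ) 1)), 0 < WGeod.kinetic p μ v t :=
    WGeod.ae_Icc_of_forall_ae_Icc fun a b ha hab hb => by
      obtain ⟨V₀, hV₀, hV⟩ := hV a b ha hab hb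
      exact hV.mono fun t ht => (ENNReal.ofReal_pos.2 hV₀).trans_le ht
  have hL : ∀ᵐ t ∂(volume.restrict (Icc (0 : ℝ) 1)), WGeod.Lq q Ω (μ t) < ⊤ :=
    WGeod.ae_Lq_lt_top hα hβ hv.velocity.measurable κ
      (ae_restrict_of_forall_mem measurableSet_Icc hκ)
      (WGeod.energy_eq (one_pos.trans hp) q α β Ω μ v hv ▸ hfin) hpos
  exact ⟨hL.mono fun t => WGeod.absolutelyContinuous_of_Lq_lt_top, fun ξ hξ hc hsub =>
    hμ.firstVariation hp hq hα hβ hΩ hfin hv hV hL hξ hc hsub⟩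

theorem mainTheorem2 (d : ℕ) (p q α β : ℝ) (hp : 1 < p) (hq : 1 < q) (hα : 0 < α) (hβ : 0 < β)
    (Ω : Set (WGeod.Space d)) (hΩ_closed : IsClosed Ω) (hΩ_convex : Convex ℝ Ω)
    (μ₀ μ₁ : Measure (WGeod.Space d)) (μ : ℝ → Measure (WGeod.Space d))
    (hμ : WGeod.IsMinimizer p q α β Ω μ₀ μ₁ μ)
    (hfin : WGeod.energy p q α β Ω μ < ⊤)
    (v : ℝ → WGeod.Space d → WGeod.Space d) (hv : WGeod.IsTangentField p μ v)
    (hV : ∀ a b : ℝ, 0 < a → a < b → b < 1 → ∃ V₀ : ℝ, 0 < V₀ ∧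
      ∀ᵐ t ∂(volume.restrict (Icc a b)), ENNReal.ofReal V₀ ≤ WGeod.kinetic p μ v t) :
    (∀ᵐ t ∂(volume.restrict (Icc (0 : ℝ) 1)), μ t ≪ volume) ∧
    ∀ ξ : ℝ × WGeod.Space d → WGeod.Space d, ContDiff ℝ ∞ ξ → HasCompactSupport ξ →
      tsupport ξ ⊆ Ioo (0 : ℝ) 1 ×ˢ interior Ω →
      (∀ᵐ t ∂(volume.restrict (Icc (0 : ℝ) 1)),
        IntegrableOn (WGeod.pressureIntegrand q μ ξ t) Ω ∧
        IntegrableOn (WGeod.momentumIntegrand p μ v ξ t) Ω) ∧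
      IntegrableOn (WGeod.pressureTerm p q α β Ω μ v ξ) (Icc (0 : ℝ) 1) ∧
      IntegrableOn (WGeod.momentumTerm p q α β Ω μ v ξ) (Icc (0 : ℝ) 1) ∧
      (α * (1 - q) * (∫ t in Icc (0 : ℝ) 1, WGeod.pressureTerm p q α β Ω μ v ξ t)) +
        (p * β * (∫ t in Icc (0 : ℝ) 1, WGeod.momentumTerm p q α β Ω μ v ξ t)) = 0 :=
  mainTheorem2_general d p q α β hp (one_pos.trans hq) hα hβ Ω hΩ_closed.measurableSet μ₀ μ₁ μ hμ
    hfin v hv hV |>.imp_right fun h ξ hξ => h ξ (hξ.of_le (by simp))
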